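/- Let $\mathbb{K}$ be a field of characteristic $0$. **Dir-inv modules.** A dir-inv $\mathbb{K}$-module is a module $M$ with a direct system of submodules $\{F_jM\}_{j\in J}$ indexed by a nonempty directed set, each $F_jM$ being equipped with an inverse system of submodules $\{F^iF_jM\}_{i\in\mathbb{N}}$, such that the inclusions $F_{j}M\subset F_{j'}M$ ($j\le j'$) are continuous. A linear map $\phi:M\to N$ is continuous if for every $j$ there is $k$ with $\phi(F_jM)\subset F_kN$ and for every $i$ there is $i'$ with $\phi(F^{i'}F_jM)\subset F^iF_kN$. A bilinear map $\mu : M\times N\to P$ is continuous if for all $j,k$ there is $l$ such that $\mu$ restricts to a map $F_jM\times F_kN\to F_lP$ that is continuous for the linear topologies defined by the inverse systems. $M$ is complete if it is isomorphic, as a dir-inv module, to one for which all maps $F_jM\to\lim_{\leftarrow i}F_jM/F^iF_jM$ are bijective and $M=\bigcup_jF_jM$. The completion of $M$ is $\widehat M=\lim_{j\to}\lim_{\leftarrow i}F_jM/F^iF_jM$. For a module $V$, regarded as a discrete inv module, $V\mathbin{\widehat\otimes}M$ is the completion of $V\otimes M$ for the dir-inv structure $F_j=V\otimes F_jM$, $F^iF_j=V\otimes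 F^iF_jM$. **The data.** Let $A=\{A^q\}_{q\in\mathbb{N}}$ be a cosimplicial DG algebra in dir-inv $\mathbb{K}$-modules: each $A^q=\bigoplus_{i\in\mathbb{Z}}A^{q,i}$ is a DG $\mathbb{K}$-algebra (not necessarily associative, commutative or unital) whose components $A^{q,i}$ are dir-inv modules and whose differential and multiplication are continuous, and for every order preserving $\alpha:[p]\to[q]$ there is a continuous homomorphism of DG algebras $\alpha^*:A^p\to A^q$, functorially in $\alpha$. Assume that all the $A^{q}$ (that is, all the $A^{q,i}$) are complete. **The two normalizations.** Let $\Omega(\Delta^l)$ be the DG algebra of polynomial differential forms on the simplex $\operatorname{Spec}\mathbb{K}[t_0,\dots,t_l]/(t_0+\dots+t_l-1)$. * $\widehat{\widetilde{\mathrm N}}{}^{p}A^{\cdot,i}\subset\prod_{l}\Omega^p(\Delta^l)\mathbin{\widehat\otimes}A^{l,i}$ is the module of the sequences $(u_l)$ with $(1\otimes\alpha^*)(u_k)=(\alpha_*\otimes1)(u_l)$ for all $\alpha:[k]\to[l]$. The DG algebra $\widehat{\widetilde{\mathrm N}}A$ has degree $n$ component $\bigoplus_{p+i=n}\widehat{\widetilde{\mathrm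 N}}{}^pA^{\cdot,i}$, with $\mathrm d(\omega\otimes a)=\mathrm d\omega\otimes a+(-1)^p\omega\otimes\mathrm da$ and $(\omega\otimes a)(\eta\otimes b)=(-1)^{iq}(\omega\wedge\eta)\otimes ab$ for $\omega\in\Omega^p$, $a$ of degree $i$, $\eta\in\Omega^q$. * $\mathrm N^pA^{\cdot,i}\subset A^{p,i}$ is the common kernel of the co-degeneracy maps. The DG algebra $\mathrm NA$ has degree $n$ component $\bigoplus_{p+i=n}\mathrm N^pA^{\cdot,i}$, the differential $\partial+(-1)^p\mathrm d$ on $\mathrm N^pA^{\cdot,i}$, where $\partial=\sum_{k=0}^{p+1}(-1)^k\partial^k$, and the Alexander–Whitney product $a\cdot b=(-1)^{iq}f^*(a)\,g^*(b)$ for $a\in\mathrm N^pA^{\cdot,i}$, $b\in\mathrm N^qA^{\cdot,j}$, where $f:[p]\to[p+q]$, $f(x)=x$, and $g:[q]\to[p+q]$, $g(x)=p+x$. Since $A^{p,i}$ is complete, integration of forms over the simplex, normalized by $\int_{\Delta^p}\mathrm dt_1\wedge\dots\wedge\mathrm dt_p=\frac1{p!}$, gives linear maps $\int_{\Delta^p}:\Omega^p(\Delta^p)\mathbin{\widehat\otimes}A^{p,i}\to\mathbb{K}\mathbin{\widehat\otimes}A^{p,i}\cong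 A^{p,i}$. Let $\int_\Delta$ be the map that sends $(u_l)_l\in\widehat{\widetilde{\mathrm N}}{}^pA^{\cdot,i}$ to $\int_{\Delta^p}u_p\in\mathrm N^pA^{\cdot,i}$. **Proposition.** The map $\int_\Delta:\widehat{\widetilde{\mathrm N}}A\to\mathrm NA$ is a homomorphism of DG $\mathbb{K}$-modules, and the induced map in cohomology $$\mathrm H\Bigl(\int_\Delta\Bigr):\mathrm H\widehat{\widetilde{\mathrm N}}A\xrightarrow{\ \simeq\ }\mathrm H\,\mathrm NA$$ is an isomorphism of graded algebras. -/

import Mathlib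

open scoped TensorProduct

noncomputable section

universe u v v' v'' w w'

namespace ThomSullivan

/-! ### Polynomial differential forms on the geometric simplices -/

section Forms

variable (K : Type u) [Field K]

/-- The coordinate ring `K[t_0, …, t_l] / (t_0 + ⋯ + t_l - 1)` of the geometric `l`-simplex, in the
coordinates `t_1, …, t_l`: the variable `X j` (`j : Fin l`) is `t_{j+1}`, and
`t_0 = 1 - t_1 - ⋯ - t_l`. -/
abbrev SimplexRing (l : ℕ) : Type u := MvPolynomial (Fin l) K

/-- The barycentric coordinate functions `t_0, …, t_l`. -/
def bary (l : ℕ) : Fin (l + 1) → SimplexRing K l :=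
  Fin.cons (1 - ∑ j, MvPolynomial.X j) MvPolynomial.X

/-- The space spanned by `dt_1, …, dt_l`; the basis vector `Pi.single j 1` is `dt_{j+1}`. -/
abbrev Cotangent (l : ℕ) : Type u := Fin l → K

/-- The differentials `dt_0, …, dt_l`. -/
def dbary (l : ℕ) : Fin (l + 1) → Cotangent K l :=
  Fin.cons (-∑ j, Pi.single j 1) (fun j => Pi.single j 1)

/-- `Ω^p` of the geometric `l`-simplex: the differential `p`-forms with polynomial coefficients,
that is, the free module over the coordinate ring on the `p`-fold exterior products of
`dt_1, …, dt_l`. -/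
abbrev Form (l p : ℕ) : Type u := SimplexRing K l ⊗[K] (⋀[K]^p (Cotangent K l))

variable {K}

/-- The multiplication `⋀^p E × ⋀^q E → ⋀^r E` for `p + q = r`. -/
def extMul {E : Type u} [AddCommGroup E] [Module K E] (p q r : ℕ) (h : p + q = r) :
    ⋀[K]^p E →ₗ[K] ⋀[K]^q E →ₗ[K] ⋀[K]^r E :=
  LinearMap.mk₂ K
    (fun x y => ⟨(x : ExteriorAlgebra K E) * y, by
      subst h
      rw [ExteriorAlgebra.exteriorPower, pow_add]
      exact Submodule.mul_mem_mul x.2 y.2⟩)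
    (fun _ _ _ => Subtype.ext (add_mul _ _ _))
    (fun _ _ _ => Subtype.ext (smul_mul_assoc _ _ _))
    (fun _ _ _ => Subtype.ext (mul_add _ _ _))
    (fun _ _ _ => Subtype.ext (mul_smul_comm _ _ _))

/-- A vector as an element of the first exterior power. -/
def extOne {E : Type u} [AddCommGroup E] [Module K E] : E →ₗ[K] ⋀[K]^1 E :=
  (ExteriorAlgebra.ι K).codRestrict _ fun e => by
    rw [ExteriorAlgebra.exteriorPower, pow_one]; exact LinearMap.mem_range_self _ e

@[simp] theorem coe_extMul {E : Type u} [AddCommGroup E] [Module K E] (p q r : ℕ) (h : p + q = r)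
    (x : ⋀[K]^p E) (y : ⋀[K]^q E) :
    (extMul p q r h x y : ExteriorAlgebra K E) = (x : ExteriorAlgebra K E) * y := rfl

@[simp] theorem coe_extOne {E : Type u} [AddCommGroup E] [Module K E] (e : E) :
    (extOne (K := K) e : ExteriorAlgebra K E) = ExteriorAlgebra.ι K e := rfl

/-- The wedge product of forms, `(f ω) ∧ (g η) = (f g) (ω ∧ η)`. -/
def Form.mul (l p q r : ℕ) (h : p + q = r) : Form K l p →ₗ[K] Form K l q →ₗ[K] Form K l r :=
  TensorProduct.map₂ (LinearMap.mul K (SimplexRing K l)) (extMul p q r h)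

/-- The exterior derivative `d (f ω) = ∑_j (∂f/∂t_j) dt_j ∧ ω`. -/
def Form.d (l p p' : ℕ) (h : p + 1 = p') : Form K l p →ₗ[K] Form K l p' :=
  ∑ j : Fin l, TensorProduct.map (MvPolynomial.pderiv j).toLinearMap
    (extMul 1 p p' (by omega) (extOne (Pi.single j 1)))

/-- The pull back of functions along the linear morphism `Δ^k → Δ^l` that is `α` on the vertices:
`t_j ↦ ∑_{α i = j} t_i`. -/
def pullRing {k l : ℕ} (α : Fin (k + 1) →o Fin (l + 1)) : SimplexRing K l →ₐ[K] SimplexRing K k :=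
  MvPolynomial.aeval fun j : Fin l => ∑ i with α i = j.succ, bary K k i

/-- The pull back of constant one-forms: `dt_j ↦ ∑_{α i = j} dt_i`. -/
def pullCotangent {k l : ℕ} (α : Fin (k + 1) →o Fin (l + 1)) : Cotangent K l →ₗ[K] Cotangent K k :=
  Fintype.linearCombination K fun j : Fin l => ∑ i with α i = j.succ, dbary K k i

/-- The pull back `α_* : Ω^p(Δ^l) → Ω^p(Δ^k)` of forms along `α : [k] → [l]`. -/
def Form.pull {k l : ℕ} (p : ℕ) (α : Fin (k + 1) →o Fin (l + 1)) : Form K l p →ₗ[K] Form K k p :=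
  TensorProduct.map (pullRing α).toLinearMap (exteriorPower.map p (pullCotangent α))

/-- Integration of functions over the compact real simplex with respect to `dt_1 ⋯ dt_l`:
`∫ t_1^{a_1} ⋯ t_l^{a_l} dt_1 ⋯ dt_l = a_1! ⋯ a_l! / (l + a_1 + ⋯ + a_l)!`. -/
def integralRing (l : ℕ) : SimplexRing K l →ₗ[K] K :=
  (MvPolynomial.basisMonomials (Fin l) K).constr K fun a =>
    (∏ i, ((a i).factorial : K)) / ((l + ∑ i, a i).factorial : K)

/-- Integration of top degree forms over the simplex:
`∫ f dt_1 ∧ ⋯ ∧ dt_l` is the integral of `f`. -/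
def Form.integral (l : ℕ) : Form K l l →ₗ[K] K :=
  LinearMap.mul' K K ∘ₗ TensorProduct.map (integralRing l)
    (exteriorPower.alternatingMapLinearEquiv (Pi.basisFun K (Fin l)).det)

@[simp] theorem Form.mul_tmul (l p q r : ℕ) (h : p + q = r) (f g : SimplexRing K l)
    (x : ⋀[K]^p (Cotangent K l)) (y : ⋀[K]^q (Cotangent K l)) :
    Form.mul l p q r h (f ⊗ₜ x) (g ⊗ₜ y) = (f * g) ⊗ₜ[K] (extMul p q r h x y) := rfl

theorem Form.d_tmul (l p p' : ℕ) (h : p + 1 = p') (f : SimplexRing K l)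
    (x : ⋀[K]^p (Cotangent K l)) :
    Form.d l p p' h (f ⊗ₜ x) = ∑ j : Fin l, (MvPolynomial.pderiv j f) ⊗ₜ[K]
      (extMul 1 p p' (by omega) (extOne (Pi.single j 1)) x) := by
  simp [Form.d, LinearMap.sum_apply]

theorem coe_extMap {E F : Type u} [AddCommGroup E] [Module K E] [AddCommGroup F] [Module K F]
    (p : ℕ) (f : E →ₗ[K] F) (x : ⋀[K]^p E) :
    (exteriorPower.map p f x : ExteriorAlgebra K F) = ExteriorAlgebra.map f x := by
  have : (Submodule.subtype _) ∘ₗ exteriorPower.map p f =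
      (ExteriorAlgebra.map f).toLinearMap ∘ₗ (Submodule.subtype _) := by
    apply exteriorPower.linearMap_ext
    ext m
    simp [exteriorPower.map_apply_ιMulti]
  exact LinearMap.congr_fun this x

theorem ι_mul_anti {E : Type u} [AddCommGroup E] [Module K E] (e f : E) :
    ExteriorAlgebra.ι K e * ExteriorAlgebra.ι K f =
      -(ExteriorAlgebra.ι K f * ExteriorAlgebra.ι K e) :=
  eq_neg_of_add_eq_zero_left (ExteriorAlgebra.ι_add_mul_swap e f)

theorem ι_mul_comm {E : Type u} [AddCommGroup E] [Module K E] (e : E) (p : ℕ)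
    (x : ExteriorAlgebra K E) (hx : x ∈ ⋀[K]^p E) :
    x * ExteriorAlgebra.ι K e = (-1 : K) ^ p • (ExteriorAlgebra.ι K e * x) := by
  induction hx using Submodule.pow_induction_on_left' with
  | algebraMap r => simp [Algebra.commutes]
  | add x y i hx hy h1 h2 => rw [add_mul, h1, h2, mul_add, smul_add]
  | mem_mul m hm i x hx h =>
    obtain ⟨m, rfl⟩ := hm
    rw [mul_assoc, h, mul_smul_comm, ← mul_assoc, ι_mul_anti m e, ← mul_assoc, neg_mul, pow_succ]
    simp

theorem pderiv_comm {l : ℕ} (i j : Fin l) (f : SimplexRing K l) :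
    MvPolynomial.pderiv i (MvPolynomial.pderiv j f) =
      MvPolynomial.pderiv j (MvPolynomial.pderiv i f) := by
  induction f using MvPolynomial.induction_on with
  | C a => simp
  | add p q hp hq => simp [hp, hq]
  | mul_X p n h =>
    simp only [Derivation.leibniz, map_add, h, smul_eq_mul, MvPolynomial.pderiv_X,
      Pi.single_apply, apply_ite, mul_one, mul_zero, map_zero]
    have e : ∀ a : Fin l, (n = a) = (a = n) := fun a => propext eq_comm
    by_cases hi : i = n <;> by_cases hj : j = n <;> simp [hi, hj, e, add_comm]

theorem eq_zero_of_eq_neg (K : Type u) [Field K] [CharZero K] {V : Type v} [AddCommGroup V]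
    [Module K V] {x : V} (h : x = -x) : x = 0 := by
  have h2 : (2 : K) • x = 0 := by
    rw [two_smul]; nth_rewrite 1 [h]; exact neg_add_cancel x
  exact (smul_eq_zero.mp h2).resolve_left two_ne_zero

theorem Form.d_d [CharZero K] (l p p' p'' : ℕ) (h : p + 1 = p') (h' : p' + 1 = p'')
    (x : Form K l p) : Form.d l p' p'' h' (Form.d l p p' h x) = 0 := by
  induction x using TensorProduct.induction_on with
  | zero => simp
  | add x y hx hy => simp [hx, hy]
  | tmul f x =>
    simp only [Form.d_tmul, map_sum]
    refine eq_zero_of_eq_neg K ?_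
    conv_lhs => rw [Finset.sum_comm]
    rw [← Finset.sum_neg_distrib]
    refine Finset.sum_congr rfl fun i _ => ?_
    rw [← Finset.sum_neg_distrib]
    refine Finset.sum_congr rfl fun j _ => ?_
    rw [← TensorProduct.tmul_neg]
    congr 1
    · exact pderiv_comm i j f
    · refine Subtype.ext ?_
      simp only [coe_extMul, coe_extOne, NegMemClass.coe_neg]
      rw [← mul_assoc, ι_mul_anti, ← mul_assoc, neg_mul]

theorem Form.leibniz (l p q r p' q' r' : ℕ) (h : p + q = r) (hp : p + 1 = p') (hq : q + 1 = q')
    (hr : r + 1 = r') (h1 : p' + q = r') (h2 : p + q' = r') (x : Form K l p) (y : Form K l q) :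
    Form.d l r r' hr (Form.mul l p q r h x y) =
      Form.mul l p' q r' h1 (Form.d l p p' hp x) y +
        (-1 : K) ^ p • Form.mul l p q' r' h2 x (Form.d l q q' hq y) := by
  induction x using TensorProduct.induction_on with
  | zero => simp
  | add x y hx hy => simp only [map_add, LinearMap.add_apply, hx, hy, smul_add]; abel
  | tmul f x =>
  induction y using TensorProduct.induction_on with
  | zero => simp
  | add x y hx hy => simp only [map_add, hx, hy, smul_add]; abel
  | tmul g y =>
    simp only [Form.mul_tmul, Form.d_tmul, map_sum, LinearMap.sum_apply, Finset.smul_sum]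
    rw [← Finset.sum_add_distrib]
    refine Finset.sum_congr rfl fun j _ => ?_
    have e1 : extMul 1 r r' (by omega) (extOne (Pi.single j (1 : K))) (extMul p q r h x y) =
        extMul p' q r' h1 (extMul 1 p p' (by omega) (extOne (Pi.single j 1)) x) y :=
      Subtype.ext (by simp [mul_assoc])
    have e2 : extMul p q' r' h2 x (extMul 1 q q' (by omega) (extOne (Pi.single j (1 : K))) y) =
        (-1 : K) ^ p •
          extMul p' q r' h1 (extMul 1 p p' (by omega) (extOne (Pi.single j 1)) x) y :=
      Subtype.ext (by
        simp only [coe_extMul, coe_extOne, Submodule.coe_smul]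
        rw [← mul_assoc, ι_mul_comm _ p _ x.2, smul_mul_assoc])
    rw [e1, e2, ← TensorProduct.tmul_smul, smul_smul, ← mul_pow]
    rw [Derivation.leibniz, TensorProduct.add_tmul, smul_eq_mul, smul_eq_mul, add_comm, mul_comm g]
    simp

theorem pderiv_bary (l : ℕ) (i : Fin l) (a : Fin (l + 1)) :
    MvPolynomial.pderiv i (bary K l a) = MvPolynomial.C (dbary K l a i) := by
  refine Fin.cases ?_ (fun j => ?_) a
  · simp [bary, dbary, MvPolynomial.pderiv_X, Pi.single_apply, Finset.sum_apply]
  · simp [bary, dbary, MvPolynomial.pderiv_X, Pi.single_apply, eq_comm]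

theorem pderiv_pullRing {k l : ℕ} (α : Fin (k + 1) →o Fin (l + 1)) (i : Fin k)
    (f : SimplexRing K l) :
    MvPolynomial.pderiv i (pullRing α f) = ∑ j : Fin l,
      pullCotangent α (Pi.single j (1 : K)) i • pullRing α (MvPolynomial.pderiv j f) := by
  induction f using MvPolynomial.induction_on with
  | C a => simp [pullRing]
  | add p q hp hq => simp only [map_add, hp, hq, smul_add, Finset.sum_add_distrib]
  | mul_X p n h =>
    have hX : MvPolynomial.pderiv i (pullRing α (MvPolynomial.X n : SimplexRing K l)) =
        MvPolynomial.C (pullCotangent α (Pi.single n (1 : K)) i) := by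
      simp [pullRing, pullCotangent, pderiv_bary, Fintype.linearCombination_apply_single]
    rw [map_mul, Derivation.leibniz, hX, h]
    simp only [Derivation.leibniz, map_add, smul_add, Finset.sum_add_distrib, smul_eq_mul, map_mul,
      MvPolynomial.pderiv_X, Finset.mul_sum]
    congr 1
    · rw [Finset.sum_eq_single n]
      · simp [MvPolynomial.smul_eq_C_mul, mul_comm]
      · intro j _ hj
        simp [hj]
      · simp
    · refine Finset.sum_congr rfl fun j _ => ?_
      rw [mul_smul_comm]

theorem Form.pull_d {k l : ℕ} (p p' : ℕ) (h : p + 1 = p') (α : Fin (k + 1) →o Fin (l + 1))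
    (x : Form K l p) :
    Form.pull p' α (Form.d l p p' h x) = Form.d k p p' h (Form.pull p α x) := by
  induction x using TensorProduct.induction_on with
  | zero => simp
  | add x y hx hy => simp only [map_add, hx, hy]
  | tmul f x =>
    simp only [Form.d_tmul, map_sum, Form.pull, TensorProduct.map_tmul, AlgHom.toLinearMap_apply,
      pderiv_pullRing, TensorProduct.sum_tmul]
    rw [Finset.sum_comm]
    refine Finset.sum_congr rfl fun j _ => ?_
    simp only [TensorProduct.smul_tmul, ← TensorProduct.tmul_sum]
    congr 1
    have e1 : exteriorPower.map p' (pullCotangent α)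
        (extMul 1 p p' (by omega) (extOne (Pi.single j (1 : K))) x) =
        extMul 1 p p' (by omega) (extOne (pullCotangent α (Pi.single j (1 : K))))
          (exteriorPower.map p (pullCotangent α) x) :=
      Subtype.ext (by simp [coe_extMap])
    have e2 : pullCotangent α (Pi.single j (1 : K)) =
        ∑ i, pullCotangent α (Pi.single j (1 : K)) i • Pi.single i (1 : K) := by
      ext a
      simp [Finset.sum_apply, Pi.single_apply]
    rw [e1, e2]
    simp only [map_sum, map_smul, LinearMap.sum_apply, LinearMap.smul_apply]
    rw [← e2]

theorem Form.pull_mul {k l : ℕ} (p q r : ℕ) (h : p + q = r) (α : Fin (k + 1) →o Fin (l + 1))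
    (x : Form K l p) (y : Form K l q) :
    Form.pull r α (Form.mul l p q r h x y) =
      Form.mul k p q r h (Form.pull p α x) (Form.pull q α y) := by
  induction x using TensorProduct.induction_on with
  | zero => simp
  | add x y hx hy => simp only [map_add, LinearMap.add_apply, hx, hy]
  | tmul f x =>
  induction y using TensorProduct.induction_on with
  | zero => simp
  | add x y hx hy => simp only [map_add, hx, hy]
  | tmul g y =>
    simp only [Form.pull, Form.mul_tmul, TensorProduct.map_tmul]
    congr 1
    · simp
    · exact Subtype.ext (by simp [coe_extMap])

end Forms

/-! ### Dir-inv modules and their completion -/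

section DirInvModules

variable {K : Type u} [Field K]

/-- A dir-inv module structure on `M`: a direct system of submodules `F j`, indexed by a nonempty
directed set, with an inverse system `fil j i` (`i : ℕ`) of submodules of each `F j`, such that the
inclusions `F j ⊆ F k` for `j ≤ k` are continuous. -/
structure DirInv (K : Type u) [Field K] (M : Type v) [AddCommGroup M] [Module K M] where
  J : Type w
  [order : PartialOrder J]
  [directed : IsDirectedOrder J]
  [nonempty : Nonempty J]
  F : J → Submodule K M
  fil : J → ℕ → Submodule K M
  fil_le : ∀ j i, fil j i ≤ F j
  fil_anti : ∀ j, Antitone (fil j)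
  F_mono : Monotone F
  incl_cont : ∀ j k, j ≤ k → ∀ i, ∃ i', fil j i' ≤ fil k i

attribute [instance] DirInv.order DirInv.directed DirInv.nonempty

variable {M : Type v} [AddCommGroup M] [Module K M]
  {N : Type v'} [AddCommGroup N] [Module K N]
  {P : Type v''} [AddCommGroup P] [Module K P]

namespace DirInv

/-- Continuity of a linear map between dir-inv modules. -/
def Cont (D : DirInv.{u, v, w} K M) (E : DirInv.{u, v', w'} K N) (f : M →ₗ[K] N) : Prop :=
  ∀ j, ∃ k, (∀ x ∈ D.F j, f x ∈ E.F k) ∧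
    ∀ i, ∃ i', ∀ x ∈ D.fil j i', f x ∈ E.fil k i

/-- Continuity of a bilinear map between dir-inv modules: for all `j`, `k` there is `l` such that
the map restricts to a map `F j × F k → F l`, which is continuous for the linear topologies that
are defined by the inverse systems (continuity at the origin, and continuity in each variable). -/
def Cont₂ (D : DirInv.{u, v, w} K M) (E : DirInv.{u, v', w} K N) (G : DirInv.{u, v'', w} K P)
    (β : M →ₗ[K] N →ₗ[K] P) : Prop :=
  ∀ j k, ∃ l, (∀ x ∈ D.F j, ∀ y ∈ E.F k, β x y ∈ G.F l) ∧
    (∀ i, ∃ i', ∀ x ∈ D.fil j i', ∀ y ∈ E.fil k i', β x y ∈ G.fil l i) ∧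
    (∀ x ∈ D.F j, ∀ i, ∃ i', ∀ y ∈ E.fil k i', β x y ∈ G.fil l i) ∧
    (∀ y ∈ E.F k, ∀ i, ∃ i', ∀ x ∈ D.fil j i', β x y ∈ G.fil l i)

/-- The canonical map `lim_j F j → M` is bijective (it is always injective). -/
def Exhaustive (D : DirInv.{u, v, w} K M) : Prop := ∀ m, ∃ j, m ∈ D.F j

/-- The inv module `F j` is complete: the canonical map `F j → lim_i (F j / fil j i)` is
bijective. An element of the limit is given by representatives `x i` of its components. -/
def CompleteAt (D : DirInv.{u, v, w} K M) (j : D.J) : Prop :=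
  ∀ x : ℕ → M, (∀ i, x i ∈ D.F j) → (∀ i, x (i + 1) - x i ∈ D.fil j i) →
    ∃! y, y ∈ D.F j ∧ ∀ i, y - x i ∈ D.fil j i

/-- A dir-inv module is complete if it is isomorphic, as a dir-inv module, to one for which all the
`F j` are complete inv modules and `lim_j F j` is the whole module. -/
def IsComplete (D : DirInv.{u, v, w} K M) : Prop :=
  ∃ (N : Type v) (_ : AddCommGroup N) (_ : Module K N) (D' : DirInv.{u, v, max v w} K N)
    (e : M ≃ₗ[K] N), Cont D D' e.toLinearMap ∧ Cont D' D e.symm.toLinearMap ∧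
      D'.Exhaustive ∧ ∀ j, D'.CompleteAt j

/-- A Cauchy sequence in some `F j`. -/
def IsCauchy (D : DirInv.{u, v, w} K M) (x : ℕ → M) : Prop :=
  ∃ j, (∀ n, x n ∈ D.F j) ∧ ∀ i, ∃ s, ∀ m ≥ s, ∀ n ≥ s, x m - x n ∈ D.fil j i

/-- A sequence in some `F j` that converges to zero there. -/
def IsNull (D : DirInv.{u, v, w} K M) (x : ℕ → M) : Prop :=
  ∃ j, (∀ n, x n ∈ D.F j) ∧ ∀ i, ∃ s, ∀ n ≥ s, x n ∈ D.fil j i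

variable (D : DirInv.{u, v, w} K M)

theorem exists_le (j k : D.J) : ∃ l, j ≤ l ∧ k ≤ l := directed_of (· ≤ ·) j k

variable {D} in
theorem cauchy_mono {x : ℕ → M} {j k : D.J} (hjk : j ≤ k)
    (h : (∀ n, x n ∈ D.F j) ∧ ∀ i, ∃ s, ∀ m ≥ s, ∀ n ≥ s, x m - x n ∈ D.fil j i) :
    (∀ n, x n ∈ D.F k) ∧ ∀ i, ∃ s, ∀ m ≥ s, ∀ n ≥ s, x m - x n ∈ D.fil k i := by
  refine ⟨fun n => D.F_mono hjk (h.1 n), fun i => ?_⟩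
  obtain ⟨i', hi'⟩ := D.incl_cont j k hjk i
  obtain ⟨s, hs⟩ := h.2 i'
  exact ⟨s, fun m hm n hn => hi' (hs m hm n hn)⟩

variable {D} in
theorem null_mono {x : ℕ → M} {j k : D.J} (hjk : j ≤ k)
    (h : (∀ n, x n ∈ D.F j) ∧ ∀ i, ∃ s, ∀ n ≥ s, x n ∈ D.fil j i) :
    (∀ n, x n ∈ D.F k) ∧ ∀ i, ∃ s, ∀ n ≥ s, x n ∈ D.fil k i := by
  refine ⟨fun n => D.F_mono hjk (h.1 n), fun i => ?_⟩
  obtain ⟨i', hi'⟩ := D.incl_cont j k hjk i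
  obtain ⟨s, hs⟩ := h.2 i'
  exact ⟨s, fun n hn => hi' (hs n hn)⟩

/-- The module of sequences that are Cauchy in some `F j`. -/
def cauchy : Submodule K (ℕ → M) where
  carrier := {x | D.IsCauchy x}
  zero_mem' := ⟨Classical.arbitrary _, fun _ => zero_mem _, fun i => ⟨0, fun m _ n _ => by simp⟩⟩
  add_mem' := by
    rintro x y ⟨j, hx⟩ ⟨k, hy⟩
    obtain ⟨l, hj, hk⟩ := D.exists_le j k
    obtain ⟨hx1, hx2⟩ := cauchy_mono hj hx
    obtain ⟨hy1, hy2⟩ := cauchy_mono hk hy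
    refine ⟨l, fun n => add_mem (hx1 n) (hy1 n), fun i => ?_⟩
    obtain ⟨s, hs⟩ := hx2 i
    obtain ⟨t, ht⟩ := hy2 i
    refine ⟨max s t, fun m hm n hn => ?_⟩
    have := add_mem (hs m (le_of_max_le_left hm) n (le_of_max_le_left hn))
      (ht m (le_of_max_le_right hm) n (le_of_max_le_right hn))
    rwa [sub_add_sub_comm] at this
  smul_mem' := by
    rintro c x ⟨j, h1, h2⟩
    refine ⟨j, fun n => Submodule.smul_mem _ c (h1 n), fun i => ?_⟩
    obtain ⟨s, hs⟩ := h2 i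
    exact ⟨s, fun m hm n hn => by
      simpa [smul_sub] using Submodule.smul_mem _ c (hs m hm n hn)⟩

/-- The module of sequences that converge to zero in some `F j`. -/
def null : Submodule K (ℕ → M) where
  carrier := {x | D.IsNull x}
  zero_mem' := ⟨Classical.arbitrary _, fun _ => zero_mem _, fun i => ⟨0, fun n _ => by simp⟩⟩
  add_mem' := by
    rintro x y ⟨j, hx⟩ ⟨k, hy⟩
    obtain ⟨l, hj, hk⟩ := D.exists_le j k
    obtain ⟨hx1, hx2⟩ := null_mono hj hx
    obtain ⟨hy1, hy2⟩ := null_mono hk hy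
    refine ⟨l, fun n => add_mem (hx1 n) (hy1 n), fun i => ?_⟩
    obtain ⟨s, hs⟩ := hx2 i
    obtain ⟨t, ht⟩ := hy2 i
    exact ⟨max s t, fun n hn =>
      add_mem (hs n (le_of_max_le_left hn)) (ht n (le_of_max_le_right hn))⟩
  smul_mem' := by
    rintro c x ⟨j, h1, h2⟩
    refine ⟨j, fun n => Submodule.smul_mem _ c (h1 n), fun i => ?_⟩
    obtain ⟨s, hs⟩ := h2 i
    exact ⟨s, fun n hn => Submodule.smul_mem _ c (hs n hn)⟩

/-- The completion `lim_{j →} lim_{← i} (F j / fil j i)`. Since the inner limits are over `ℕ`, they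
are the modules of Cauchy sequences in `F j` modulo the sequences that converge to zero, and the
direct limit over `j` of these quotients is the quotient of the unions. -/
def Completion : Type v := D.cauchy ⧸ (D.null.comap D.cauchy.subtype)

instance : AddCommGroup D.Completion :=
  inferInstanceAs (AddCommGroup (D.cauchy ⧸ (D.null.comap D.cauchy.subtype)))

instance : Module K D.Completion :=
  inferInstanceAs (Module K (D.cauchy ⧸ (D.null.comap D.cauchy.subtype)))

/-- The class of a Cauchy sequence. -/
def cls : D.cauchy →ₗ[K] D.Completion := Submodule.mkQ _

theorem cls_surjective : Function.Surjective D.cls := Submodule.mkQ_surjective _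

theorem cls_eq_zero (x : D.cauchy) : D.cls x = 0 ↔ D.IsNull x := by
  exact Submodule.Quotient.mk_eq_zero _

theorem cls_eq_mk (x y : D.cauchy) :
    D.cls x = D.cls y ↔ D.IsNull ((x : ℕ → M) - (y : ℕ → M)) := by
  rw [← sub_eq_zero, ← map_sub, cls_eq_zero]; rfl

variable {D} {E : DirInv.{u, v', w'} K N}

theorem Cont.cauchy {f : M →ₗ[K] N} (hf : Cont D E f) {x : ℕ → M} (hx : D.IsCauchy x) :
    E.IsCauchy fun n => f (x n) := by
  obtain ⟨j, h1, h2⟩ := hx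
  obtain ⟨k, hk, hi⟩ := hf j
  refine ⟨k, fun n => hk _ (h1 n), fun i => ?_⟩
  obtain ⟨i', hi'⟩ := hi i
  obtain ⟨s, hs⟩ := h2 i'
  exact ⟨s, fun m hm n hn => by simpa using hi' _ (hs m hm n hn)⟩

theorem Cont.null {f : M →ₗ[K] N} (hf : Cont D E f) {x : ℕ → M} (hx : D.IsNull x) :
    E.IsNull fun n => f (x n) := by
  obtain ⟨j, h1, h2⟩ := hx
  obtain ⟨k, hk, hi⟩ := hf j
  refine ⟨k, fun n => hk _ (h1 n), fun i => ?_⟩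
  obtain ⟨i', hi'⟩ := hi i
  obtain ⟨s, hs⟩ := h2 i'
  exact ⟨s, fun n hn => hi' _ (hs n hn)⟩

/-- The map of Cauchy sequences that is induced by a continuous linear map. -/
def cauchyMap (f : M →ₗ[K] N) (hf : Cont D E f) : D.cauchy →ₗ[K] E.cauchy where
  toFun x := ⟨fun n => f ((x : ℕ → M) n), hf.cauchy x.2⟩
  map_add' _ _ := Subtype.ext (funext fun _ => map_add f _ _)
  map_smul' c _ := Subtype.ext (funext fun _ => map_smul f c _)

/-- The map of completions that is induced by a continuous linear map. -/
def complMap (f : M →ₗ[K] N) (hf : Cont D E f) : D.Completion →ₗ[K] E.Completion :=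
  Submodule.mapQ _ _ (cauchyMap f hf) fun _ hx => hf.null hx

@[simp] theorem complMap_cls (f : M →ₗ[K] N) (hf : Cont D E f) (x : D.cauchy) :
    complMap f hf (D.cls x) = E.cls (cauchyMap f hf x) := rfl

section Bilinear

variable {E : DirInv.{u, v', w} K N} {G : DirInv.{u, v'', w} K P}

theorem Cont₂.cauchy {β : M →ₗ[K] N →ₗ[K] P} (hβ : Cont₂ D E G β) {x : ℕ → M} {y : ℕ → N}
    (hx : D.IsCauchy x) (hy : E.IsCauchy y) : G.IsCauchy fun n => β (x n) (y n) := by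
  obtain ⟨j, x1, x2⟩ := hx
  obtain ⟨k, y1, y2⟩ := hy
  obtain ⟨l, h1, h2, h3, h4⟩ := hβ j k
  refine ⟨l, fun n => h1 _ (x1 n) _ (y1 n), fun i => ?_⟩
  obtain ⟨a, ha⟩ := h2 i
  obtain ⟨s, hs⟩ := x2 a
  obtain ⟨t, ht⟩ := y2 a
  set r := max s t with hr
  obtain ⟨b, hb⟩ := h3 (x r) (x1 r) i
  obtain ⟨c, hc⟩ := h4 (y r) (y1 r) i
  obtain ⟨s', hs'⟩ := y2 b
  obtain ⟨t', ht'⟩ := x2 c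
  refine ⟨max r (max s' t'), fun m hm n hn => ?_⟩
  have key : ∀ m n, β (x m) (y m) - β (x n) (y n) =
      (β (x m - x r) (y m - y r) - β (x n - x r) (y n - y r)) + β (x r) (y m - y n) +
        β (x m - x n) (y r) := by
    intro m n
    simp only [map_sub, LinearMap.sub_apply]
    abel
  rw [key]
  have hrs : r ≥ s := le_max_left _ _
  have hrt : r ≥ t := le_max_right _ _
  have hmr : m ≥ r := le_of_max_le_left hm
  have hnr : n ≥ r := le_of_max_le_left hn
  refine add_mem (add_mem (sub_mem ?_ ?_) ?_) ?_
  · exact ha _ (hs _ (hrs.trans hmr) _ hrs) _ (ht _ (hrt.trans hmr) _ hrt)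
  · exact ha _ (hs _ (hrs.trans hnr) _ hrs) _ (ht _ (hrt.trans hnr) _ hrt)
  · exact hb _ (hs' _ (le_of_max_le_left (le_of_max_le_right hm)) _
      (le_of_max_le_left (le_of_max_le_right hn)))
  · exact hc _ (ht' _ (le_of_max_le_right (le_of_max_le_right hm)) _
      (le_of_max_le_right (le_of_max_le_right hn)))

theorem Cont₂.null_left {β : M →ₗ[K] N →ₗ[K] P} (hβ : Cont₂ D E G β) {x : ℕ → M} {y : ℕ → N}
    (hx : D.IsNull x) (hy : E.IsCauchy y) : G.IsNull fun n => β (x n) (y n) := by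
  obtain ⟨j, x1, x2⟩ := hx
  obtain ⟨k, y1, y2⟩ := hy
  obtain ⟨l, h1, h2, h3, h4⟩ := hβ j k
  refine ⟨l, fun n => h1 _ (x1 n) _ (y1 n), fun i => ?_⟩
  obtain ⟨a, ha⟩ := h2 i
  obtain ⟨s, hs⟩ := x2 a
  obtain ⟨t, ht⟩ := y2 a
  obtain ⟨c, hc⟩ := h4 (y t) (y1 t) i
  obtain ⟨t', ht'⟩ := x2 c
  refine ⟨max s (max t t'), fun n hn => ?_⟩
  have key : β (x n) (y n) = β (x n) (y n - y t) + β (x n) (y t) := by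
    simp only [map_sub]; abel
  show β (x n) (y n) ∈ _
  rw [key]
  exact add_mem (ha _ (hs _ (le_of_max_le_left hn)) _
    (ht _ (le_of_max_le_left (le_of_max_le_right hn)) _ le_rfl))
    (hc _ (ht' _ (le_of_max_le_right (le_of_max_le_right hn))))

theorem Cont₂.flip {β : M →ₗ[K] N →ₗ[K] P} (hβ : Cont₂ D E G β) : Cont₂ E D G β.flip := by
  intro k j
  obtain ⟨l, h1, h2, h3, h4⟩ := hβ j k
  refine ⟨l, fun y hy x hx => h1 x hx y hy, fun i => ?_, h4, h3⟩
  obtain ⟨a, ha⟩ := h2 i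
  exact ⟨a, fun y hy x hx => ha x hx y hy⟩

/-- The bilinear map of Cauchy sequences that is induced by a continuous bilinear map. -/
def cauchyMap₂ (β : M →ₗ[K] N →ₗ[K] P) (hβ : Cont₂ D E G β) :
    D.cauchy →ₗ[K] E.cauchy →ₗ[K] G.cauchy :=
  LinearMap.mk₂ K (fun x y => ⟨fun n => β ((x : ℕ → M) n) ((y : ℕ → N) n), hβ.cauchy x.2 y.2⟩)
    (fun _ _ _ => Subtype.ext (funext fun _ => LinearMap.map_add₂ β _ _ _))
    (fun _ _ _ => Subtype.ext (funext fun _ => LinearMap.map_smul₂ β _ _ _))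
    (fun _ _ _ => Subtype.ext (funext fun _ => map_add (β _) _ _))
    (fun _ _ _ => Subtype.ext (funext fun _ => map_smul (β _) _ _))

/-- The bilinear map of completions that is induced by a continuous bilinear map. -/
def complMap₂ (β : M →ₗ[K] N →ₗ[K] P) (hβ : Cont₂ D E G β) :
    D.Completion →ₗ[K] E.Completion →ₗ[K] G.Completion :=
  LinearMap.liftQ₂ _ _ ((cauchyMap₂ β hβ).compr₂ G.cls)
    (fun x hx => LinearMap.ext fun y =>
      (G.cls_eq_zero _).mpr (hβ.null_left (x := (x : ℕ → M)) hx y.2))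
    (fun y hy => LinearMap.ext fun x =>
      (G.cls_eq_zero _).mpr (hβ.flip.null_left (x := (y : ℕ → N)) hy x.2))

@[simp] theorem complMap₂_cls (β : M →ₗ[K] N →ₗ[K] P) (hβ : Cont₂ D E G β) (x : D.cauchy)
    (y : E.cauchy) : complMap₂ β hβ (D.cls x) (E.cls y) = G.cls (cauchyMap₂ β hβ x y) := rfl

end Bilinear

/-! #### Complete modules agree with their completion -/

theorem IsComplete.exhaustive (h : D.IsComplete) : D.Exhaustive := by
  obtain ⟨N, _, _, D', e, h1, h2, h3, h4⟩ := h
  intro m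
  obtain ⟨j, hj⟩ := h3 (e m)
  obtain ⟨k, hk, -⟩ := h2 j
  exact ⟨k, by simpa using hk _ hj⟩

/-- The canonical map from `M = lim_j F j` to the completion (constant sequences). -/
def toCompletion (h : D.Exhaustive) : M →ₗ[K] D.Completion :=
  D.cls ∘ₗ
    { toFun := fun m => ⟨fun _ => m, by
        obtain ⟨j, hj⟩ := h m
        exact ⟨j, fun _ => hj, fun i => ⟨0, fun _ _ _ _ => by simp⟩⟩⟩
      map_add' := fun _ _ => rfl
      map_smul' := fun _ _ => rfl }

theorem IsComplete.bijective (h : D.IsComplete) :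
    Function.Bijective (toCompletion h.exhaustive) := by
  have h0 := h.exhaustive
  obtain ⟨N, _, _, D', e, h1, h2, h3, h4⟩ := h
  constructor
  · rw [injective_iff_map_eq_zero]
    intro m hm
    obtain ⟨k, k1, k2⟩ := h1.null ((D.cls_eq_zero _).mp hm)
    have k3 : ∀ i, e m ∈ D'.fil k i := fun i => by
      obtain ⟨s, hs⟩ := k2 i
      simpa using hs s le_rfl
    have := (h4 k (fun _ => 0) (fun _ => zero_mem _) (fun _ => by simp)).unique
      (y₁ := e m) (y₂ := 0) ⟨k1 0, by simpa using k3⟩ ⟨zero_mem _, by simp⟩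
    simpa using this
  · intro z
    obtain ⟨x, rfl⟩ := D.cls_surjective z
    obtain ⟨k, k1, k2⟩ := h1.cauchy x.2
    choose s hs using k2
    -- a subsequence whose successive differences are small
    let t : ℕ → ℕ := fun i => ∑ a ∈ Finset.range (i + 1), s a
    have ht : ∀ i, s i ≤ t i := fun i =>
      Finset.single_le_sum (f := s) (fun _ _ => Nat.zero_le _) (Finset.self_mem_range_succ i)
    have ht' : ∀ i, t i ≤ t (i + 1) := fun i => by
      simp only [t]; rw [Finset.sum_range_succ _ (i + 1)]; exact Nat.le_add_right _ _
    obtain ⟨y, ⟨y1, y2⟩, -⟩ := h4 k (fun i => e ((x : ℕ → M) (t i))) (fun i => k1 _)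
      (fun i => hs i _ ((ht i).trans (ht' i)) _ (ht i))
    refine ⟨e.symm y, ?_⟩
    refine (D.cls_eq_mk _ _).mpr ?_
    have hnull : D'.IsNull fun n => y - e ((x : ℕ → M) n) := by
      refine ⟨k, fun n => sub_mem y1 (k1 n), fun i => ⟨s i, fun n hn => ?_⟩⟩
      have := add_mem (y2 i) (hs i _ (ht i) n hn)
      simpa using this
    have := h2.null hnull
    simp only [map_sub, LinearEquiv.coe_coe, LinearEquiv.symm_apply_apply] at this
    exact this

/-- A complete dir-inv module is canonically isomorphic to its completion. -/
def IsComplete.equiv (h : D.IsComplete) : M ≃ₗ[K] D.Completion :=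
  LinearEquiv.ofBijective _ h.bijective

end DirInv

/-! #### The tensor product with a discrete inv module -/

section Tensor

variable {V : Type u} [AddCommGroup V] [Module K V]
  {W : Type u} [AddCommGroup W] [Module K W]
  {U : Type u} [AddCommGroup U] [Module K U]

/-- The submodule `V ⊗ S` of `V ⊗ M`. -/
def tensorSub (V : Type u) [AddCommGroup V] [Module K V] (S : Submodule K M) :
    Submodule K (V ⊗[K] M) :=
  LinearMap.range (S.subtype.lTensor V)

theorem tmul_mem_tensorSub {S : Submodule K M} (x : V) {m : M} (hm : m ∈ S) :
    x ⊗ₜ[K] m ∈ tensorSub V S := ⟨x ⊗ₜ ⟨m, hm⟩, rfl⟩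

theorem tensorSub_induction {S : Submodule K M} {p : V ⊗[K] M → Prop} (zero : p 0)
    (add : ∀ x y, p x → p y → p (x + y)) (tmul : ∀ x, ∀ m ∈ S, p (x ⊗ₜ m))
    {z : V ⊗[K] M} (hz : z ∈ tensorSub V S) : p z := by
  obtain ⟨z, rfl⟩ := hz
  induction z using TensorProduct.induction_on with
  | zero => simpa using zero
  | add x y hx hy => rw [map_add]; exact add _ _ hx hy
  | tmul x m => exact tmul x m m.2

theorem tensorSub_mono {S T : Submodule K M} (h : S ≤ T) : tensorSub V S ≤ tensorSub V T :=
  fun _ hz => tensorSub_induction (zero_mem _) (fun _ _ => add_mem)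
    (fun x _ hm => tmul_mem_tensorSub x (h hm)) hz

/-- The dir-inv structure on `V ⊗ M`, where `V` is a module considered as a discrete inv module and
`M` is a dir-inv module. -/
def DirInv.tensor (V : Type u) [AddCommGroup V] [Module K V] (D : DirInv.{u, v, w} K M) :
    DirInv.{u, max u v, w} K (V ⊗[K] M) where
  J := D.J
  F j := tensorSub V (D.F j)
  fil j i := tensorSub V (D.fil j i)
  fil_le j i := tensorSub_mono (D.fil_le j i)
  fil_anti j _ _ h := tensorSub_mono (D.fil_anti j h)
  F_mono _ _ h := tensorSub_mono (D.F_mono h)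
  incl_cont j k h i := (D.incl_cont j k h i).imp fun _ => tensorSub_mono

/-- The completed tensor product of a discrete inv module and a dir-inv module. -/
abbrev CTensor (V : Type u) [AddCommGroup V] [Module K V] (D : DirInv.{u, v, w} K M) :
    Type (max u v) := (D.tensor V).Completion

namespace DirInv

variable {D : DirInv.{u, v, w} K M} {E : DirInv.{u, v', w} K N} {G : DirInv.{u, v'', w} K P}

theorem map_mem_tensorSub (g : V →ₗ[K] W) (f : M →ₗ[K] N) {S : Submodule K M}
    {T : Submodule K N} (h : ∀ x ∈ S, f x ∈ T) {z : V ⊗[K] M} (hz : z ∈ tensorSub V S) :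
    TensorProduct.map g f z ∈ tensorSub W T :=
  tensorSub_induction (p := fun z => TensorProduct.map g f z ∈ tensorSub W T) (by simp)
    (fun x y hx hy => by rw [map_add]; exact add_mem hx hy)
    (fun x m hm => tmul_mem_tensorSub (g x) (h m hm)) hz

theorem map₂_mem_tensorSub (g : V →ₗ[K] W →ₗ[K] U) (f : M →ₗ[K] N →ₗ[K] P)
    {S : Submodule K M} {T : Submodule K N} {R : Submodule K P}
    (h : ∀ x ∈ S, ∀ y ∈ T, f x y ∈ R) {z : V ⊗[K] M} {t : W ⊗[K] N}
    (hz : z ∈ tensorSub V S) (ht : t ∈ tensorSub W T) :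
    TensorProduct.map₂ g f z t ∈ tensorSub U R := by
  refine tensorSub_induction (p := fun z => TensorProduct.map₂ g f z t ∈ tensorSub U R)
    (by simp) (fun x y hx hy => by rw [map_add]; exact add_mem hx hy) (fun x m hm => ?_) hz
  exact map_mem_tensorSub (g x) (f m) (h m hm) ht

theorem Cont.tensor (g : V →ₗ[K] W) {f : M →ₗ[K] N} (hf : Cont D E f) :
    Cont (D.tensor V) (E.tensor W) (TensorProduct.map g f) := by
  intro j
  obtain ⟨k, h1, h2⟩ := hf j
  refine ⟨k, fun x hx => map_mem_tensorSub g f h1 hx, fun i => ?_⟩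
  obtain ⟨i', h3⟩ := h2 i
  exact ⟨i', fun x hx => map_mem_tensorSub g f h3 hx⟩

theorem tensor_aux (g : V →ₗ[K] W →ₗ[K] U) (f : M →ₗ[K] N →ₗ[K] P) {S : Submodule K M}
    {T : ℕ → Submodule K N} (hT : Antitone T) {R : Submodule K P}
    (h : ∀ x ∈ S, ∃ i', ∀ y ∈ T i', f x y ∈ R) {z : V ⊗[K] M} (hz : z ∈ tensorSub V S) :
    ∃ i', ∀ t ∈ tensorSub W (T i'), TensorProduct.map₂ g f z t ∈ tensorSub U R := by
  refine tensorSub_induction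
    (p := fun z => ∃ i', ∀ t ∈ tensorSub W (T i'), TensorProduct.map₂ g f z t ∈ tensorSub U R)
    ⟨0, by simp⟩ ?_ ?_ hz
  · rintro x y ⟨a, ha⟩ ⟨b, hb⟩
    refine ⟨max a b, fun t ht => ?_⟩
    rw [map_add]
    exact add_mem (ha t (tensorSub_mono (hT (le_max_left a b)) ht))
      (hb t (tensorSub_mono (hT (le_max_right a b)) ht))
  · intro x m hm
    obtain ⟨i', hi⟩ := h m hm
    exact ⟨i', fun t ht => map_mem_tensorSub (g x) (f m) hi ht⟩

theorem map₂_flip (g : V →ₗ[K] W →ₗ[K] U) (f : M →ₗ[K] N →ₗ[K] P) (z : V ⊗[K] M)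
    (t : W ⊗[K] N) :
    TensorProduct.map₂ g f z t = TensorProduct.map₂ g.flip f.flip t z := by
  induction z using TensorProduct.induction_on with
  | zero => simp
  | add x y hx hy => simp only [map_add, LinearMap.add_apply, hx, hy]
  | tmul f x =>
  induction t using TensorProduct.induction_on with
  | zero => simp
  | add x y hx hy => simp only [map_add, LinearMap.add_apply, hx, hy]
  | tmul g y => rfl

theorem Cont₂.tensor (g : V →ₗ[K] W →ₗ[K] U) {f : M →ₗ[K] N →ₗ[K] P} (hf : Cont₂ D E G f) :
    Cont₂ (D.tensor V) (E.tensor W) (G.tensor U) (TensorProduct.map₂ g f) := by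
  intro j k
  obtain ⟨l, h1, h2, h3, h4⟩ := hf j k
  refine ⟨l, fun x hx y hy => map₂_mem_tensorSub g f h1 hx hy, fun i => ?_, fun x hx i => ?_,
    fun y hy i => ?_⟩
  · obtain ⟨i', h⟩ := h2 i
    exact ⟨i', fun x hx y hy => map₂_mem_tensorSub g f h hx hy⟩
  · exact tensor_aux g f (E.fil_anti k) (fun x hx => h3 x hx i) hx
  · obtain ⟨i', h⟩ := tensor_aux g.flip f.flip (D.fil_anti j) (fun y hy => h4 y hy i) hy
    exact ⟨i', fun x hx => by rw [map₂_flip]; exact h x hx⟩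

theorem cont_contract (c : V →ₗ[K] K) :
    Cont (D.tensor V) D (TensorProduct.lift ((LinearMap.lsmul K M).comp c)) := by
  have key : ∀ (S : Submodule K M), ∀ z ∈ tensorSub V S,
      TensorProduct.lift ((LinearMap.lsmul K M).comp c) z ∈ S := fun S z hz =>
    tensorSub_induction (p := fun z => TensorProduct.lift ((LinearMap.lsmul K M).comp c) z ∈ S)
      (by simp) (fun x y hx hy => by rw [map_add]; exact add_mem hx hy)
      (fun x m hm => by simpa using S.smul_mem (c x) hm) hz
  exact fun j => ⟨j, key _, fun i => ⟨i, key _⟩⟩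

end DirInv

end Tensor

end DirInvModules

/-! ### DG algebras, not necessarily associative, commutative or unital -/

section DGAlgebras

/-- A DG `K`-algebra, not necessarily associative, commutative or unital. The degrees of the target
modules of `d` and `mul` are free variables subject to an equation. -/
structure DGAlg (K : Type u) [Field K] where
  X : ℤ → Type v
  [grp : ∀ i, AddCommGroup (X i)]
  [mod : ∀ i, Module K (X i)]
  d : ∀ i i', i + 1 = i' → (X i →ₗ[K] X i')
  mul : ∀ i j k, i + j = k → (X i →ₗ[K] X j →ₗ[K] X k)
  d_d : ∀ i i' i'' (h : i + 1 = i') (h' : i' + 1 = i'') (x : X i), d i' i'' h' (d i i' h x) = 0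
  leibniz : ∀ i j k i' j' k' (h : i + j = k) (hi : i + 1 = i') (hj : j + 1 = j')
    (hk : k + 1 = k') (h1 : i' + j = k') (h2 : i + j' = k') (x : X i) (y : X j),
    d k k' hk (mul i j k h x y) =
      mul i' j k' h1 (d i i' hi x) y + (-1 : K) ^ i • mul i j' k' h2 x (d j j' hj y)

attribute [instance] DGAlg.grp DGAlg.mod

variable {K : Type u} [Field K]

namespace DGAlg

variable (A : DGAlg.{u, v} K)

/-- The cocycles of degree `n`. -/
def cocycles (n : ℤ) : Submodule K (A.X n) := LinearMap.ker (A.d n (n + 1) rfl)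

/-- The coboundaries of degree `n`. -/
def coboundaries (n : ℤ) : Submodule K (A.X n) :=
  LinearMap.range (A.d (n - 1) n (sub_add_cancel n 1))

/-- The cohomology in degree `n`. -/
abbrev H (n : ℤ) : Type v := A.cocycles n ⧸ (A.coboundaries n).comap (A.cocycles n).subtype

/-- The class of a cocycle. -/
def cls (n : ℤ) : A.cocycles n →ₗ[K] A.H n := Submodule.mkQ _

theorem d_eq_zero {n n' : ℤ} (h : n + 1 = n') {x : A.X n} (hx : x ∈ A.cocycles n) :
    A.d n n' h x = 0 := by
  subst h; exact hx

theorem mem_coboundaries {n n' : ℤ} (h : n + 1 = n') (x : A.X n) :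
    A.d n n' h x ∈ A.coboundaries n' := by
  obtain rfl : n = n' - 1 := by omega
  exact ⟨x, rfl⟩

/-- The product of cocycles. -/
def cocyclesMul (m n k : ℤ) (h : m + n = k) :
    A.cocycles m →ₗ[K] A.cocycles n →ₗ[K] A.cocycles k :=
  LinearMap.mk₂ K
    (fun x y => ⟨A.mul m n k h x y, by
      have := A.leibniz m n k (m + 1) (n + 1) (k + 1) h rfl rfl rfl (by omega) (by omega) x y
      rw [A.d_eq_zero rfl x.2, A.d_eq_zero rfl y.2] at this
      simpa [cocycles] using this⟩)
    (fun _ _ _ => Subtype.ext (LinearMap.map_add₂ _ _ _ _))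
    (fun _ _ _ => Subtype.ext (LinearMap.map_smul₂ _ _ _ _))
    (fun _ _ _ => Subtype.ext (map_add _ _ _))
    (fun _ _ _ => Subtype.ext (map_smul _ _ _))

/-- The product of the cohomology algebra. -/
def mulH (m n k : ℤ) (h : m + n = k) : A.H m →ₗ[K] A.H n →ₗ[K] A.H k :=
  LinearMap.liftQ₂ _ _ ((A.cocyclesMul m n k h).compr₂ (A.cls k))
    (by
      intro x hx
      refine LinearMap.ext fun y => (Submodule.Quotient.mk_eq_zero _).mpr ?_
      obtain ⟨z, hz⟩ := hx
      have := A.leibniz (m - 1) n (k - 1) m (n + 1) k (by omega) (by omega) rfl (by omega) h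
        (by omega) z y
      rw [A.d_eq_zero rfl y.2, map_zero, smul_zero, add_zero, hz] at this
      exact ⟨_, this⟩)
    (by
      intro y hy
      refine LinearMap.ext fun x => (Submodule.Quotient.mk_eq_zero _).mpr ?_
      obtain ⟨z, hz⟩ := hy
      have := A.leibniz m (n - 1) (k - 1) (m + 1) n k (by omega) rfl (by omega) (by omega)
        (by omega) h x z
      rw [A.d_eq_zero rfl x.2, map_zero, LinearMap.zero_apply, zero_add, hz, ← map_smul] at this
      have h3 : A.mul m n k h x y ∈ A.coboundaries k := by
        have h4 := Submodule.smul_mem (A.coboundaries k) ((-1 : K) ^ m)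
          (A.mem_coboundaries (by omega) (A.mul m (n - 1) (k - 1) (by omega) x z))
        rw [this, map_smul, smul_smul, ← mul_zpow] at h4
        simpa using h4
      exact h3)

/-- A family of linear maps of degree zero between the modules that underlie DG algebras is a
homomorphism of DG modules. -/
def IsCochainMap (A : DGAlg.{u, v} K) (B : DGAlg.{u, v'} K) (f : ∀ n, A.X n →ₗ[K] B.X n) : Prop :=
  ∀ n n' (h : n + 1 = n') (x : A.X n), f n' (A.d n n' h x) = B.d n n' h (f n x)

variable {A} {B : DGAlg.{u, v'} K}

/-- The map on cocycles that is induced by a homomorphism of DG modules. -/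
def mapCocycles {f : ∀ n, A.X n →ₗ[K] B.X n} (hf : IsCochainMap A B f) (n : ℤ) :
    A.cocycles n →ₗ[K] B.cocycles n :=
  (f n).restrict fun x hx => by
    have := hf n (n + 1) rfl x
    rw [A.d_eq_zero rfl hx, map_zero] at this
    exact this.symm

/-- The map on cohomology that is induced by a homomorphism of DG modules. -/
def mapH {f : ∀ n, A.X n →ₗ[K] B.X n} (hf : IsCochainMap A B f) (n : ℤ) : A.H n →ₗ[K] B.H n :=
  Submodule.mapQ _ _ (mapCocycles hf n) fun x hx => by
    obtain ⟨z, hz⟩ := hx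
    refine ⟨f (n - 1) z, ?_⟩
    rw [← hf (n - 1) n (sub_add_cancel n 1) z, hz]
    rfl

end DGAlg

/-- A bigraded algebra with two commuting differentials, of degrees `(1, 0)` and `(0, 1)`, each of
which is a graded derivation with respect to its own degree. -/
structure BiDGAlg (K : Type u) [Field K] where
  X : ℕ → ℤ → Type v
  [grp : ∀ p i, AddCommGroup (X p i)]
  [mod : ∀ p i, Module K (X p i)]
  dh : ∀ p p' i, p + 1 = p' → (X p i →ₗ[K] X p' i)
  dv : ∀ p i i', i + 1 = i' → (X p i →ₗ[K] X p i')
  mul : ∀ p q r i j k, p + q = r → i + j = k → (X p i →ₗ[K] X q j →ₗ[K] X r k)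
  dh_dh : ∀ p p' p'' i (h : p + 1 = p') (h' : p' + 1 = p'') (x : X p i),
    dh p' p'' i h' (dh p p' i h x) = 0
  dv_dv : ∀ p i i' i'' (h : i + 1 = i') (h' : i' + 1 = i'') (x : X p i),
    dv p i' i'' h' (dv p i i' h x) = 0
  dh_dv : ∀ p p' i i' (h : p + 1 = p') (h' : i + 1 = i') (x : X p i),
    dh p p' i' h (dv p i i' h' x) = dv p' i i' h' (dh p p' i h x)
  dh_mul : ∀ p q r p' q' r' i j k (h : p + q = r) (hp : p + 1 = p') (hq : q + 1 = q')
    (hr : r + 1 = r') (h1 : p' + q = r') (h2 : p + q' = r') (e : i + j = k) (x : X p i) (y : X q j),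
    dh r r' k hr (mul p q r i j k h e x y) =
      mul p' q r' i j k h1 e (dh p p' i hp x) y +
        (-1 : K) ^ p • mul p q' r' i j k h2 e x (dh q q' j hq y)
  dv_mul : ∀ p q r i j k i' j' k' (h : p + q = r) (e : i + j = k) (ei : i + 1 = i')
    (ej : j + 1 = j') (ek : k + 1 = k') (e1 : i' + j = k') (e2 : i + j' = k') (x : X p i) (y : X q j),
    dv r k k' ek (mul p q r i j k h e x y) =
      mul p q r i' j k' h e1 (dv p i i' ei x) y +
        (-1 : K) ^ i • mul p q r i j' k' h e2 x (dv q j j' ej y)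

attribute [instance] BiDGAlg.grp BiDGAlg.mod

namespace BiDGAlg

variable (B : BiDGAlg.{u, v} K)

/-- The bidegrees of total degree `n`. -/
abbrev Bideg (n : ℤ) : Type := {x : ℕ × ℤ // (x.1 : ℤ) + x.2 = n}

/-- The total module in degree `n`. -/
abbrev TotX (n : ℤ) : Type v := DirectSum (Bideg n) fun x => B.X x.1.1 x.1.2

/-- The inclusion of a bigraded component in the total module. -/
def inc (n : ℤ) (p : ℕ) (i : ℤ) (h : (p : ℤ) + i = n) : B.X p i →ₗ[K] B.TotX n :=
  DirectSum.lof K (Bideg n) (fun x => B.X x.1.1 x.1.2) ⟨(p, i), h⟩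

/-- The total differential `dh + (-1)^p dv`. -/
def totD (n n' : ℤ) (h : n + 1 = n') : B.TotX n →ₗ[K] B.TotX n' :=
  DirectSum.toModule K _ _ fun x =>
    B.inc n' (x.1.1 + 1) x.1.2 (by have := x.2; push_cast; omega) ∘ₗ B.dh _ _ _ rfl +
      (-1 : K) ^ x.1.1 • B.inc n' x.1.1 (x.1.2 + 1) (by have := x.2; omega) ∘ₗ B.dv _ _ _ rfl

/-- The total product: `(-1)^{iq}` times the product, in bidegrees `(p, i)` and `(q, j)`. -/
def totMul (m n k : ℤ) (h : m + n = k) : B.TotX m →ₗ[K] B.TotX n →ₗ[K] B.TotX k :=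
  DirectSum.toModule K _ _ fun x => LinearMap.flip <| DirectSum.toModule K _ _ fun y =>
    LinearMap.flip <| (-1 : K) ^ (x.1.2 * (y.1.1 : ℤ)) •
      (B.mul x.1.1 y.1.1 _ x.1.2 y.1.2 _ rfl rfl).compr₂
        (B.inc k (x.1.1 + y.1.1) (x.1.2 + y.1.2)
          (by have := x.2; have := y.2; push_cast; omega))

theorem totD_inc (n n' : ℤ) (h : n + 1 = n') (p p' : ℕ) (i i' : ℤ) (e : (p : ℤ) + i = n)
    (hp : p + 1 = p') (hi : i + 1 = i') (x : B.X p i) :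
    B.totD n n' h (B.inc n p i e x) =
      B.inc n' p' i (by omega) (B.dh p p' i hp x) +
        (-1 : K) ^ p • B.inc n' p i' (by omega) (B.dv p i i' hi x) := by
  subst hp hi
  simp only [totD, inc, DirectSum.toModule_lof]
  rfl

theorem totMul_inc (m n k : ℤ) (h : m + n = k) (p q r : ℕ) (i j l : ℤ) (e : (p : ℤ) + i = m)
    (e' : (q : ℤ) + j = n) (hr : p + q = r) (hl : i + j = l) (x : B.X p i) (y : B.X q j) :
    B.totMul m n k h (B.inc m p i e x) (B.inc n q j e' y) =
      (-1 : K) ^ (i * (q : ℤ)) •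
        B.inc k r l (by omega) (B.mul p q r i j l hr hl x y) := by
  subst hr hl
  simp only [totMul, inc, DirectSum.toModule_lof, LinearMap.flip_apply]
  rfl

theorem tot_induction {n : ℤ} {P : B.TotX n → Prop} (zero : P 0)
    (add : ∀ x y, P x → P y → P (x + y))
    (inc : ∀ (p : ℕ) (i : ℤ) (h : (p : ℤ) + i = n) (x : B.X p i), P (B.inc n p i h x)) (x : B.TotX n) : P x :=
  DirectSum.induction_on x zero (fun i x => inc i.1.1 i.1.2 i.2 x) add

/-- The total DG algebra, in which the degree `n` part is the direct sum of the parts of bidegree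
`(p, i)` with `p + i = n`. -/
def tot : DGAlg.{u, v} K where
  X := B.TotX
  d := B.totD
  mul := B.totMul
  d_d n n' n'' h h' x := by
    induction x using B.tot_induction with
    | zero => simp
    | add x y hx hy => simp only [map_add, hx, hy, add_zero]
    | inc p i e x =>
      rw [B.totD_inc n n' h p (p + 1) i (i + 1) e rfl rfl, map_add, map_smul,
        B.totD_inc n' n'' h' (p + 1) (p + 2) i (i + 1) _ rfl rfl,
        B.totD_inc n' n'' h' p (p + 1) (i + 1) (i + 2) _ rfl (by omega),
        B.dh_dh, B.dv_dv, B.dh_dv]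
      simp only [map_zero, zero_add, smul_zero, add_zero, pow_succ, mul_neg, mul_one, neg_smul]
      exact neg_add_cancel _
  leibniz m n k m' n' k' h hm hn hk h1 h2 x y := by
    induction x using B.tot_induction with
    | zero => simp
    | add x y hx hy => simp only [map_add, LinearMap.add_apply, hx, hy, smul_add]; abel
    | inc p i e x =>
    induction y using B.tot_induction with
    | zero => simp
    | add x y hx hy => simp only [map_add, hx, hy, smul_add]; abel
    | inc q j e' y =>
      have n1 : (-1 : K) ≠ 0 := neg_ne_zero.mpr one_ne_zero
      rw [B.totMul_inc m n k h p q (p + q) i j (i + j) e e' rfl rfl, map_smul,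
        B.totD_inc k k' hk (p + q) (p + q + 1) (i + j) (i + j + 1) _ rfl rfl,
        B.dh_mul p q (p + q) (p + 1) (q + 1) (p + q + 1) i j (i + j) rfl rfl rfl rfl (by omega)
          (by omega) rfl,
        B.dv_mul p q (p + q) i j (i + j) (i + 1) (j + 1) (i + j + 1) rfl rfl rfl rfl rfl (by omega)
          (by omega),
        B.totD_inc m m' hm p (p + 1) i (i + 1) e rfl rfl,
        B.totD_inc n n' hn q (q + 1) j (j + 1) e' rfl rfl]
      simp only [map_add, map_smul, LinearMap.add_apply, LinearMap.smul_apply]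
      rw [B.totMul_inc m' n k' h1 (p + 1) q (p + q + 1) i j (i + j) _ _ (by omega) rfl,
        B.totMul_inc m' n k' h1 p q (p + q) (i + 1) j (i + j + 1) _ _ rfl (by omega),
        B.totMul_inc m n' k' h2 p (q + 1) (p + q + 1) i j (i + j) _ _ (by omega) rfl,
        B.totMul_inc m n' k' h2 p q (p + q) i (j + 1) (i + j + 1) _ _ rfl (by omega)]
      simp only [smul_add, smul_smul]
      have s1 : (-1 : K) ^ m = (-1) ^ p * (-1 : K) ^ i := by
        rw [← e, zpow_add₀ n1, zpow_natCast]
      have s2 : (-1 : K) ^ ((i + 1) * (q : ℤ)) = (-1 : K) ^ (i * (q : ℤ)) * (-1) ^ q := by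
        rw [add_mul, one_mul, zpow_add₀ n1, zpow_natCast]
      have s3 : (-1 : K) ^ (i * ((q + 1 : ℕ) : ℤ)) = (-1 : K) ^ (i * (q : ℤ)) * (-1 : K) ^ i := by
        rw [Nat.cast_add, mul_add, Nat.cast_one, mul_one, zpow_add₀ n1]
      have s4 : (-1 : K) ^ i * (-1 : K) ^ i = 1 := by rw [← mul_zpow]; simp
      rw [s1, s2, s3]
      have t1 : (-1 : K) ^ p * (-1 : K) ^ i * ((-1 : K) ^ (i * (q : ℤ)) * (-1 : K) ^ i) =
          (-1 : K) ^ (i * (q : ℤ)) * (-1) ^ p := by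
        linear_combination ((-1 : K) ^ p * (-1 : K) ^ (i * (q : ℤ))) * s4
      rw [t1, pow_add]
      have t2 : (-1 : K) ^ (i * (q : ℤ)) * ((-1) ^ p * (-1) ^ q) =
        (-1) ^ p * ((-1 : K) ^ (i * (q : ℤ)) * (-1) ^ q) := by ring
      have t3 : (-1 : K) ^ (i * (q : ℤ)) * ((-1) ^ p * (-1) ^ q * (-1 : K) ^ i) =
        (-1 : K) ^ p * (-1 : K) ^ i * ((-1 : K) ^ q * (-1 : K) ^ (i * (q : ℤ))) := by ring
      simp only [mul_assoc] at t2 t3 ⊢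
      rw [t2, t3]
      abel

end BiDGAlg

end DGAlgebras

/-! ### Maps between completed tensor products -/

section CompletedTensorMaps

variable {K : Type u} [Field K]
  {V V' V'' : Type u} [AddCommGroup V] [Module K V] [AddCommGroup V'] [Module K V']
  [AddCommGroup V''] [Module K V'']
  {M : Type v} [AddCommGroup M] [Module K M] {N : Type v'} [AddCommGroup N] [Module K N]
  {P : Type v''} [AddCommGroup P] [Module K P]
  {D : DirInv.{u, v, w} K M} {E : DirInv.{u, v', w} K N} {G : DirInv.{u, v'', w} K P}

theorem DirInv.Cont.id (D : DirInv.{u, v, w} K M) : DirInv.Cont D D LinearMap.id :=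
  fun j => ⟨j, fun _ h => h, fun i => ⟨i, fun _ h => h⟩⟩

/-- The map of completed tensor products that is induced by a linear map and a continuous linear
map. -/
def ctMap (g : V →ₗ[K] V') (f : M →ₗ[K] N) (hf : DirInv.Cont D E f) :
    CTensor V D →ₗ[K] CTensor V' E :=
  DirInv.complMap (TensorProduct.map g f) (hf.tensor g)

/-- The bilinear map of completed tensor products that is induced by a bilinear map and a
continuous bilinear map. -/
def ctMap₂ (g : V →ₗ[K] V' →ₗ[K] V'') (f : M →ₗ[K] N →ₗ[K] P) (hf : DirInv.Cont₂ D E G f) :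
    CTensor V D →ₗ[K] CTensor V' E →ₗ[K] CTensor V'' G :=
  DirInv.complMap₂ (TensorProduct.map₂ g f) (hf.tensor g)

/-- The map `V ⊗̂ M → K ⊗̂ M = M` that is induced by a linear form on `V`, for complete `M`. -/
def ctContract (c : V →ₗ[K] K) (hD : D.IsComplete) : CTensor V D →ₗ[K] M :=
  hD.equiv.symm.toLinearMap ∘ₗ DirInv.complMap _ (DirInv.cont_contract c)

theorem ctMap_comm {V₁ V₂ V₃ V₄ : Type u} [AddCommGroup V₁] [Module K V₁] [AddCommGroup V₂]
    [Module K V₂] [AddCommGroup V₃] [Module K V₃] [AddCommGroup V₄] [Module K V₄]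
    {M₁ M₂ M₃ M₄ : Type v} [AddCommGroup M₁] [Module K M₁] [AddCommGroup M₂]
    [Module K M₂] [AddCommGroup M₃] [Module K M₃] [AddCommGroup M₄] [Module K M₄]
    {D₁ : DirInv.{u, v, w} K M₁} {D₂ : DirInv.{u, v, w} K M₂} {D₃ : DirInv.{u, v, w} K M₃}
    {D₄ : DirInv.{u, v, w} K M₄}
    {g : V₁ →ₗ[K] V₂} {f : M₁ →ₗ[K] M₂} {hf : DirInv.Cont D₁ D₂ f}
    {g' : V₂ →ₗ[K] V₄} {f' : M₂ →ₗ[K] M₄} {hf' : DirInv.Cont D₂ D₄ f'}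
    {k : V₁ →ₗ[K] V₃} {l : M₁ →ₗ[K] M₃} {hl : DirInv.Cont D₁ D₃ l}
    {k' : V₃ →ₗ[K] V₄} {l' : M₃ →ₗ[K] M₄} {hl' : DirInv.Cont D₃ D₄ l'}
    (h : ∀ x, g' (g x) = k' (k x)) (h' : ∀ x, f' (f x) = l' (l x)) (x : CTensor V₁ D₁) :
    ctMap g' f' hf' (ctMap g f hf x) = ctMap k' l' hl' (ctMap k l hl x) := by
  obtain ⟨x, rfl⟩ := DirInv.cls_surjective _ x
  simp only [ctMap, DirInv.complMap_cls]
  congr 1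
  refine Subtype.ext (funext fun n => ?_)
  simp only [DirInv.cauchyMap, LinearMap.coe_mk, AddHom.coe_mk]
  induction (x : ℕ → V₁ ⊗[K] M₁) n using TensorProduct.induction_on with
  | zero => simp
  | add x y hx hy => simp only [map_add, hx, hy]
  | tmul v m => simp [h, h']

theorem ctMap_ctMap_zero {g : V →ₗ[K] V'} {f : M →ₗ[K] N} {hf : DirInv.Cont D E f}
    {g' : V' →ₗ[K] V''} {f' : N →ₗ[K] P} {hf' : DirInv.Cont E G f'}
    (h : (∀ x, g' (g x) = 0) ∨ ∀ x, f' (f x) = 0) (x : CTensor V D) :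
    ctMap g' f' hf' (ctMap g f hf x) = 0 := by
  obtain ⟨x, rfl⟩ := DirInv.cls_surjective _ x
  have : DirInv.cauchyMap (TensorProduct.map g' f') (hf'.tensor g')
      (DirInv.cauchyMap (TensorProduct.map g f) (hf.tensor g) x) = 0 := by
    refine Subtype.ext (funext fun n => ?_)
    simp only [DirInv.cauchyMap, LinearMap.coe_mk, AddHom.coe_mk]
    induction (x : ℕ → V ⊗[K] M) n using TensorProduct.induction_on with
    | zero => simp
    | add x y hx hy => simpa [hx] using hy
    | tmul v m => rcases h with h | h <;> simp [h]
  simp only [ctMap, DirInv.complMap_cls, this, map_zero]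

theorem ctMap_zero {g : V →ₗ[K] V'} {f : M →ₗ[K] N} {hf : DirInv.Cont D E f}
    (h : ∀ x, g x = 0) (x : CTensor V D) : ctMap g f hf x = 0 := by
  obtain rfl : g = 0 := LinearMap.ext h
  obtain ⟨x, rfl⟩ := DirInv.cls_surjective _ x
  have : DirInv.cauchyMap (TensorProduct.map (0 : V →ₗ[K] V') f) (hf.tensor _) x = 0 :=
    Subtype.ext (funext fun n => by simp [DirInv.cauchyMap])
  simp only [ctMap, DirInv.complMap_cls, this, map_zero]

theorem map_ctContract (c : V →ₗ[K] K) (hD : D.IsComplete) (hE : E.IsComplete) (f : M →ₗ[K] N)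
    (hf : DirInv.Cont D E f) (x : CTensor V D) :
    f (ctContract c hD x) = ctContract c hE (ctMap LinearMap.id f hf x) := by
  obtain ⟨x, rfl⟩ := DirInv.cls_surjective _ x
  have key : ∀ m : M, hE.equiv (f m) = DirInv.complMap f hf (hD.equiv m) := fun m => rfl
  simp only [ctContract, LinearMap.comp_apply, LinearEquiv.coe_coe, ctMap, DirInv.complMap_cls]
  rw [LinearEquiv.eq_symm_apply, key, LinearEquiv.apply_symm_apply, DirInv.complMap_cls]
  congr 1
  refine Subtype.ext (funext fun n => ?_)
  simp only [DirInv.cauchyMap, LinearMap.coe_mk, AddHom.coe_mk]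
  induction (x : ℕ → V ⊗[K] M) n using TensorProduct.induction_on with
  | zero => simp
  | add x y hx hy => simp only [map_add, hx, hy]
  | tmul v m => simp

section Products

variable {V₁ V₂ V₃ W₁ W₂ W₃ : Type u}
  [AddCommGroup V₁] [Module K V₁] [AddCommGroup V₂] [Module K V₂] [AddCommGroup V₃] [Module K V₃]
  [AddCommGroup W₁] [Module K W₁] [AddCommGroup W₂] [Module K W₂] [AddCommGroup W₃] [Module K W₃]
  {M₁ M₂ M₃ N₁ N₂ N₃ : Type v}
  [AddCommGroup M₁] [Module K M₁] [AddCommGroup M₂] [Module K M₂] [AddCommGroup M₃] [Module K M₃]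
  [AddCommGroup N₁] [Module K N₁] [AddCommGroup N₂] [Module K N₂] [AddCommGroup N₃] [Module K N₃]
  {D₁ : DirInv.{u, v, w} K M₁} {D₂ : DirInv.{u, v, w} K M₂} {D₃ : DirInv.{u, v, w} K M₃}
  {E₁ : DirInv.{u, v, w} K N₁} {E₂ : DirInv.{u, v, w} K N₂} {E₃ : DirInv.{u, v, w} K N₃}

theorem ctMap_ctMap₂ {γ : V₁ →ₗ[K] V₂ →ₗ[K] V₃} {γ' : W₁ →ₗ[K] W₂ →ₗ[K] W₃}
    {g₁ : V₁ →ₗ[K] W₁} {g₂ : V₂ →ₗ[K] W₂} {g₃ : V₃ →ₗ[K] W₃}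
    (hg : ∀ x y, g₃ (γ x y) = γ' (g₁ x) (g₂ y))
    {φ : M₁ →ₗ[K] M₂ →ₗ[K] M₃} {hφ : DirInv.Cont₂ D₁ D₂ D₃ φ}
    {φ' : N₁ →ₗ[K] N₂ →ₗ[K] N₃} {hφ' : DirInv.Cont₂ E₁ E₂ E₃ φ'}
    {f₁ : M₁ →ₗ[K] N₁} {hf₁ : DirInv.Cont D₁ E₁ f₁} {f₂ : M₂ →ₗ[K] N₂}
    {hf₂ : DirInv.Cont D₂ E₂ f₂} {f₃ : M₃ →ₗ[K] N₃} {hf₃ : DirInv.Cont D₃ E₃ f₃}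
    (hf : ∀ x y, f₃ (φ x y) = φ' (f₁ x) (f₂ y)) (x : CTensor V₁ D₁) (y : CTensor V₂ D₂) :
    ctMap g₃ f₃ hf₃ (ctMap₂ γ φ hφ x y) =
      ctMap₂ γ' φ' hφ' (ctMap g₁ f₁ hf₁ x) (ctMap g₂ f₂ hf₂ y) := by
  obtain ⟨x, rfl⟩ := DirInv.cls_surjective _ x
  obtain ⟨y, rfl⟩ := DirInv.cls_surjective _ y
  simp only [ctMap, ctMap₂, DirInv.complMap_cls, DirInv.complMap₂_cls]
  congr 1
  refine Subtype.ext (funext fun n => ?_)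
  simp only [DirInv.cauchyMap, DirInv.cauchyMap₂, LinearMap.coe_mk, AddHom.coe_mk,
    LinearMap.mk₂_apply]
  induction (x : ℕ → V₁ ⊗[K] M₁) n using TensorProduct.induction_on with
  | zero => simp
  | add x y hx hy => simp only [map_add, LinearMap.add_apply, hx, hy]
  | tmul v m =>
  induction (y : ℕ → V₂ ⊗[K] M₂) n using TensorProduct.induction_on with
  | zero => simp
  | add x y hx hy => simp only [map_add, hx, hy]
  | tmul v' m' => simp [hg, hf]

/-- A Leibniz rule for tensor products gives one for completed tensor products. -/
theorem ct_leibniz {γ : V₁ →ₗ[K] V₂ →ₗ[K] V₃} {γ₁ : W₁ →ₗ[K] V₂ →ₗ[K] W₃}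
    {γ₂ : V₁ →ₗ[K] W₂ →ₗ[K] W₃} {g₁ : V₁ →ₗ[K] W₁} {g₂ : V₂ →ₗ[K] W₂} {g₃ : V₃ →ₗ[K] W₃}
    {φ : M₁ →ₗ[K] M₂ →ₗ[K] M₃} {hφ : DirInv.Cont₂ D₁ D₂ D₃ φ}
    {φ₁ : N₁ →ₗ[K] M₂ →ₗ[K] N₃} {hφ₁ : DirInv.Cont₂ E₁ D₂ E₃ φ₁}
    {φ₂ : M₁ →ₗ[K] N₂ →ₗ[K] N₃} {hφ₂ : DirInv.Cont₂ D₁ E₂ E₃ φ₂}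
    {f₁ : M₁ →ₗ[K] N₁} {hf₁ : DirInv.Cont D₁ E₁ f₁} {f₂ : M₂ →ₗ[K] N₂}
    {hf₂ : DirInv.Cont D₂ E₂ f₂} {f₃ : M₃ →ₗ[K] N₃} {hf₃ : DirInv.Cont D₃ E₃ f₃} {c : K}
    (h : ∀ v m v' m', g₃ (γ v v') ⊗ₜ[K] f₃ (φ m m') =
      γ₁ (g₁ v) v' ⊗ₜ[K] φ₁ (f₁ m) m' + c • (γ₂ v (g₂ v') ⊗ₜ[K] φ₂ m (f₂ m')))
    (x : CTensor V₁ D₁) (y : CTensor V₂ D₂) :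
    ctMap g₃ f₃ hf₃ (ctMap₂ γ φ hφ x y) =
      ctMap₂ γ₁ φ₁ hφ₁ (ctMap g₁ f₁ hf₁ x) y + c • ctMap₂ γ₂ φ₂ hφ₂ x (ctMap g₂ f₂ hf₂ y) := by
  obtain ⟨x, rfl⟩ := DirInv.cls_surjective _ x
  obtain ⟨y, rfl⟩ := DirInv.cls_surjective _ y
  simp only [ctMap, ctMap₂, DirInv.complMap_cls, DirInv.complMap₂_cls]
  rw [← map_smul, ← map_add]
  congr 1
  refine Subtype.ext (funext fun n => ?_)
  simp only [DirInv.cauchyMap, DirInv.cauchyMap₂, LinearMap.coe_mk, AddHom.coe_mk,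
    LinearMap.mk₂_apply, Submodule.coe_add, Submodule.coe_smul, Pi.add_apply, Pi.smul_apply]
  induction (x : ℕ → V₁ ⊗[K] M₁) n using TensorProduct.induction_on with
  | zero => simp
  | add x y hx hy => simp only [map_add, LinearMap.add_apply, hx, hy, smul_add]; abel
  | tmul v m =>
  induction (y : ℕ → V₂ ⊗[K] M₂) n using TensorProduct.induction_on with
  | zero => simp
  | add x y hx hy => simp only [map_add, hx, hy, smul_add]; abel
  | tmul v' m' => simpa using h v m v' m'

end Products

end CompletedTensorMaps

/-! ### Cosimplicial DG algebras in dir-inv modules -/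

section Cosimplicial

set_option linter.checkUnivs false in
/-- A DG algebra in dir-inv modules: each homogeneous component is a dir-inv module, and the
differential and the multiplication are continuous. -/
structure DirInvDGAlg (K : Type u) [Field K] extends DGAlg.{u, v} K where
  D : ∀ i, DirInv.{u, v, w} K (X i)
  d_cont : ∀ i i' h, DirInv.Cont (D i) (D i') (d i i' h)
  mul_cont : ∀ i j k h, DirInv.Cont₂ (D i) (D j) (D k) (mul i j k h)

set_option linter.checkUnivs false in
/-- A cosimplicial DG algebra in dir-inv modules: a functor `[q] ↦ A^q` from the category of the
ordered sets `[q] = {0, …, q}` to the category of DG algebras in dir-inv modules, with the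
continuous homomorphisms of DG algebras. -/
structure CosimplicialDGAlg (K : Type u) [Field K] where
  obj : ℕ → DirInvDGAlg.{u, v, w} K
  map : ∀ {p q : ℕ}, (Fin (p + 1) →o Fin (q + 1)) → ∀ i, (obj p).X i →ₗ[K] (obj q).X i
  map_cont : ∀ {p q : ℕ} (α : Fin (p + 1) →o Fin (q + 1)) i,
    DirInv.Cont ((obj p).D i) ((obj q).D i) (map α i)
  map_id : ∀ p i (x : (obj p).X i), map (OrderHom.id : Fin (p + 1) →o Fin (p + 1)) i x = x
  map_comp : ∀ {p q r : ℕ} (β : Fin (q + 1) →o Fin (r + 1)) (α : Fin (p + 1) →o Fin (q + 1)) i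
    (x : (obj p).X i), map (β.comp α) i x = map β i (map α i x)
  map_d : ∀ {p q : ℕ} (α : Fin (p + 1) →o Fin (q + 1)) i i' h (x : (obj p).X i),
    map α i' ((obj p).d i i' h x) = (obj q).d i i' h (map α i x)
  map_mul : ∀ {p q : ℕ} (α : Fin (p + 1) →o Fin (q + 1)) i j k h (x : (obj p).X i)
    (y : (obj p).X j),
    map α k ((obj p).mul i j k h x y) = (obj q).mul i j k h (map α i x) (map α j y)

/-- The co-face map `[p] → [p + 1]`, the injective map that does not take the value `k`. -/
def coface {p p' : ℕ} (h : p + 1 = p') (k : ℕ) : Fin (p + 1) →o Fin (p' + 1) where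
  toFun x := ⟨if (x : ℕ) < k then x else x + 1, by have := x.2; split_ifs <;> omega⟩
  monotone' x y hxy := by
    have : (x : ℕ) ≤ y := hxy
    simp only [Fin.mk_le_mk]; split_ifs <;> omega

/-- The co-degeneracy map `[p + 1] → [p]`, the surjective map that takes the value `k` twice. -/
def codegen {p p' : ℕ} (h : p' + 1 = p) (k : Fin (p' + 1)) : Fin (p + 1) →o Fin (p' + 1) where
  toFun x := ⟨if (x : ℕ) ≤ k then x else x - 1, by
    have := x.2; have := k.2; split_ifs <;> omega⟩
  monotone' x y hxy := by
    have : (x : ℕ) ≤ y := hxy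
    simp only [Fin.mk_le_mk]; split_ifs <;> omega

/-- The front face `[p] → [p + q]`, `x ↦ x`. -/
def front {p q r : ℕ} (h : p + q = r) : Fin (p + 1) →o Fin (r + 1) where
  toFun x := ⟨x, by have := x.2; omega⟩
  monotone' _ _ hxy := hxy

/-- The back face `[q] → [p + q]`, `x ↦ p + x`. -/
def back {p q r : ℕ} (h : p + q = r) : Fin (q + 1) →o Fin (r + 1) where
  toFun x := ⟨p + x, by have := x.2; omega⟩
  monotone' x y hxy := by
    have : (x : ℕ) ≤ y := hxy
    simp only [Fin.mk_le_mk]; omega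

theorem coe_coface {p p' : ℕ} (h : p + 1 = p') (k : ℕ) (x : Fin (p + 1)) :
    (coface h k x : ℕ) = if (x : ℕ) < k then (x : ℕ) else x + 1 := rfl

theorem coe_codegen {p p' : ℕ} (h : p' + 1 = p) (k : Fin (p' + 1)) (x : Fin (p + 1)) :
    (codegen h k x : ℕ) = if (x : ℕ) ≤ k then (x : ℕ) else x - 1 := rfl

theorem coe_front {p q r : ℕ} (h : p + q = r) (x : Fin (p + 1)) : (front h x : ℕ) = x := rfl

theorem coe_back {p q r : ℕ} (h : p + q = r) (x : Fin (q + 1)) : (back h x : ℕ) = p + x := rfl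

variable {K : Type u} [Field K]

namespace CosimplicialDGAlg

variable (A : CosimplicialDGAlg.{u, v, w} K)

/-! #### The standard normalization -/

/-- The normalization `N^p`: the common kernel of the co-degeneracy maps on `A^p`. -/
def normSub (p : ℕ) (i : ℤ) : Submodule K ((A.obj p).X i) :=
  ⨅ (p' : ℕ) (h : p' + 1 = p) (k : Fin (p' + 1)), LinearMap.ker (A.map (codegen h k) i)

theorem mem_normSub {p : ℕ} {i : ℤ} {x : (A.obj p).X i} :
    x ∈ A.normSub p i ↔
      ∀ (p' : ℕ) (h : p' + 1 = p) (k : Fin (p' + 1)), A.map (codegen h k) i x = 0 := by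
  simp [normSub]

/-- The alternating sum of the co-face maps. -/
def delta (p p' : ℕ) (i : ℤ) (h : p + 1 = p') : (A.obj p).X i →ₗ[K] (A.obj p').X i :=
  ∑ k ∈ Finset.range (p' + 1), (-1 : K) ^ k • A.map (coface h k) i

theorem delta_apply (p p' : ℕ) (i : ℤ) (h : p + 1 = p') (x : (A.obj p).X i) :
    A.delta p p' i h x = ∑ k ∈ Finset.range (p' + 1), (-1 : K) ^ k • A.map (coface h k) i x := by
  simp [delta, LinearMap.sum_apply]

theorem delta_delta (p p' p'' : ℕ) (i : ℤ) (h : p + 1 = p') (h' : p' + 1 = p'')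
    (x : (A.obj p).X i) : A.delta p' p'' i h' (A.delta p p' i h x) = 0 := by
  subst h h'
  simp only [delta_apply, map_sum, map_smul, Finset.smul_sum, smul_smul, ← A.map_comp]
  rw [Finset.sum_sigma', ← Finset.sum_filter_add_sum_filter_not _ fun a => a.1 < a.2]
  rw [← eq_neg_iff_add_eq_zero, ← Finset.sum_neg_distrib]
  refine Finset.sum_nbij' (fun a => ⟨a.2 - 1, a.1⟩) (fun a => ⟨a.2, a.1 + 1⟩) ?_ ?_ ?_ ?_ ?_
  · rintro ⟨a, b⟩ hab; simp at hab ⊢; omega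
  · rintro ⟨a, b⟩ hab; simp at hab ⊢; omega
  · rintro ⟨a, b⟩ hab
    simp at hab
    simp only [Sigma.mk.injEq, heq_eq_eq, true_and]; omega
  · rintro ⟨a, b⟩ hab; simp
  · rintro ⟨a, b⟩ hab
    simp only [Finset.mem_filter, Finset.mem_sigma, Finset.mem_range] at hab
    obtain ⟨b, rfl⟩ : ∃ c, b = c + 1 := ⟨b - 1, by omega⟩
    have : (coface rfl (b + 1)).comp (coface (p := p) rfl a) =
        (coface rfl a).comp (coface (p := p) rfl b) := by
      ext y
      simp only [OrderHom.comp_coe, Function.comp_apply]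
      grind [coe_coface, coe_codegen, coe_front, coe_back]
    simp only [this, Nat.add_sub_cancel, ← neg_smul]
    congr 1
    ring

theorem delta_mem (p p' : ℕ) (i : ℤ) (h : p + 1 = p') (x : (A.obj p).X i)
    (hx : x ∈ A.normSub p i) : A.delta p p' i h x ∈ A.normSub p' i := by
  rw [mem_normSub] at hx ⊢
  intro q hq k
  obtain rfl : q = p := by omega
  subst h
  rw [delta_apply, map_sum]
  have h0 : ∀ j ∈ Finset.range (q + 1 + 1), j ≠ (k : ℕ) → j ≠ k + 1 →
      A.map (codegen hq k) i (A.map (coface rfl j) i x) = 0 := by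
    intro j hj h1 h2
    have hk := k.2
    rw [Finset.mem_range] at hj
    obtain ⟨m, rfl⟩ : ∃ m, q = m + 1 := ⟨q - 1, by omega⟩
    rw [← A.map_comp]
    rcases lt_or_gt_of_ne h1 with h1 | h1
    · have e : (codegen hq k).comp (coface rfl j) =
          (coface rfl j).comp (codegen rfl (⟨k - 1, by omega⟩ : Fin (m + 1))) := by
        ext y
        simp only [OrderHom.comp_coe, Function.comp_apply]
        grind [coe_coface, coe_codegen, coe_front, coe_back]
      rw [e, A.map_comp, hx, map_zero]
    · have e : (codegen hq k).comp (coface rfl j) =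
          (coface rfl (j - 1)).comp (codegen rfl (⟨k, by omega⟩ : Fin (m + 1))) := by
        ext y
        simp only [OrderHom.comp_coe, Function.comp_apply]
        grind [coe_coface, coe_codegen, coe_front, coe_back]
      rw [e, A.map_comp, hx, map_zero]
  have h1 : ∀ j, j = (k : ℕ) ∨ j = k + 1 →
      A.map (codegen hq k) i (A.map (coface rfl j) i x) = x := by
    intro j hj
    have hk := k.2
    have e : (codegen hq k).comp (coface rfl j) = OrderHom.id := by
      ext y
      simp only [OrderHom.comp_coe, Function.comp_apply, OrderHom.id_coe, id]
      grind [coe_coface, coe_codegen, coe_front, coe_back]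
    rw [← A.map_comp, e, A.map_id]
  have hk := k.2
  rw [Finset.sum_eq_add_of_mem (k : ℕ) (k + 1) (by simp only [Finset.mem_range]; omega)
    (by simp only [Finset.mem_range]; omega) (by omega)]
  · rw [map_smul, map_smul, h1 _ (Or.inl rfl), h1 _ (Or.inr rfl), ← add_smul, pow_succ]
    simp
  · rintro j hj ⟨h2, h3⟩
    rw [map_smul, h0 j hj h2 h3, smul_zero]

/-- The Alexander-Whitney product (without sign): the product of the images under the front face
and the back face. -/
def awMul (p q r : ℕ) (i j k : ℤ) (h : p + q = r) (e : i + j = k) :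
    (A.obj p).X i →ₗ[K] (A.obj q).X j →ₗ[K] (A.obj r).X k :=
  ((A.obj r).mul i j k e).compl₁₂ (A.map (front h) i) (A.map (back h) j)

theorem awMul_apply (p q r : ℕ) (i j k : ℤ) (h : p + q = r) (e : i + j = k) (x : (A.obj p).X i)
    (y : (A.obj q).X j) : A.awMul p q r i j k h e x y =
      (A.obj r).mul i j k e (A.map (front h) i x) (A.map (back h) j y) := rfl

theorem awMul_mem (p q r : ℕ) (i j k : ℤ) (h : p + q = r) (e : i + j = k) (x : (A.obj p).X i)
    (y : (A.obj q).X j) (hx : x ∈ A.normSub p i) (hy : y ∈ A.normSub q j) :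
    A.awMul p q r i j k h e x y ∈ A.normSub r k := by
  rw [mem_normSub] at hx hy ⊢
  intro r' hr s
  rw [awMul_apply, A.map_mul, ← A.map_comp, ← A.map_comp]
  have hs := s.2
  by_cases hsp : (s : ℕ) < p
  · obtain ⟨p', rfl⟩ : ∃ m, p = m + 1 := ⟨p - 1, by omega⟩
    have : (codegen hr s).comp (front h) =
        (front (q := q) (by omega)).comp (codegen rfl (⟨s, hsp⟩ : Fin (p' + 1))) := by
      ext y
      simp only [OrderHom.comp_coe, Function.comp_apply]
      grind [coe_coface, coe_codegen, coe_front, coe_back]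
    rw [this, A.map_comp, hx, map_zero, map_zero, LinearMap.zero_apply]
  · obtain ⟨q', rfl⟩ : ∃ m, q = m + 1 := ⟨q - 1, by omega⟩
    have : (codegen hr s).comp (back h) =
        (back (p := p) (by omega)).comp
          (codegen rfl (⟨s - p, by omega⟩ : Fin (q' + 1))) := by
      ext y
      simp only [OrderHom.comp_coe, Function.comp_apply]
      grind [coe_coface, coe_codegen, coe_front, coe_back]
    rw [this, A.map_comp (back _) (codegen _ _), hy, map_zero, map_zero]

theorem delta_awMul (p q r p' q' r' : ℕ) (i j k : ℤ) (h : p + q = r) (hp : p + 1 = p')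
    (hq : q + 1 = q') (hr : r + 1 = r') (h1 : p' + q = r') (h2 : p + q' = r') (e : i + j = k)
    (x : (A.obj p).X i) (y : (A.obj q).X j) :
    A.delta r r' k hr (A.awMul p q r i j k h e x y) =
      A.awMul p' q r' i j k h1 e (A.delta p p' i hp x) y +
        (-1 : K) ^ p • A.awMul p q' r' i j k h2 e x (A.delta q q' j hq y) := by
  subst hp hq
  set m := (A.obj r').mul i j k e with hm
  -- the two kinds of terms of the left hand side
  have L : ∀ s, s < p + 1 → A.map (coface hr s) k (A.awMul p q r i j k h e x y) =
      m (A.map (front h1) i (A.map (coface rfl s) i x)) (A.map (back h1) j y) := by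
    intro s hs
    rw [awMul_apply, A.map_mul, ← A.map_comp, ← A.map_comp, ← A.map_comp]
    have e1 : (coface hr s).comp (front h) = (front h1).comp (coface rfl s) := by
      ext y
      simp only [OrderHom.comp_coe, Function.comp_apply]
      grind [coe_coface, coe_codegen, coe_front, coe_back]
    have e2 : (coface hr s).comp (back h) = back h1 := by
      ext y
      simp only [OrderHom.comp_coe, Function.comp_apply]
      grind [coe_coface, coe_codegen, coe_front, coe_back]
    rw [e1, e2]
  have R : ∀ s, A.map (coface hr (p + 1 + s)) k (A.awMul p q r i j k h e x y) =
      m (A.map (front h2) i x) (A.map (back h2) j (A.map (coface rfl (s + 1)) j y)) := by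
    intro s
    rw [awMul_apply, A.map_mul, ← A.map_comp, ← A.map_comp, ← A.map_comp]
    have e1 : (coface hr (p + 1 + s)).comp (front h) = front h2 := by
      ext y
      have := y.2
      simp only [OrderHom.comp_coe, Function.comp_apply]
      grind [coe_coface, coe_codegen, coe_front, coe_back]
    have e2 : (coface hr (p + 1 + s)).comp (back h) = (back h2).comp (coface rfl (s + 1)) := by
      ext y
      simp only [OrderHom.comp_coe, Function.comp_apply]
      grind [coe_coface, coe_codegen, coe_front, coe_back]
    rw [e1, e2]
  have C1 : (front h1).comp (coface (p := p) rfl (p + 1)) = front h2 := by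
    ext y
    have := y.2
    simp only [OrderHom.comp_coe, Function.comp_apply]
    grind [coe_coface, coe_codegen, coe_front, coe_back]
  have C2 : (back h2).comp (coface (p := q) rfl 0) = back h1 := by
    ext y
    simp only [OrderHom.comp_coe, Function.comp_apply]
    grind [coe_coface, coe_codegen, coe_front, coe_back]
  have hr' : r' + 1 = (p + 1) + (q + 1) := by omega
  rw [delta_apply, hr', Finset.sum_range_add]
  simp only [R]
  have L' : ∑ s ∈ Finset.range (p + 1), (-1 : K) ^ s •
      A.map (coface hr s) k (A.awMul p q r i j k h e x y) =
      ∑ s ∈ Finset.range (p + 1), (-1 : K) ^ s •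
        m (A.map (front h1) i (A.map (coface rfl s) i x)) (A.map (back h1) j y) :=
    Finset.sum_congr rfl fun s hs => by rw [L s (Finset.mem_range.mp hs)]
  rw [L', awMul_apply, awMul_apply, delta_apply, delta_apply, Finset.sum_range_succ _ (p + 1),
    Finset.sum_range_succ' _ (q + 1)]
  simp only [map_add, map_sum, map_smul, LinearMap.add_apply, LinearMap.sum_apply,
    LinearMap.smul_apply, ← hm, smul_add, Finset.smul_sum, smul_smul]
  rw [← A.map_comp (front h1) (coface rfl (p + 1)), C1,
    ← A.map_comp (back h2) (coface rfl 0), C2]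
  have e3 : ∀ s, (-1 : K) ^ (p + 1 + s) = (-1) ^ p * (-1) ^ (s + 1) := fun s => by ring
  simp only [e3]
  have e4 : (-1 : K) ^ p * (-1) ^ 0 = - (-1) ^ (p + 1) := by ring
  rw [e4, neg_smul]
  abel

/-- The bigraded algebra `N^p A^{·, i}` with the differential `∂`, the differential of `A`, and the
Alexander-Whitney product. -/
def normBi : BiDGAlg.{u, v} K where
  X p i := A.normSub p i
  dh p p' i h := (A.delta p p' i h).restrict (A.delta_mem p p' i h)
  dv p i i' h := ((A.obj p).d i i' h).restrict fun x hx => by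
    rw [mem_normSub] at hx ⊢
    intro q hq k
    rw [A.map_d, hx, map_zero]
  mul p q r i j k h e := LinearMap.mk₂ K
    (fun x y => ⟨A.awMul p q r i j k h e x y, A.awMul_mem p q r i j k h e x y x.2 y.2⟩)
    (fun _ _ _ => Subtype.ext (LinearMap.map_add₂ _ _ _ _))
    (fun _ _ _ => Subtype.ext (LinearMap.map_smul₂ _ _ _ _))
    (fun _ _ _ => Subtype.ext (map_add _ _ _))
    (fun _ _ _ => Subtype.ext (map_smul _ _ _))
  dh_dh p p' p'' i h h' x := Subtype.ext (A.delta_delta p p' p'' i h h' x)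
  dv_dv p i i' i'' h h' x := Subtype.ext ((A.obj p).d_d i i' i'' h h' x)
  dh_dv p p' i i' h h' x := Subtype.ext (by
    change A.delta p p' i' h ((A.obj p).d i i' h' x) = (A.obj p').d i i' h' (A.delta p p' i h x)
    simp only [delta_apply, map_sum, map_smul, A.map_d])
  dh_mul p q r p' q' r' i j k h hp hq hr h1 h2 e x y :=
    Subtype.ext (A.delta_awMul p q r p' q' r' i j k h hp hq hr h1 h2 e x y)
  dv_mul p q r i j k i' j' k' h e ei ej ek e1 e2 x y := Subtype.ext (by
    change (A.obj r).d k k' ek (A.awMul p q r i j k h e x y) =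
      A.awMul p q r i' j k' h e1 ((A.obj p).d i i' ei x) y +
        (-1 : K) ^ i • A.awMul p q r i j' k' h e2 x ((A.obj q).d j j' ej y)
    simp only [awMul_apply, A.map_d]
    exact (A.obj r).leibniz ..)

/-- The DG algebra `N A`: the standard normalization with the Alexander-Whitney product
`(a, b) ↦ (-1)^{iq} front(a) back(b)` for `a ∈ N^p A^{·, i}` and `b ∈ N^q A^{·, j}`. -/
def N : DGAlg.{u, v} K := A.normBi.tot

/-! #### The complete Thom-Sullivan normalization -/

/-- `Ω^p(Δ^l) ⊗̂ A^{l, i}`. -/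
abbrev FormTensor (l p : ℕ) (i : ℤ) : Type (max u v) := CTensor (Form K l p) ((A.obj l).D i)

/-- The map `1 ⊗ α^*`. -/
def coeffMap {k l : ℕ} (p : ℕ) (i : ℤ) (α : Fin (k + 1) →o Fin (l + 1)) :
    A.FormTensor k p i →ₗ[K] CTensor (Form K k p) ((A.obj l).D i) :=
  ctMap LinearMap.id (A.map α i) (A.map_cont α i)

/-- The map `α_* ⊗ 1`. -/
def formMap {k l : ℕ} (p : ℕ) (i : ℤ) (α : Fin (k + 1) →o Fin (l + 1)) :
    A.FormTensor l p i →ₗ[K] CTensor (Form K k p) ((A.obj l).D i) :=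
  ctMap (Form.pull p α) LinearMap.id (DirInv.Cont.id _)

/-- The complete Thom-Sullivan normalization in degree `p` of the cosimplicial dir-inv module
`A^{·, i}`: the sequences `u_l ∈ Ω^p(Δ^l) ⊗̂ A^{l, i}` such that
`(1 ⊗ α^*) (u_k) = (α_* ⊗ 1) (u_l)` for all `α : [k] → [l]`. -/
def thomSub (p : ℕ) (i : ℤ) : Submodule K (∀ l, A.FormTensor l p i) :=
  ⨅ (k : ℕ) (l : ℕ) (α : Fin (k + 1) →o Fin (l + 1)),
    LinearMap.eqLocus (A.coeffMap p i α ∘ₗ LinearMap.proj k) (A.formMap p i α ∘ₗ LinearMap.proj l)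

theorem mem_thomSub {p : ℕ} {i : ℤ} {x : ∀ l, A.FormTensor l p i} :
    x ∈ A.thomSub p i ↔ ∀ (k l : ℕ) (α : Fin (k + 1) →o Fin (l + 1)),
      A.coeffMap p i α (x k) = A.formMap p i α (x l) := by
  simp [thomSub, LinearMap.mem_eqLocus]

/-- The exterior derivative `d ⊗ 1` on `Ω(Δ^l) ⊗̂ A^l`. -/
def formD (l p p' : ℕ) (i : ℤ) (h : p + 1 = p') : A.FormTensor l p i →ₗ[K] A.FormTensor l p' i :=
  ctMap (Form.d l p p' h) LinearMap.id (DirInv.Cont.id _)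

/-- The map `1 ⊗ d` on `Ω(Δ^l) ⊗̂ A^l`, for the differential `d` of `A^l`. -/
def coeffD (l p : ℕ) (i i' : ℤ) (h : i + 1 = i') : A.FormTensor l p i →ₗ[K] A.FormTensor l p i' :=
  ctMap LinearMap.id ((A.obj l).d i i' h) ((A.obj l).d_cont i i' h)

/-- The product `(ω ⊗ a, η ⊗ b) ↦ (ω ∧ η) ⊗ ab` on `Ω(Δ^l) ⊗̂ A^l` (without sign). -/
def formTensorMul (l p q r : ℕ) (i j k : ℤ) (h : p + q = r) (e : i + j = k) :
    A.FormTensor l p i →ₗ[K] A.FormTensor l q j →ₗ[K] A.FormTensor l r k :=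
  ctMap₂ (Form.mul l p q r h) ((A.obj l).mul i j k e) ((A.obj l).mul_cont i j k e)

theorem formD_mem (p p' : ℕ) (i : ℤ) (h : p + 1 = p') (x : ∀ l, A.FormTensor l p i)
    (hx : x ∈ A.thomSub p i) : (fun l => A.formD l p p' i h (x l)) ∈ A.thomSub p' i := by
  rw [mem_thomSub] at hx ⊢
  intro k l α
  let δ : CTensor (Form K k p) ((A.obj l).D i) →ₗ[K] CTensor (Form K k p') ((A.obj l).D i) :=
    ctMap (Form.d k p p' h) LinearMap.id (DirInv.Cont.id _)
  have e1 : A.coeffMap p' i α (A.formD k p p' i h (x k)) = δ (A.coeffMap p i α (x k)) :=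
    ctMap_comm (by intro _; rfl) (by intro _; rfl) (x k)
  have e2 : A.formMap p' i α (A.formD l p p' i h (x l)) = δ (A.formMap p i α (x l)) :=
    ctMap_comm (Form.pull_d p p' h α) (by intro _; rfl) (x l)
  rw [e1, e2, hx]

theorem coeffD_mem (p : ℕ) (i i' : ℤ) (h : i + 1 = i') (x : ∀ l, A.FormTensor l p i)
    (hx : x ∈ A.thomSub p i) : (fun l => A.coeffD l p i i' h (x l)) ∈ A.thomSub p i' := by
  rw [mem_thomSub] at hx ⊢
  intro k l α
  let δ : CTensor (Form K k p) ((A.obj l).D i) →ₗ[K] CTensor (Form K k p) ((A.obj l).D i') :=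
    ctMap LinearMap.id ((A.obj l).d i i' h) ((A.obj l).d_cont i i' h)
  have e1 : A.coeffMap p i' α (A.coeffD k p i i' h (x k)) = δ (A.coeffMap p i α (x k)) :=
    ctMap_comm (by intro _; rfl) (A.map_d α i i' h) (x k)
  have e2 : A.formMap p i' α (A.coeffD l p i i' h (x l)) = δ (A.formMap p i α (x l)) :=
    ctMap_comm (by intro _; rfl) (by intro _; rfl) (x l)
  rw [e1, e2, hx]

theorem formTensorMul_mem (p q r : ℕ) (i j k : ℤ) (h : p + q = r) (e : i + j = k)
    (x : ∀ l, A.FormTensor l p i) (y : ∀ l, A.FormTensor l q j)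
    (hx : x ∈ A.thomSub p i) (hy : y ∈ A.thomSub q j) :
    (fun l => A.formTensorMul l p q r i j k h e (x l) (y l)) ∈ A.thomSub r k := by
  rw [mem_thomSub] at hx hy ⊢
  intro a b α
  let μ : CTensor (Form K a p) ((A.obj b).D i) →ₗ[K] CTensor (Form K a q) ((A.obj b).D j) →ₗ[K]
      CTensor (Form K a r) ((A.obj b).D k) :=
    ctMap₂ (Form.mul a p q r h) ((A.obj b).mul i j k e) ((A.obj b).mul_cont i j k e)
  have e1 : A.coeffMap r k α (A.formTensorMul a p q r i j k h e (x a) (y a)) =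
      μ (A.coeffMap p i α (x a)) (A.coeffMap q j α (y a)) :=
    ctMap_ctMap₂ (by intro _ _; rfl) (A.map_mul α i j k e) (x a) (y a)
  have e2 : A.formMap r k α (A.formTensorMul b p q r i j k h e (x b) (y b)) =
      μ (A.formMap p i α (x b)) (A.formMap q j α (y b)) :=
    ctMap_ctMap₂ (Form.pull_mul p q r h α) (by intro _ _; rfl) (x b) (y b)
  rw [e1, e2, hx, hy]

theorem formD_coeffD (l p p' : ℕ) (i i' : ℤ) (h : p + 1 = p') (h' : i + 1 = i')
    (x : A.FormTensor l p i) :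
    A.formD l p p' i' h (A.coeffD l p i i' h' x) = A.coeffD l p' i i' h' (A.formD l p p' i h x) :=
  ctMap_comm (by intro _; rfl) (by intro _; rfl) x

theorem formD_formTensorMul (l p q r p' q' r' : ℕ) (i j k : ℤ) (h : p + q = r) (hp : p + 1 = p')
    (hq : q + 1 = q') (hr : r + 1 = r') (h1 : p' + q = r') (h2 : p + q' = r') (e : i + j = k)
    (x : A.FormTensor l p i) (y : A.FormTensor l q j) :
    A.formD l r r' k hr (A.formTensorMul l p q r i j k h e x y) =
      A.formTensorMul l p' q r' i j k h1 e (A.formD l p p' i hp x) y +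
        (-1 : K) ^ p • A.formTensorMul l p q' r' i j k h2 e x (A.formD l q q' j hq y) :=
  ct_leibniz (fun v m v' m' => by
    rw [Form.leibniz l p q r p' q' r' h hp hq hr h1 h2, TensorProduct.add_tmul,
      ← TensorProduct.smul_tmul']
    rfl) x y

theorem coeffD_formTensorMul (l p q r : ℕ) (i j k i' j' k' : ℤ) (h : p + q = r) (e : i + j = k)
    (ei : i + 1 = i') (ej : j + 1 = j') (ek : k + 1 = k') (e1 : i' + j = k') (e2 : i + j' = k')
    (x : A.FormTensor l p i) (y : A.FormTensor l q j) :
    A.coeffD l r k k' ek (A.formTensorMul l p q r i j k h e x y) =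
      A.formTensorMul l p q r i' j k' h e1 (A.coeffD l p i i' ei x) y +
        (-1 : K) ^ i • A.formTensorMul l p q r i j' k' h e2 x (A.coeffD l q j j' ej y) :=
  ct_leibniz (fun v m v' m' => by
    rw [(A.obj l).leibniz i j k i' j' k' e ei ej ek e1 e2, TensorProduct.tmul_add,
      TensorProduct.tmul_smul]
    rfl) x y

/-- The bigraded algebra of the modules `thomSub p i`, with the exterior derivative and the
differential of `A`. -/
def thomBi [CharZero K] : BiDGAlg.{u, max u v} K where
  X p i := A.thomSub p i
  dh p p' i h :=
    (LinearMap.pi fun l => A.formD l p p' i h ∘ₗ LinearMap.proj l).restrict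
      (A.formD_mem p p' i h)
  dv p i i' h :=
    (LinearMap.pi fun l => A.coeffD l p i i' h ∘ₗ LinearMap.proj l).restrict
      (A.coeffD_mem p i i' h)
  mul p q r i j k h e := LinearMap.mk₂ K
    (fun x y => ⟨fun l => A.formTensorMul l p q r i j k h e (x.1 l) (y.1 l),
      A.formTensorMul_mem p q r i j k h e x.1 y.1 x.2 y.2⟩)
    (fun x x' y => Subtype.ext (funext fun l =>
      LinearMap.map_add₂ (A.formTensorMul l p q r i j k h e) (x.1 l) (x'.1 l) (y.1 l)))
    (fun c x y => Subtype.ext (funext fun l =>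
      LinearMap.map_smul₂ (A.formTensorMul l p q r i j k h e) c (x.1 l) (y.1 l)))
    (fun x y y' => Subtype.ext (funext fun l =>
      map_add (A.formTensorMul l p q r i j k h e (x.1 l)) (y.1 l) (y'.1 l)))
    (fun c x y => Subtype.ext (funext fun l =>
      map_smul (A.formTensorMul l p q r i j k h e (x.1 l)) c (y.1 l)))
  dh_dh p p' p'' i h h' x := Subtype.ext (funext fun l =>
    ctMap_ctMap_zero (hf := DirInv.Cont.id _) (hf' := DirInv.Cont.id _)
      (Or.inl (Form.d_d l p p' p'' h h')) (x.1 l))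
  dv_dv p i i' i'' h h' x := Subtype.ext (funext fun l =>
    ctMap_ctMap_zero (hf := (A.obj l).d_cont i i' h) (hf' := (A.obj l).d_cont i' i'' h')
      (Or.inr ((A.obj l).d_d i i' i'' h h')) (x.1 l))
  dh_dv p p' i i' h h' x := Subtype.ext (funext fun l =>
    A.formD_coeffD l p p' i i' h h' (x.1 l))
  dh_mul p q r p' q' r' i j k h hp hq hr h1 h2 e x y := Subtype.ext (funext fun l =>
    A.formD_formTensorMul l p q r p' q' r' i j k h hp hq hr h1 h2 e (x.1 l) (y.1 l))
  dv_mul p q r i j k i' j' k' h e ei ej ek e1 e2 x y := Subtype.ext (funext fun l =>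
    A.coeffD_formTensorMul l p q r i j k i' j' k' h e ei ej ek e1 e2 (x.1 l) (y.1 l))

/-- The complete Thom-Sullivan normalization of `A`, as a DG algebra. Its differential and its
product are those of the DG algebras `Ω(Δ^l) ⊗̂ A^l`: `d (ω ⊗ a) = dω ⊗ a + (-1)^p ω ⊗ da` and
`(ω ⊗ a) (η ⊗ b) = (-1)^{iq} (ω ∧ η) ⊗ ab`, for `ω` of degree `p`, `a` of degree `i` and `η` of
degree `q`. -/
def TS [CharZero K] : DGAlg.{u, max u v} K := A.thomBi.tot

/-! #### Integration -/

theorem _root_.ThomSullivan.Form.pull_eq_zero {k l p : ℕ} (α : Fin (k + 1) →o Fin (l + 1))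
    (hp : l < p) (x : Form K l p) : Form.pull p α x = 0 := by
  have h0 : exteriorPower.map p (pullCotangent (K := K) α) = 0 := by
    apply exteriorPower.linearMap_ext
    ext m
    simp only [LinearMap.compAlternatingMap_apply, exteriorPower.map_apply_ιMulti,
      LinearMap.zero_apply]
    rw [AlternatingMap.map_linearDependent]
    · intro hli
      have := (LinearIndependent.of_comp (pullCotangent α) hli).fintype_card_le_finrank
      simp at this
      omega
  rw [Form.pull, h0, TensorProduct.map_zero_right, LinearMap.zero_apply]

/-- The map `∫_Δ : (u_l)_l ↦ ∫_{Δ^p} u_p`, from degree `p` of the complete Thom-Sullivan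
normalization to degree `p` of the standard normalization. -/
def integralBi (hA : ∀ q i, ((A.obj q).D i).IsComplete) (p : ℕ) (i : ℤ) :
    A.thomSub p i →ₗ[K] A.normSub p i :=
  (ctContract (Form.integral p) (hA p i) ∘ₗ LinearMap.proj p ∘ₗ
      (A.thomSub p i).subtype).codRestrict _ fun x => by
    rw [mem_normSub]
    intro p' h k
    have hx := (A.mem_thomSub.mp x.2) p p' (codegen h k)
    simp only [LinearMap.comp_apply, LinearMap.proj_apply, Submodule.subtype_apply]
    rw [map_ctContract _ (hA p i) (hA p' i) _ (A.map_cont _ i)]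
    unfold coeffMap formMap at hx
    rw [hx, ctMap_zero (Form.pull_eq_zero (codegen h k) (by omega)), map_zero]

/-- The map `∫_Δ` in total degree `n`. -/
def integral [CharZero K] (hA : ∀ q i, ((A.obj q).D i).IsComplete) (n : ℤ) :
    A.TS.X n →ₗ[K] A.N.X n :=
  DirectSum.toModule K (BiDGAlg.Bideg n) (A.normBi.TotX n) fun x =>
    A.normBi.inc n x.1.1 x.1.2 x.2 ∘ₗ A.integralBi hA x.1.1 x.1.2

end CosimplicialDGAlg

end Cosimplicial

end ThomSullivan

end

open scoped TensorProduct

noncomputable section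

universe u v v' v'' w w'

namespace ThomSullivan

/-! ### Pull back of forms along arbitrary maps of vertices -/

section Pull

variable {K : Type u} [Field K]

/-! All the work is done on polynomial forms on the simplices, by operators that are natural in the
simplex. A linear map of the discrete factor of a completed tensor product, and a finite identity
between such maps, extend to the completion, so everything then passes to Ω(Δ^l) ⊗̂ A^l.

Bijectivity in cohomology. Let h_i be the contraction of Ω(Δ^l) onto the vertex i: contract with the
Euler vector field centred at i and divide by the weight. Cartan's formula gives d h_i + h_i d = 1
in positive degrees, and h_i d = 1 minus the value at i on functions. Dupont's homotopy is s = ∑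
(-1)^k t_{i_0} dt_{i_1} ⋯ dt_{i_k} h_{i_k} ⋯ h_{i_0}, summed over all tuples of vertices. As ∑ t_i =
1 and ∑ dt_i = 0, the sum telescopes: ds + sd is the identity minus a combination of the forms
t_{i_0} dt_{i_1} ⋯ dt_{i_p}, whose coefficients are vertex values of iterated contractions. By
Stokes these coefficients are the integrals over the simplices with vertices i_0, …, i_p
(`Form.integral_cone`). For a compatible sequence all of them are controlled by the one integral ∫
u_p (`ctContract_pullFun_thom`), so s contracts the kernel of integration. Moreover s commutes with
every pull back of forms and has integral zero. Integration is surjective, because ∑_σ t_{σ_0}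
dt_{σ_1} ⋯ dt_{σ_p} ⊗ σ^*(a) is compatible and integrates to a / (p+1)! (`integralBi_surjective`). A
surjection with a contractible kernel is bijective in cohomology (`DGAlg.mapH_bijective`). It
commutes with the differentials by Stokes (`integralBi_dh`).

Multiplicativity. This is an acyclic models argument. On Δ^r let ψ_r(ω, η) be ∫ ω ∧ η minus the
product of the integrals over the front and the back face. Let δ be the alternating sum over the
faces and let d^* be the dual of the differential of Ω(Δ^r) ⊗ Ω(Δ^r). Stokes gives d^* ψ_{r+1} = δ
ψ_r. As Ω(Δ^r) ⊗ Ω(Δ^r) contracts to the constants, one can solve ψ_{r+1} = δ θ_r + d^* θ_{r+1}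
inductively (`Bil.psi_succ`). Pairing compatible sequences with θ_r turns δ into the cosimplicial
differential and d^* into the exterior derivatives, so θ becomes a homotopy between ∫(uv) and the
Alexander–Whitney product of ∫u and ∫v (`BiDGAlg.mapH_totMap_mul`). The contraction used to solve
for θ_r is onto the vertex 0, which every codegeneracy fixes; this keeps the values of the homotopy
in the normalization. -/

theorem sum_bary (l : ℕ) : ∑ i, bary K l i = 1 := by
  rw [Fin.sum_univ_succ]; simp [bary]

theorem sum_dbary (l : ℕ) : ∑ i, dbary K l i = 0 := by
  rw [Fin.sum_univ_succ]; simp [dbary]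

@[simp] theorem bary_succ (l : ℕ) (j : Fin l) : bary K l j.succ = MvPolynomial.X j := rfl

@[simp] theorem dbary_succ (l : ℕ) (j : Fin l) : dbary K l j.succ = Pi.single j 1 := rfl

/-- The pull back of functions along the affine map `Δ^k → Δ^l` that is `α` on the vertices. -/
def pullRingFun {k l : ℕ} (α : Fin (k + 1) → Fin (l + 1)) : SimplexRing K l →ₐ[K] SimplexRing K k :=
  MvPolynomial.aeval fun j : Fin l => ∑ i with α i = j.succ, bary K k i

/-- The pull back of constant one-forms along the affine map that is `α` on the vertices. -/
def pullCotangentFun {k l : ℕ} (α : Fin (k + 1) → Fin (l + 1)) :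
    Cotangent K l →ₗ[K] Cotangent K k :=
  Fintype.linearCombination K fun j : Fin l => ∑ i with α i = j.succ, dbary K k i

/-- The pull back of forms along the affine map that is `α` on the vertices. -/
def Form.pullFun {k l : ℕ} (p : ℕ) (α : Fin (k + 1) → Fin (l + 1)) : Form K l p →ₗ[K] Form K k p :=
  TensorProduct.map (pullRingFun α).toLinearMap (exteriorPower.map p (pullCotangentFun α))

theorem Form.pull_eq_pullFun {k l : ℕ} (p : ℕ) (α : Fin (k + 1) →o Fin (l + 1)) :
    Form.pull (K := K) p α = Form.pullFun p α := rfl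

theorem Form.pullFun_tmul {k l : ℕ} (p : ℕ) (α : Fin (k + 1) → Fin (l + 1)) (f : SimplexRing K l)
    (x : ⋀[K]^p (Cotangent K l)) :
    Form.pullFun p α (f ⊗ₜ x) = pullRingFun α f ⊗ₜ exteriorPower.map p (pullCotangentFun α) x := rfl

/-- The vertices are partitioned by the fibres of `α`. As t_0 and dt_0 are determined by the other
coordinates, this yields the pull back formula at the index 0 as well. -/
theorem sum_fiber_zero {k l : ℕ} (α : Fin (k + 1) → Fin (l + 1)) {V : Type*} [AddCommGroup V]
    (f : Fin (k + 1) → V) :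
    ∑ i, f i - ∑ j : Fin l, ∑ i with α i = j.succ, f i = ∑ i with α i = 0, f i := by
  rw [← Finset.sum_fiberwise (s := Finset.univ) (g := α), Fin.sum_univ_succ, add_sub_cancel_right]

theorem pullRingFun_bary {k l : ℕ} (α : Fin (k + 1) → Fin (l + 1)) (j : Fin (l + 1)) :
    pullRingFun α (bary K l j) = ∑ i with α i = j, bary K k i := by
  have hX : ∀ j : Fin l, pullRingFun α (MvPolynomial.X j : SimplexRing K l) =
      ∑ i with α i = j.succ, bary K k i := fun j => by simp [pullRingFun]
  refine Fin.cases ?_ (fun j => hX j) j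
  rw [← sum_fiber_zero, sum_bary]
  simp [bary, hX]

theorem pullCotangentFun_dbary {k l : ℕ} (α : Fin (k + 1) → Fin (l + 1)) (j : Fin (l + 1)) :
    pullCotangentFun α (dbary K l j) = ∑ i with α i = j, dbary K k i := by
  have hX : ∀ j : Fin l, pullCotangentFun α (Pi.single j 1 : Cotangent K l) =
      ∑ i with α i = j.succ, dbary K k i := fun j => by
    simp [pullCotangentFun, Fintype.linearCombination_apply_single]
  refine Fin.cases ?_ (fun j => hX j) j
  rw [← sum_fiber_zero, sum_dbary]
  simp [dbary, hX]

theorem sum_fiber_comp {k l m : ℕ} (α : Fin (k + 1) → Fin (l + 1)) (β : Fin (l + 1) → Fin (m + 1))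
    (j : Fin (m + 1)) {V : Type*} [AddCommGroup V] (f : Fin (k + 1) → V) :
    ∑ i with β i = j, ∑ a with α a = i, f a = ∑ a with β (α a) = j, f a := by
  rw [← Finset.sum_fiberwise_of_maps_to (s := Finset.univ.filter fun a => β (α a) = j)
    (t := Finset.univ.filter fun i => β i = j) (g := α) (by simp)]
  refine Finset.sum_congr rfl fun i hi => Finset.sum_congr ?_ fun _ _ => rfl
  ext a
  simp only [Finset.mem_filter, Finset.mem_univ, true_and] at hi ⊢
  exact ⟨fun h => ⟨h ▸ hi, h⟩, fun h => h.2⟩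

theorem pullRingFun_comp {k l m : ℕ} (α : Fin (k + 1) → Fin (l + 1)) (β : Fin (l + 1) → Fin (m + 1)) :
    pullRingFun (K := K) (β ∘ α) = (pullRingFun α).comp (pullRingFun β) := by
  refine MvPolynomial.algHom_ext fun j => ?_
  rw [AlgHom.comp_apply, ← bary_succ, pullRingFun_bary, pullRingFun_bary, map_sum]
  simp only [pullRingFun_bary]
  rw [sum_fiber_comp]; rfl

theorem pullCotangentFun_comp {k l m : ℕ} (α : Fin (k + 1) → Fin (l + 1))
    (β : Fin (l + 1) → Fin (m + 1)) :
    pullCotangentFun (K := K) (β ∘ α) = pullCotangentFun α ∘ₗ pullCotangentFun β := by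
  refine (Pi.basisFun K (Fin m)).ext fun j => ?_
  rw [LinearMap.comp_apply, Pi.basisFun_apply, ← dbary_succ, pullCotangentFun_dbary,
    pullCotangentFun_dbary, map_sum]
  simp only [pullCotangentFun_dbary]
  rw [sum_fiber_comp]; rfl

theorem pullRingFun_id (l : ℕ) : pullRingFun (K := K) (id : Fin (l + 1) → Fin (l + 1)) = AlgHom.id K _ := by
  refine MvPolynomial.algHom_ext fun j => ?_
  rw [← bary_succ, pullRingFun_bary]
  simp [Finset.filter_eq']

theorem pullCotangentFun_id (l : ℕ) :
    pullCotangentFun (K := K) (id : Fin (l + 1) → Fin (l + 1)) = LinearMap.id := by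
  refine (Pi.basisFun K (Fin l)).ext fun j => ?_
  rw [Pi.basisFun_apply, ← dbary_succ, pullCotangentFun_dbary]
  simp [Finset.filter_eq']

theorem Form.pullFun_comp {k l m : ℕ} (p : ℕ) (α : Fin (k + 1) → Fin (l + 1))
    (β : Fin (l + 1) → Fin (m + 1)) (x : Form K m p) :
    Form.pullFun p (β ∘ α) x = Form.pullFun p α (Form.pullFun p β x) := by
  induction x using TensorProduct.induction_on with
  | zero => simp
  | add x y hx hy => simp only [map_add, hx, hy]
  | tmul f x =>
    simp only [Form.pullFun_tmul, pullRingFun_comp, pullCotangentFun_comp, exteriorPower.map_comp]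
    rfl

theorem Form.pullFun_id {l : ℕ} (p : ℕ) (x : Form K l p) : Form.pullFun p id x = x := by
  induction x using TensorProduct.induction_on with
  | zero => simp
  | add x y hx hy => simp only [map_add, hx, hy]
  | tmul f x => simp [Form.pullFun_tmul, pullRingFun_id, pullCotangentFun_id]

/-- The chain rule for an affine map: its Jacobian is constant and is the matrix of
`pullCotangentFun α`. -/
theorem pderiv_pullRingFun {k l : ℕ} (α : Fin (k + 1) → Fin (l + 1)) (i : Fin k)
    (f : SimplexRing K l) :
    MvPolynomial.pderiv i (pullRingFun α f) = ∑ j : Fin l,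
      pullCotangentFun α (Pi.single j (1 : K)) i • pullRingFun α (MvPolynomial.pderiv j f) := by
  induction f using MvPolynomial.induction_on with
  | C a => simp [pullRingFun]
  | add p q hp hq => simp only [map_add, hp, hq, smul_add, Finset.sum_add_distrib]
  | mul_X p n h =>
    have hX : MvPolynomial.pderiv i (pullRingFun α (MvPolynomial.X n : SimplexRing K l)) =
        MvPolynomial.C (pullCotangentFun α (Pi.single n (1 : K)) i) := by
      simp [pullRingFun, pullCotangentFun, pderiv_bary, Fintype.linearCombination_apply_single]
    rw [map_mul, Derivation.leibniz, hX, h]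
    simp only [Derivation.leibniz, map_add, smul_add, Finset.sum_add_distrib, smul_eq_mul, map_mul,
      MvPolynomial.pderiv_X, Finset.mul_sum]
    congr 1
    · rw [Finset.sum_eq_single n]
      · simp [MvPolynomial.smul_eq_C_mul, mul_comm]
      · intro j _ hj
        simp [hj]
      · simp
    · refine Finset.sum_congr rfl fun j _ => ?_
      rw [mul_smul_comm]

theorem Form.pullFun_d {k l : ℕ} (p p' : ℕ) (h : p + 1 = p') (α : Fin (k + 1) → Fin (l + 1))
    (x : Form K l p) :
    Form.pullFun p' α (Form.d l p p' h x) = Form.d k p p' h (Form.pullFun p α x) := by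
  induction x using TensorProduct.induction_on with
  | zero => simp
  | add x y hx hy => simp only [map_add, hx, hy]
  | tmul f x =>
    simp only [Form.d_tmul, map_sum, Form.pullFun, TensorProduct.map_tmul,
      AlgHom.toLinearMap_apply, pderiv_pullRingFun, TensorProduct.sum_tmul]
    rw [Finset.sum_comm]
    refine Finset.sum_congr rfl fun j _ => ?_
    simp only [TensorProduct.smul_tmul, ← TensorProduct.tmul_sum]
    congr 1
    have e1 : exteriorPower.map p' (pullCotangentFun α)
        (extMul 1 p p' (by omega) (extOne (Pi.single j (1 : K))) x) =
        extMul 1 p p' (by omega) (extOne (pullCotangentFun α (Pi.single j (1 : K))))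
          (exteriorPower.map p (pullCotangentFun α) x) :=
      Subtype.ext (by simp [coe_extMap])
    have e2 : pullCotangentFun α (Pi.single j (1 : K)) =
        ∑ i, pullCotangentFun α (Pi.single j (1 : K)) i • Pi.single i (1 : K) := by
      ext a
      simp [Finset.sum_apply, Pi.single_apply]
    rw [e1, e2]
    simp only [map_sum, map_smul, LinearMap.sum_apply, LinearMap.smul_apply]
    rw [← e2]

/-- The exterior derivative, with the degree of the target computed. -/
abbrev Form.dS (l p : ℕ) : Form K l p →ₗ[K] Form K l (p + 1) := Form.d l p (p + 1) rfl

/-- Multiplication by a function. -/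
def Form.fmul (l p : ℕ) (f : SimplexRing K l) : Form K l p →ₗ[K] Form K l p :=
  TensorProduct.map (LinearMap.mulLeft K f) LinearMap.id

/-- Left multiplication by a constant one-form. -/
def Form.wedge (l p : ℕ) : Cotangent K l →ₗ[K] Form K l p →ₗ[K] Form K l (p + 1) :=
  TensorProduct.mapBilinear (.id K) (SimplexRing K l) (⋀[K]^p (Cotangent K l)) (SimplexRing K l) (⋀[K]^(p + 1) (Cotangent K l)) LinearMap.id
    ∘ₗ extMul 1 p (p + 1) (by omega) ∘ₗ extOne

@[simp] theorem Form.fmul_tmul (l p : ℕ) (f g : SimplexRing K l) (x : ⋀[K]^p (Cotangent K l)) :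
    Form.fmul l p f (g ⊗ₜ x) = (f * g) ⊗ₜ x := rfl

@[simp] theorem Form.wedge_tmul (l p : ℕ) (e : Cotangent K l) (g : SimplexRing K l)
    (x : ⋀[K]^p (Cotangent K l)) :
    Form.wedge l p e (g ⊗ₜ x) = g ⊗ₜ extMul 1 p (p + 1) (by omega) (extOne e) x := rfl

theorem Form.fmul_one (l p : ℕ) (x : Form K l p) : Form.fmul l p 1 x = x := by
  induction x using TensorProduct.induction_on with
  | zero => simp
  | add x y hx hy => simp only [map_add, hx, hy]
  | tmul f x => simp

theorem Form.fmul_sum (l p : ℕ) {ι : Type*} (s : Finset ι) (f : ι → SimplexRing K l) (x : Form K l p) :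
    Form.fmul l p (∑ i ∈ s, f i) x = ∑ i ∈ s, Form.fmul l p (f i) x := by
  induction x using TensorProduct.induction_on with
  | zero => simp
  | add x y hx hy => simp only [map_add, hx, hy, Finset.sum_add_distrib]
  | tmul f x => simp [Finset.sum_mul, TensorProduct.sum_tmul]

/-- A constant one-form is closed, so the exterior derivative only has to anticommute past it. -/
theorem Form.d_wedge (l p : ℕ) (e : Cotangent K l) (x : Form K l p) :
    Form.dS l (p + 1) (Form.wedge l p e x) = -Form.wedge l (p + 1) e (Form.dS l p x) := by
  induction x using TensorProduct.induction_on with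
  | zero => simp
  | add x y hx hy => simp only [map_add, hx, hy, neg_add]
  | tmul f x =>
    rw [Form.wedge_tmul, Form.d_tmul, Form.d_tmul, map_sum, ← Finset.sum_neg_distrib]
    refine Finset.sum_congr rfl fun j _ => ?_
    rw [Form.wedge_tmul, ← TensorProduct.tmul_neg]
    congr 1
    refine Subtype.ext ?_
    simp only [coe_extMul, coe_extOne, NegMemClass.coe_neg]
    rw [← mul_assoc, ι_mul_anti, ← mul_assoc, neg_mul]

theorem Form.d_fmul_bary (l p : ℕ) (i : Fin (l + 1)) (x : Form K l p) :
    Form.dS l p (Form.fmul l p (bary K l i) x) =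
      Form.wedge l p (dbary K l i) x + Form.fmul l (p + 1) (bary K l i) (Form.dS l p x) := by
  induction x using TensorProduct.induction_on with
  | zero => simp
  | add x y hx hy => simp only [map_add, hx, hy]; abel
  | tmul f x =>
    have e : dbary K l i = ∑ j, dbary K l i j • Pi.single j (1 : K) := by
      ext a
      simp [Finset.sum_apply, Pi.single_apply]
    have e2 : Form.wedge l p (dbary K l i) (f ⊗ₜ x) =
        ∑ j, dbary K l i j • Form.wedge l p (Pi.single j (1 : K)) (f ⊗ₜ x) := by
      conv_lhs => rw [e]
      simp only [map_sum, map_smul, LinearMap.sum_apply, LinearMap.smul_apply]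
    rw [Form.fmul_tmul, Form.d_tmul, Form.d_tmul, map_sum, e2, ← Finset.sum_add_distrib]
    refine Finset.sum_congr rfl fun j _ => ?_
    rw [Form.wedge_tmul, Form.fmul_tmul, Derivation.leibniz, pderiv_bary, TensorProduct.add_tmul,
      smul_eq_mul, smul_eq_mul, mul_comm f, ← MvPolynomial.smul_eq_C_mul,
      ← TensorProduct.smul_tmul']
    exact add_comm _ _

theorem Form.pullFun_fmul {k l : ℕ} (p : ℕ) (α : Fin (k + 1) → Fin (l + 1)) (f : SimplexRing K l)
    (x : Form K l p) :
    Form.pullFun p α (Form.fmul l p f x) = Form.fmul k p (pullRingFun α f) (Form.pullFun p α x) := by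
  induction x using TensorProduct.induction_on with
  | zero => simp
  | add x y hx hy => simp only [map_add, hx, hy]
  | tmul g x => simp [Form.pullFun_tmul]

theorem Form.pullFun_wedge {k l : ℕ} (p : ℕ) (α : Fin (k + 1) → Fin (l + 1)) (e : Cotangent K l)
    (x : Form K l p) :
    Form.pullFun (p + 1) α (Form.wedge l p e x) =
      Form.wedge k p (pullCotangentFun α e) (Form.pullFun p α x) := by
  induction x using TensorProduct.induction_on with
  | zero => simp
  | add x y hx hy => simp only [map_add, hx, hy]
  | tmul g x =>
    rw [Form.wedge_tmul, Form.pullFun_tmul, Form.pullFun_tmul, Form.wedge_tmul]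
    congr 1
    exact Subtype.ext (by simp [coe_extMap])

/-! ### Vanishing of forms in degrees above the dimension -/

theorem _root_.exteriorPower.map_eq_zero_of_finrank_lt {E F : Type u} [AddCommGroup E] [Module K E]
    [AddCommGroup F] [Module K F] {p : ℕ} (f : E →ₗ[K] F) [Module.Finite K (LinearMap.range f)]
    (hf : Module.finrank K (LinearMap.range f) < p) : exteriorPower.map p f = 0 := by
  apply exteriorPower.linearMap_ext
  ext m
  simp only [LinearMap.compAlternatingMap_apply, exteriorPower.map_apply_ιMulti,
    LinearMap.zero_apply]
  rw [AlternatingMap.map_linearDependent]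
  intro hli
  have : LinearIndependent K fun i => (⟨f (m i), LinearMap.mem_range_self f _⟩ : LinearMap.range f) :=
    LinearIndependent.of_comp (LinearMap.range f).subtype hli
  have := this.fintype_card_le_finrank
  simp at this
  omega

theorem Form.eq_zero_of_lt {l p : ℕ} (h : l < p) (x : Form K l p) : x = 0 := by
  have h0 : exteriorPower.map p (LinearMap.id : Cotangent K l →ₗ[K] Cotangent K l) = 0 :=
    exteriorPower.map_eq_zero_of_finrank_lt _ (by rw [LinearMap.range_id]; simpa using h)
  rw [← Form.pullFun_id p x, Form.pullFun, pullCotangentFun_id, h0, TensorProduct.map_zero_right,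
    LinearMap.zero_apply]

/-- The intermediate simplex has dimension `l`, too small to carry a nonzero `p`-form. This disposes
of degenerate simplices. -/
theorem Form.pullFun_eq_zero_of_factor {k l m p : ℕ} (α : Fin (k + 1) → Fin (l + 1)) (β : Fin (l + 1) → Fin (m + 1))
    (h : l < p) (x : Form K m p) : Form.pullFun p (β ∘ α) x = 0 := by
  rw [Form.pullFun_comp, Form.eq_zero_of_lt h (Form.pullFun p β x), map_zero]

end Pull

/-! ### The contraction of forms onto a vertex -/

section Contract

variable {K : Type u} [Field K]

/-- Induction with the antiderivation rule: the contraction of a ∧ x is φ(a) x minus a ∧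
(contraction of x), and both terms have one factor less. -/
theorem contractLeft_mem_exteriorPower {E : Type u} [AddCommGroup E] [Module K E]
    (φ : Module.Dual K E) (p : ℕ) (x : ExteriorAlgebra K E) (hx : x ∈ ⋀[K]^(p + 1) E) :
    CliffordAlgebra.contractLeft (Q := (0 : QuadraticForm K E)) φ x ∈ ⋀[K]^p E := by
  induction p generalizing x with
  | zero =>
    rw [ExteriorAlgebra.exteriorPower, zero_add, pow_one] at hx
    obtain ⟨a, rfl⟩ := hx
    rw [ExteriorAlgebra.exteriorPower, pow_zero]
    refine ⟨φ a, ((CliffordAlgebra.contractLeft_ι (Q := (0 : QuadraticForm K E)) (d := φ) a).trans ?_).symm⟩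
    rw [Algebra.algebraMap_eq_smul_one]; rfl
  | succ p ih =>
    rw [ExteriorAlgebra.exteriorPower, pow_succ'] at hx
    refine Submodule.mul_induction_on hx ?_ fun x y hx hy => ?_
    · rintro _ ⟨a, rfl⟩ b hb
      have := CliffordAlgebra.contractLeft_ι_mul (Q := (0 : QuadraticForm K E)) (d := φ) a b
      change CliffordAlgebra.contractLeft φ (CliffordAlgebra.ι 0 a * b) ∈ _
      rw [this]
      refine sub_mem (Submodule.smul_mem _ _ hb) ?_
      rw [ExteriorAlgebra.exteriorPower, pow_succ']
      exact Submodule.mul_mem_mul (LinearMap.mem_range_self _ a) (ih b hb)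
    · rw [map_add]; exact add_mem hx hy

/-- The contraction of exterior powers with a linear form. -/
def extContract {E : Type u} [AddCommGroup E] [Module K E] (φ : Module.Dual K E) (p : ℕ) :
    ⋀[K]^(p + 1) E →ₗ[K] ⋀[K]^p E :=
  (CliffordAlgebra.contractLeft (Q := (0 : QuadraticForm K E)) φ).restrict
    (contractLeft_mem_exteriorPower φ p)

theorem extContract_mul {E : Type u} [AddCommGroup E] [Module K E] (φ : Module.Dual K E) (p : ℕ)
    (a : E) (x : ⋀[K]^(p + 1) E) :
    extContract φ (p + 1) (extMul 1 (p + 1) (p + 2) (by omega) (extOne a) x) =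
      φ a • x - extMul 1 p (p + 1) (by omega) (extOne a) (extContract φ p x) :=
  Subtype.ext (CliffordAlgebra.contractLeft_ι_mul (Q := (0 : QuadraticForm K E)) (d := φ) a x)

theorem contractLeft_exteriorPower_zero {E : Type u} [AddCommGroup E] [Module K E]
    (φ : Module.Dual K E) (x : ⋀[K]^0 E) :
    CliffordAlgebra.contractLeft (Q := (0 : QuadraticForm K E)) φ x = 0 := by
  obtain ⟨x, hx⟩ := x
  rw [ExteriorAlgebra.exteriorPower, pow_zero] at hx
  obtain ⟨r, rfl⟩ := hx
  refine (congrArg _ ?_).trans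
    (CliffordAlgebra.contractLeft_algebraMap (Q := (0 : QuadraticForm K E)) (d := φ) r)
  exact (Algebra.algebraMap_eq_smul_one r).symm

theorem extContract_mul_zero {E : Type u} [AddCommGroup E] [Module K E] (φ : Module.Dual K E)
    (a : E) (x : ⋀[K]^0 E) :
    extContract φ 0 (extMul 1 0 (0 + 1) (by omega) (extOne a) x) = φ a • x := by
  refine Subtype.ext ?_
  have := CliffordAlgebra.contractLeft_ι_mul (Q := (0 : QuadraticForm K E)) (d := φ) a (x : ExteriorAlgebra K E)
  rw [contractLeft_exteriorPower_zero, mul_zero, sub_zero] at this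
  exact this

/-- The products a ∧ x generate the exterior power additively, as a scalar can be absorbed in a;
hence neither zero nor scalar multiples need a case of their own. -/
theorem exteriorPower_induction {E : Type u} [AddCommGroup E] [Module K E] {p : ℕ}
    {P : ⋀[K]^(p + 1) E → Prop} (add : ∀ x y, P x → P y → P (x + y))
    (mul : ∀ a x, P (extMul 1 p (p + 1) (by omega) (extOne a) x)) (x : ⋀[K]^(p + 1) E) : P x := by
  obtain ⟨x, hx⟩ := x
  have hx' := hx
  rw [ExteriorAlgebra.exteriorPower, pow_succ'] at hx'
  have : ∃ h, P ⟨x, h⟩ := by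
    refine Submodule.mul_induction_on hx' ?_ ?_
    · rintro _ ⟨a, rfl⟩ b hb
      exact ⟨_, mul a ⟨b, hb⟩⟩
    · rintro x y ⟨h1, hx⟩ ⟨h2, hy⟩
      exact ⟨_, add _ _ hx hy⟩
  exact this.2

theorem extContract_map {E F : Type u} [AddCommGroup E] [Module K E] [AddCommGroup F] [Module K F]
    (f : E →ₗ[K] F) (φ : Module.Dual K F) (p : ℕ) (x : ⋀[K]^(p + 1) E) :
    extContract φ p (exteriorPower.map (p + 1) f x) =
      exteriorPower.map p f (extContract (φ ∘ₗ f) p x) := by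
  have hm : ∀ (p : ℕ) (a : E) (x : ⋀[K]^p E),
      exteriorPower.map (p + 1) f (extMul 1 p (p + 1) (by omega) (extOne a) x) =
        extMul 1 p (p + 1) (by omega) (extOne (f a)) (exteriorPower.map p f x) := fun p a x =>
    Subtype.ext (by simp [coe_extMap])
  induction p with
  | zero =>
    induction x using exteriorPower_induction with
    | add x y hx hy => simp only [map_add, hx, hy]
    | mul a x => rw [hm, extContract_mul_zero, extContract_mul_zero, map_smul]; rfl
  | succ p ih =>
    induction x using exteriorPower_induction with
    | add x y hx hy => simp only [map_add, hx, hy]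
    | mul a x => rw [hm, extContract_mul, extContract_mul, ih, map_sub, hm, map_smul]; rfl

/-- The operator ∑ dt_j ∧ ι_j counts the factors of an exterior product. On a ∧ x the contraction of
a itself returns a ∧ x once; in the other term two signs cancel and induction counts the factors of
x. -/
theorem sum_mul_extContract {l : ℕ} (p : ℕ) (x : ⋀[K]^(p + 1) (Cotangent K l)) :
    ∑ j, extMul 1 p (p + 1) (by omega) (extOne (Pi.single j (1 : K)))
      (extContract (LinearMap.proj j) p x) = ((p + 1 : ℕ) : K) • x := by
  have hs : ∀ (p : ℕ) (a : Cotangent K l) (x : ⋀[K]^p (Cotangent K l)),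
      ∑ j, extMul 1 p (p + 1) (by omega) (extOne (Pi.single j (1 : K)))
        ((LinearMap.proj (R := K) (φ := fun _ : Fin l => K) j a) • x) =
        extMul 1 p (p + 1) (by omega) (extOne a) x := by
    intro p a x
    have e : a = ∑ j, a j • Pi.single j (1 : K) := by
      ext b
      simp [Finset.sum_apply, Pi.single_apply]
    conv_rhs => rw [e]
    simp only [map_sum, map_smul, LinearMap.sum_apply, LinearMap.smul_apply]
    rfl
  induction p with
  | zero =>
    induction x using exteriorPower_induction with
    | add x y hx hy => simp only [map_add, Finset.sum_add_distrib, smul_add, hx, hy]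
    | mul a x =>
      simp only [extContract_mul_zero]
      rw [hs]
      simp
  | succ p ih =>
    induction x using exteriorPower_induction with
    | add x y hx hy => simp only [map_add, Finset.sum_add_distrib, smul_add, hx, hy]
    | mul a x =>
      simp only [extContract_mul, map_sub, Finset.sum_sub_distrib]
      rw [hs]
      have e : ∀ j : Fin l, extMul 1 (p + 1) (p + 1 + 1) (by omega) (extOne (Pi.single j (1 : K)))
          (extMul 1 p (p + 1) (by omega) (extOne a) (extContract (LinearMap.proj j) p x)) =
          - extMul 1 (p + 1) (p + 1 + 1) (by omega) (extOne a)
          (extMul 1 p (p + 1) (by omega) (extOne (Pi.single j (1 : K))) (extContract (LinearMap.proj j) p x)) := by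
        intro j
        refine Subtype.ext ?_
        simp only [coe_extMul, coe_extOne, NegMemClass.coe_neg]
        rw [← mul_assoc, ι_mul_anti, ← mul_assoc, neg_mul]
      simp only [e, Finset.sum_neg_distrib, ← map_sum]
      rw [ih, map_smul, sub_neg_eq_add, Nat.cast_succ (p + 1), add_smul, one_smul]
      exact add_comm _ _

/-- The operator that multiplies a monomial of degree `m` by `(m + n)⁻¹`. -/
def weightInv (l n : ℕ) : SimplexRing K l →ₗ[K] SimplexRing K l :=
  (MvPolynomial.basisMonomials (Fin l) K).constr K fun a =>
    ((a.degree + n : ℕ) : K)⁻¹ • MvPolynomial.monomial a 1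

theorem weightInv_monomial (l n : ℕ) (a : Fin l →₀ ℕ) (c : K) :
    weightInv l n (MvPolynomial.monomial a c) =
      ((a.degree + n : ℕ) : K)⁻¹ • MvPolynomial.monomial a c := by
  have : MvPolynomial.monomial a c = c • MvPolynomial.basisMonomials (Fin l) K a := by
    simp [MvPolynomial.smul_monomial]
  rw [this, map_smul, weightInv, Module.Basis.constr_basis, smul_comm]
  simp

theorem weightInv_of_isHomogeneous {l m : ℕ} (n : ℕ) {f : SimplexRing K l} (hf : f.IsHomogeneous m) :
    weightInv l n f = ((m + n : ℕ) : K)⁻¹ • f := by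
  rw [f.as_sum, map_sum, Finset.smul_sum]
  refine Finset.sum_congr rfl fun a ha => ?_
  rw [weightInv_monomial, ← hf (MvPolynomial.mem_support_iff.mp ha), Finsupp.degree_eq_weight_one]
  rfl

/-- A derivative lowers the degree of a monomial by one, so the shift has to grow by one for the
weight to stay the same. It is the same exchange by which d turns a function coefficient into a
further factor dt_k. -/
theorem pderiv_weightInv (l n : ℕ) (k : Fin l) (f : SimplexRing K l) :
    MvPolynomial.pderiv k (weightInv l n f) = weightInv l (n + 1) (MvPolynomial.pderiv k f) := by
  induction f using MvPolynomial.induction_on' with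
  | add p q hp hq => simp only [map_add, hp, hq]
  | monomial a c =>
    rw [weightInv_monomial, Derivation.map_smul, MvPolynomial.pderiv_monomial, weightInv_monomial]
    by_cases h : a k = 0
    · simp [h]
    · have h1 : Finsupp.single k 1 ≤ a := by
        rw [Finsupp.single_le_iff]; omega
      have h2 : (a - Finsupp.single k 1).degree + 1 = a.degree := by
        conv_rhs => rw [← tsub_add_cancel_of_le h1, map_add]
        simp
      rw [← h2]
      congr 3
      omega

/-- By Euler's identity ∑ X_j ∂_j is multiplication by the degree m on a monomial; together with n +
1 this restores the factor m + n + 1, which is invertible in characteristic zero. -/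
theorem euler_weightInv [CharZero K] (l n : ℕ) (f : SimplexRing K l) :
    ∑ j, MvPolynomial.X j * MvPolynomial.pderiv j (weightInv l (n + 1) f) +
      ((n + 1 : ℕ) : K) • weightInv l (n + 1) f = f := by
  induction f using MvPolynomial.induction_on' with
  | add p q hp hq =>
    conv_rhs => rw [← hp, ← hq]
    simp only [map_add, mul_add, Finset.sum_add_distrib, smul_add]
    abel
  | monomial a c =>
    simp only [weightInv_monomial, Derivation.map_smul, mul_smul_comm]
    rw [← Finset.smul_sum, (MvPolynomial.isHomogeneous_monomial c rfl).sum_X_mul_pderiv,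
      ← Nat.cast_smul_eq_nsmul K, smul_smul, smul_smul, ← add_smul]
    have : ((a.degree + (n + 1) : ℕ) : K) ≠ 0 := Nat.cast_ne_zero.mpr (by omega)
    convert one_smul K _
    field_simp
    push_cast
    ring

/-- Without a shift the constant monomial has weight zero and cannot be recovered: its "inverse
weight" is 0⁻¹ = 0. This is the source of the vertex value in the contraction of functions. -/
theorem euler_weightInv_zero [CharZero K] (l : ℕ) (f : SimplexRing K l) :
    ∑ j, MvPolynomial.X j * MvPolynomial.pderiv j (weightInv l 0 f) =
      f - MvPolynomial.C (MvPolynomial.constantCoeff f) := by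
  induction f using MvPolynomial.induction_on' with
  | add p q hp hq =>
    simp only [map_add, mul_add, Finset.sum_add_distrib, hp, hq]
    abel
  | monomial a c =>
    simp only [weightInv_monomial, Derivation.map_smul, mul_smul_comm]
    rw [← Finset.smul_sum, (MvPolynomial.isHomogeneous_monomial c rfl).sum_X_mul_pderiv,
      ← Nat.cast_smul_eq_nsmul K, smul_smul]
    by_cases h : a = 0
    · subst h; simp
    · have : ((a.degree : ℕ) : K) ≠ 0 := by
        exact_mod_cast fun h0 => h ((Finsupp.degree_eq_zero_iff a).mp h0)
      rw [MvPolynomial.constantCoeff_monomial, if_neg h]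
      simp [this]

/-- The contraction of `Ω(Δ^l)` onto the vertex `0`: the contraction with the Euler vector field,
divided by the weight. -/
def Form.coneZero (l p : ℕ) : Form K l (p + 1) →ₗ[K] Form K l p :=
  ∑ j : Fin l, TensorProduct.map (LinearMap.mulLeft K (MvPolynomial.X j) ∘ₗ weightInv l (p + 1))
    (extContract (LinearMap.proj j) p)

theorem Form.coneZero_tmul (l p : ℕ) (f : SimplexRing K l) (x : ⋀[K]^(p + 1) (Cotangent K l)) :
    Form.coneZero l p (f ⊗ₜ x) = ∑ j : Fin l, (MvPolynomial.X j * weightInv l (p + 1) f) ⊗ₜ[K]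
      extContract (LinearMap.proj j) p x := by
  simp [Form.coneZero, LinearMap.sum_apply]

/-- Cartan's formula d ι_E + ι_E d = L_E for the Euler field E. On a monomial of degree m times a
constant (p+1)-form, L_E is multiplication by the weight m + p + 1, which `weightInv l (p + 1)`
inverts. -/
theorem Form.d_coneZero [CharZero K] (l p : ℕ) (x : Form K l (p + 1)) :
    Form.dS l p (Form.coneZero l p x) + Form.coneZero l (p + 1) (Form.dS l (p + 1) x) = x := by
  induction x using TensorProduct.induction_on with
  | zero => simp
  | add x y hx hy =>
    conv_rhs => rw [← hx, ← hy]
    simp only [map_add]; abel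
  | tmul f x =>
    set g := weightInv l (p + 1) f with hg
    -- The double sum of X_j ∂_k g ⊗ dt_k ∧ ι_j x occurs here and, with the opposite sign, in `h2`.
    -- What survives is (∑ X_j ∂_j g + (p + 1) g) ⊗ x, which is f ⊗ x by Euler's identity.
    have h1 : Form.dS l p (Form.coneZero l p (f ⊗ₜ x)) = ∑ k : Fin l, ∑ j : Fin l,
        (MvPolynomial.X j * MvPolynomial.pderiv k g) ⊗ₜ[K]
          extMul 1 p (p + 1) (by omega) (extOne (Pi.single k (1 : K)))
            (extContract (LinearMap.proj j) p x) + g ⊗ₜ[K] (((p + 1 : ℕ) : K) • x) := by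
      rw [Form.coneZero_tmul, map_sum]
      simp only [Form.d_tmul]
      rw [Finset.sum_comm, ← sum_mul_extContract, TensorProduct.tmul_sum, ← Finset.sum_add_distrib]
      refine Finset.sum_congr rfl fun k _ => ?_
      have : g ⊗ₜ[K] extMul 1 p (p + 1) (by omega) (extOne (Pi.single k (1 : K)))
            (extContract (LinearMap.proj k) p x) = ∑ j : Fin l,
          (MvPolynomial.pderiv k (MvPolynomial.X j) * g) ⊗ₜ[K]
            extMul 1 p (p + 1) (by omega) (extOne (Pi.single k (1 : K)))
            (extContract (LinearMap.proj j) p x) := by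
        rw [Finset.sum_eq_single k]
        · simp
        · intro b _ hb
          rw [MvPolynomial.pderiv_X_of_ne hb, zero_mul, TensorProduct.zero_tmul]
        · simp
      rw [this, ← Finset.sum_add_distrib]
      refine Finset.sum_congr rfl fun j _ => ?_
      rw [← TensorProduct.add_tmul, Derivation.leibniz, smul_eq_mul, smul_eq_mul, mul_comm _ g]
    have h2 : Form.coneZero l (p + 1) (Form.dS l (p + 1) (f ⊗ₜ x)) =
        (∑ j, MvPolynomial.X j * MvPolynomial.pderiv j g) ⊗ₜ[K] x -
        ∑ k : Fin l, ∑ j : Fin l,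
        (MvPolynomial.X j * MvPolynomial.pderiv k g) ⊗ₜ[K]
          extMul 1 p (p + 1) (by omega) (extOne (Pi.single k (1 : K)))
            (extContract (LinearMap.proj j) p x) := by
      rw [Form.d_tmul, map_sum, TensorProduct.sum_tmul, ← Finset.sum_sub_distrib]
      refine Finset.sum_congr rfl fun k _ => ?_
      rw [Form.coneZero_tmul]
      simp only [extContract_mul, ← pderiv_weightInv, TensorProduct.tmul_sub]
      rw [Finset.sum_sub_distrib, ← hg]
      congr 1
      rw [Finset.sum_eq_single k]
      · simp
      · intro b _ hb
        simp [hb]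
      · simp
    rw [h1, h2, TensorProduct.tmul_smul, TensorProduct.smul_tmul']
    conv_rhs => rw [← euler_weightInv l p f, TensorProduct.add_tmul]
    abel

theorem Form.coneZero_d_tmul [CharZero K] (l : ℕ) (f : SimplexRing K l) (x : ⋀[K]^0 (Cotangent K l)) :
    Form.coneZero l 0 (Form.dS l 0 (f ⊗ₜ x)) =
      f ⊗ₜ x - MvPolynomial.C (MvPolynomial.constantCoeff f) ⊗ₜ x := by
  rw [← TensorProduct.sub_tmul, ← euler_weightInv_zero, Form.d_tmul, map_sum, TensorProduct.sum_tmul]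
  refine Finset.sum_congr rfl fun k _ => ?_
  rw [Form.coneZero_tmul]
  simp only [← pderiv_weightInv]
  rw [Finset.sum_eq_single k]
  · rw [extContract_mul_zero]
    simp
  · intro b _ hb
    rw [extContract_mul_zero]
    simp [hb]
  · simp

/-- Since the vertex 0 lies over 0, the inhomogeneous coordinate t_0 does not occur in the pull back
of any X_j: the affine map is linear in the coordinates t_1, t_2, …. -/
theorem pullRingFun_isHomogeneous {k l m : ℕ} {α : Fin (k + 1) → Fin (l + 1)} (hα : α 0 = 0)
    {f : SimplexRing K l} (hf : f.IsHomogeneous m) :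
    (pullRingFun (K := K) α f).IsHomogeneous m := by
  have := hf.aeval (S := K) (n := 1) (fun j : Fin l => ∑ i with α i = j.succ, bary K k i) fun j => by
    refine MvPolynomial.IsHomogeneous.sum _ _ _ fun i hi => ?_
    obtain rfl | ⟨i, rfl⟩ := Fin.eq_zero_or_eq_succ i
    · simp [hα, (Fin.succ_ne_zero j).symm] at hi
    · exact MvPolynomial.isHomogeneous_X K i
  rwa [one_mul] at this

theorem weightInv_pullRingFun {k l n : ℕ} {α : Fin (k + 1) → Fin (l + 1)} (hα : α 0 = 0)
    (f : SimplexRing K l) :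
    weightInv k n (pullRingFun α f) = pullRingFun α (weightInv l n f) := by
  induction f using MvPolynomial.induction_on' with
  | add p q hp hq => simp only [map_add, hp, hq]
  | monomial a c =>
    have h := MvPolynomial.isHomogeneous_monomial (R := K) c (rfl : a.degree = a.degree)
    rw [weightInv_of_isHomogeneous n h, weightInv_of_isHomogeneous n (pullRingFun_isHomogeneous hα h),
      map_smul]

theorem pullRingFun_X_eq_sum {k l : ℕ} {α : Fin (k + 1) → Fin (l + 1)} (hα : α 0 = 0) (j : Fin l) :
    pullRingFun α (MvPolynomial.X j : SimplexRing K l) =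
      ∑ i : Fin k, pullCotangentFun α (Pi.single j (1 : K)) i • MvPolynomial.X i := by
  rw [← bary_succ, pullRingFun_bary, ← dbary_succ, pullCotangentFun_dbary]
  simp only [Finset.sum_filter, Fin.sum_univ_succ, hα, if_neg (Fin.succ_ne_zero j).symm, zero_add,
    Finset.sum_apply, bary_succ, dbary_succ]
  refine Finset.sum_congr rfl fun i _ => ?_
  rw [Finset.sum_eq_single i]
  · split_ifs <;> simp
  · intro b _ hb
    split_ifs <;> simp [hb.symm]
  · simp

/-- A map that fixes the vertex 0 is linear in these coordinates, so it carries the Euler field to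
the Euler field and preserves weights. -/
theorem Form.pullFun_coneZero {k l : ℕ} (p : ℕ) {α : Fin (k + 1) → Fin (l + 1)} (hα : α 0 = 0)
    (x : Form K l (p + 1)) :
    Form.pullFun p α (Form.coneZero l p x) = Form.coneZero k p (Form.pullFun (p + 1) α x) := by
  induction x using TensorProduct.induction_on with
  | zero => simp
  | add x y hx hy => simp only [map_add, hx, hy]
  | tmul f x =>
    rw [Form.pullFun_tmul, Form.coneZero_tmul, Form.coneZero_tmul, map_sum]
    simp only [Form.pullFun_tmul, map_mul, pullRingFun_X_eq_sum hα, weightInv_pullRingFun hα,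
      extContract_map, Finset.sum_mul, TensorProduct.sum_tmul]
    rw [Finset.sum_comm]
    refine Finset.sum_congr rfl fun i _ => ?_
    simp only [smul_mul_assoc, TensorProduct.smul_tmul, ← map_smul, ← TensorProduct.tmul_sum, ← map_sum]
    congr 2
    -- The same constant matrix expresses the pull back of the X_j and the push forward of the
    -- coordinate vector fields, so the two sums agree coefficient by coefficient.
    have e : (LinearMap.proj i ∘ₗ pullCotangentFun α : Module.Dual K (Cotangent K l)) =
        ∑ j, pullCotangentFun α (Pi.single j (1 : K)) i • LinearMap.proj j := by
      refine (Pi.basisFun K (Fin l)).ext fun j => ?_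
      simp [Pi.single_apply, LinearMap.sum_apply]
    rw [e]
    refine Subtype.ext ?_
    change _ = CliffordAlgebra.contractLeft _ _
    simp only [map_sum, map_smul, LinearMap.sum_apply, LinearMap.smul_apply]
    rw [AddSubmonoidClass.coe_finsetSum]
    rfl

end Contract

/-! ### Vertices, contractions onto the vertices, and integrals -/

section Integrals

variable {K : Type u} [Field K]

/-- The exterior power `⋀^0 E` is spanned by this element. -/
def extUnit (E : Type u) [AddCommGroup E] [Module K E] : ⋀[K]^0 E :=
  ⟨1, by rw [ExteriorAlgebra.exteriorPower, pow_zero]; exact Submodule.one_le.mp le_rfl⟩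

theorem exists_smul_extUnit {E : Type u} [AddCommGroup E] [Module K E] (x : ⋀[K]^0 E) :
    ∃ c : K, x = c • extUnit E := by
  obtain ⟨x, hx⟩ := x
  have hx' := hx
  rw [ExteriorAlgebra.exteriorPower, pow_zero] at hx'
  obtain ⟨r, rfl⟩ := hx'
  exact ⟨r, rfl⟩

theorem map_extUnit {E F : Type u} [AddCommGroup E] [Module K E] [AddCommGroup F] [Module K F]
    (f : E →ₗ[K] F) : exteriorPower.map 0 f (extUnit E) = extUnit F :=
  Subtype.ext (by rw [coe_extMap]; exact map_one _)

variable (K) in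
/-- The constant function `1`, as a form. -/
def Form.one (l : ℕ) : Form K l 0 := 1 ⊗ₜ extUnit _

theorem Form.pullFun_one {k l : ℕ} (α : Fin (k + 1) → Fin (l + 1)) :
    Form.pullFun 0 α (Form.one K l) = Form.one K k := by
  rw [Form.one, Form.pullFun_tmul, map_extUnit, map_one, Form.one]

/-- The linear form on the top exterior power of `K^l` that is the determinant. -/
def detForm (l : ℕ) : ⋀[K]^l (Cotangent K l) →ₗ[K] K :=
  exteriorPower.alternatingMapLinearEquiv (Pi.basisFun K (Fin l)).det

theorem detForm_ιMulti (l : ℕ) (v : Fin l → Cotangent K l) :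
    detForm l (exteriorPower.ιMulti K l v) = Matrix.det (Matrix.of v) := by
  rw [detForm, exteriorPower.alternatingMapLinearEquiv_apply_ιMulti]
  rw [Pi.basisFun_det]; rfl

theorem detForm_extUnit : detForm 0 (extUnit (Cotangent K 0)) = 1 := by
  have : extUnit (Cotangent K 0) = exteriorPower.ιMulti K 0 Fin.elim0 :=
    Subtype.ext (by simp [extUnit])
  rw [this, detForm_ιMulti]
  simp

theorem Form.integral_tmul (l : ℕ) (f : SimplexRing K l) (x : ⋀[K]^l (Cotangent K l)) :
    Form.integral l (f ⊗ₜ x) = integralRing l f * detForm l x := rfl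

theorem integralRing_prod_X (l : ℕ) (b : Fin l → ℕ) :
    integralRing l (∏ j, MvPolynomial.X j ^ b j : SimplexRing K l) =
      (∏ j, ((b j).factorial : K)) / ((l + ∑ j, b j).factorial : K) := by
  have : (∏ j, MvPolynomial.X j ^ b j : SimplexRing K l) =
      MvPolynomial.basisMonomials (Fin l) K (Finsupp.equivFunOnFinite.symm b) := by
    rw [MvPolynomial.coe_basisMonomials]
    change _ = MvPolynomial.monomial _ _
    rw [MvPolynomial.monomial_eq, Finsupp.prod_fintype _ _ (by simp)]
    simp
  rw [this, integralRing, Module.Basis.constr_basis]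
  simp

theorem Form.integral_one : Form.integral 0 (Form.one K 0) = 1 := by
  rw [Form.one, Form.integral_tmul, detForm_extUnit]
  have := integralRing_prod_X (K := K) 0 Fin.elim0
  simp at this
  simp [this]

/-- The value of a function at a vertex. -/
def Form.eval (l : ℕ) (i : Fin (l + 1)) : Form K l 0 →ₗ[K] K :=
  Form.integral 0 ∘ₗ Form.pullFun 0 fun _ : Fin 1 => i

theorem Form.eval_pullFun {k l : ℕ} (α : Fin (k + 1) → Fin (l + 1)) (i : Fin (k + 1)) (x : Form K l 0) :
    Form.eval k i (Form.pullFun 0 α x) = Form.eval l (α i) x := by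
  rw [Form.eval, LinearMap.comp_apply, ← Form.pullFun_comp]; rfl

/-- The vertex 0 is the origin of the coordinates t_1, …, t_l, so restricting to it reads off the
constant coefficient. -/
theorem pullRingFun_const_zero (l : ℕ) (f : SimplexRing K l) :
    pullRingFun (fun _ : Fin 1 => (0 : Fin (l + 1))) f =
      MvPolynomial.C (MvPolynomial.constantCoeff f) := by
  have : (pullRingFun (K := K) fun _ : Fin 1 => (0 : Fin (l + 1))) =
      (Algebra.ofId K _).comp (MvPolynomial.aeval fun _ => (0 : K)) := by
    refine MvPolynomial.algHom_ext fun j => ?_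
    rw [← bary_succ, pullRingFun_bary]
    simp [Fin.succ_ne_zero, eq_comm]
  rw [this, AlgHom.comp_apply]
  change MvPolynomial.C _ = _
  congr 1
  simp

theorem Form.coneZero_d [CharZero K] (l : ℕ) (x : Form K l 0) :
    Form.coneZero l 0 (Form.dS l 0 x) = x - Form.eval l 0 x • Form.one K l := by
  induction x using TensorProduct.induction_on with
  | zero => simp
  | add x y hx hy => simp only [map_add, hx, hy, add_smul]; abel
  | tmul f x =>
    obtain ⟨c, rfl⟩ := exists_smul_extUnit x
    rw [Form.coneZero_d_tmul]
    congr 1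
    have e : (MvPolynomial.C (MvPolynomial.constantCoeff f) : SimplexRing K 0) =
        MvPolynomial.constantCoeff f • 1 := by simp [MvPolynomial.smul_eq_C_mul]
    have e' : (MvPolynomial.C (MvPolynomial.constantCoeff f) : SimplexRing K l) =
        MvPolynomial.constantCoeff f • 1 := by simp [MvPolynomial.smul_eq_C_mul]
    have h1 : Form.eval l 0 (f ⊗ₜ[K] (c • extUnit (Cotangent K l))) =
        c * MvPolynomial.constantCoeff f := by
      rw [Form.eval, LinearMap.comp_apply, Form.pullFun_tmul, pullRingFun_const_zero, map_smul,
        map_extUnit, e, TensorProduct.tmul_smul, ← TensorProduct.smul_tmul']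
      have := Form.integral_one (K := K)
      rw [Form.one] at this
      simp [this]
    rw [h1, e', TensorProduct.tmul_smul, ← TensorProduct.smul_tmul', smul_smul]
    rfl

/-- The contraction of `Ω(Δ^l)` onto the vertex `i`. -/
def Form.cone (l p : ℕ) (i : Fin (l + 1)) : Form K l (p + 1) →ₗ[K] Form K l p :=
  Form.pullFun p (Equiv.swap 0 i) ∘ₗ Form.coneZero l p ∘ₗ Form.pullFun (p + 1) (Equiv.swap 0 i)

theorem Form.pullFun_swap_swap (l p : ℕ) (i : Fin (l + 1)) (x : Form K l p) :
    Form.pullFun p (Equiv.swap 0 i) (Form.pullFun p (Equiv.swap 0 i) x) = x := by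
  rw [← Form.pullFun_comp]
  convert Form.pullFun_id p x
  ext a
  simp

theorem Form.cone_zero (l p : ℕ) (x : Form K l (p + 1)) : Form.cone l p 0 x = Form.coneZero l p x := by
  simp only [Form.cone, LinearMap.comp_apply, Equiv.swap_self]
  exact (Form.pullFun_id p _).trans (congrArg _ (Form.pullFun_id _ _))

theorem Form.d_cone [CharZero K] (l p : ℕ) (i : Fin (l + 1)) (x : Form K l (p + 1)) :
    Form.dS l p (Form.cone l p i x) + Form.cone l (p + 1) i (Form.dS l (p + 1) x) = x := by
  simp only [Form.cone, LinearMap.comp_apply]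
  rw [← Form.pullFun_d, Form.pullFun_d (p + 1), ← map_add, Form.d_coneZero, Form.pullFun_swap_swap]

theorem Form.cone_d [CharZero K] (l : ℕ) (i : Fin (l + 1)) (x : Form K l 0) :
    Form.cone l 0 i (Form.dS l 0 x) = x - Form.eval l i x • Form.one K l := by
  simp only [Form.cone, LinearMap.comp_apply]
  rw [Form.pullFun_d, Form.coneZero_d, map_sub, map_smul, Form.pullFun_swap_swap, Form.eval_pullFun,
    Form.pullFun_one, Equiv.swap_apply_left]

/-- Conjugating `α` by the transpositions (0 i) and (0 α(i)) gives a map that fixes 0, to which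
`Form.pullFun_coneZero` applies. The transpositions are not monotone, which is why forms are pulled
back along arbitrary maps of vertices. -/
theorem Form.pullFun_cone {k l : ℕ} (p : ℕ) (α : Fin (k + 1) → Fin (l + 1)) (i : Fin (k + 1))
    (x : Form K l (p + 1)) :
    Form.pullFun p α (Form.cone l p (α i) x) = Form.cone k p i (Form.pullFun (p + 1) α x) := by
  simp only [Form.cone, LinearMap.comp_apply]
  rw [← Form.pullFun_comp, ← Form.pullFun_comp]
  have e : α ∘ Equiv.swap 0 i =
      Equiv.swap 0 (α i) ∘ (Equiv.swap 0 (α i) ∘ α ∘ Equiv.swap 0 i) := by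
    ext a
    simp
  have h0 : (Equiv.swap 0 (α i) ∘ α ∘ Equiv.swap 0 i) 0 = 0 := by simp
  rw [e, Form.pullFun_comp (p + 1), ← Form.pullFun_coneZero p h0, ← Form.pullFun_comp]
  congr 2
  ext a
  simp

/-! ### Dirichlet's formula in barycentric coordinates and the symmetry of the integral -/

theorem prod_pow_add_single {l : ℕ} {R : Type*} [CommMonoid R] (x : Fin l → R) (b : Fin l → ℕ)
    (k : Fin l) : ∏ j, x j ^ (b + Pi.single k 1 : Fin l → ℕ) j = x k * ∏ j, x j ^ b j := by
  simp only [Pi.add_apply, pow_add, Finset.prod_mul_distrib]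
  rw [mul_comm, Finset.prod_eq_single k (fun j _ hj => by simp [hj]) (by simp)]
  simp

theorem prod_factorial_add_single {l : ℕ} (b : Fin l → ℕ) (k : Fin l) :
    ∏ j, (((b + Pi.single k 1 : Fin l → ℕ) j).factorial : K) =
      (b k + 1 : K) * ∏ j, ((b j).factorial : K) := by
  rw [← Finset.mul_prod_erase _ _ (Finset.mem_univ k),
    ← Finset.mul_prod_erase _ (fun j => ((b j).factorial : K)) (Finset.mem_univ k), ← mul_assoc]
  congr 1
  · simp [Nat.factorial_succ]
  · refine Finset.prod_congr rfl fun j hj => ?_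
    simp [Finset.ne_of_mem_erase hj]

/-- The integral of a monomial in the barycentric coordinates. -/
theorem integralRing_prod_bary [CharZero K] (l : ℕ) (a : Fin (l + 1) → ℕ) :
    integralRing l (∏ i, bary K l i ^ a i) =
      (∏ i, ((a i).factorial : K)) / ((l + ∑ i, a i).factorial : K) := by
  -- Induction on the exponent n of t_0, replacing one factor t_0 by 1 - ∑ X_k. The numerators
  -- combine by (l + n + ∑ b_k + 1) - ∑ (b_k + 1) = n + 1.
  have key : ∀ (n : ℕ) (b : Fin l → ℕ),
      integralRing l (bary K l 0 ^ n * ∏ j, MvPolynomial.X j ^ b j) =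
        (n.factorial * ∏ j, ((b j).factorial : K)) / ((l + (n + ∑ j, b j)).factorial : K) := by
    intro n
    induction n with
    | zero => intro b; simp [integralRing_prod_X]
    | succ n ih =>
      intro b
      have e : bary K l 0 ^ (n + 1) * ∏ j, MvPolynomial.X j ^ b j =
          bary K l 0 ^ n * ∏ j, MvPolynomial.X j ^ b j -
          ∑ k, bary K l 0 ^ n * ∏ j, MvPolynomial.X j ^ (b + Pi.single k 1 : Fin l → ℕ) j := by
        simp only [prod_pow_add_single]
        rw [pow_succ]
        have : bary K l 0 = 1 - ∑ j, MvPolynomial.X j := rfl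
        nth_rewrite 2 [this]
        simp only [← mul_assoc, ← Finset.sum_mul, ← Finset.mul_sum]
        ring
      rw [e, map_sub, map_sum, ih]
      simp only [ih, prod_factorial_add_single]
      have h1 : ∀ k, ∑ j, (b + Pi.single k 1 : Fin l → ℕ) j = ∑ j, b j + 1 := fun k => by
        simp [Finset.sum_add_distrib]
      have h2 : ((l + (n + 1 + ∑ j, b j)).factorial : K) =
          ((l + n + ∑ j, b j : K) + 1) * ((l + (n + ∑ j, b j)).factorial : K) := by
        rw [show l + (n + 1 + ∑ j, b j) = l + (n + ∑ j, b j) + 1 by omega, Nat.factorial_succ]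
        push_cast
        ring
      have h3 : ∀ k, l + (n + ∑ j, (b + Pi.single k 1 : Fin l → ℕ) j) =
          l + (n + 1 + ∑ j, b j) := fun k => by rw [h1]; omega
      simp only [h3]
      have h4 : ((l + (n + ∑ j, b j)).factorial : K) ≠ 0 := Nat.cast_ne_zero.mpr (Nat.factorial_ne_zero _)
      have h5 : (l + n + ∑ j, b j : K) + 1 ≠ 0 := by exact_mod_cast Nat.succ_ne_zero (l + n + ∑ j, b j)
      rw [← Finset.sum_div, ← Finset.mul_sum, ← Finset.sum_mul, h2, Nat.factorial_succ]
      have h6 : ∑ k, (b k + 1 : K) = ∑ k, (b k : K) + l := by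
        rw [Finset.sum_add_distrib]; simp
      rw [h6]
      field_simp
      push_cast
      ring
  have := key (a 0) fun j => a j.succ
  rw [Fin.prod_univ_succ, Fin.prod_univ_succ, Fin.sum_univ_succ]
  exact this

/-- The Dirichlet formula is symmetric in the exponents of all l + 1 barycentric coordinates. -/
theorem integralRing_pullRingFun_perm [CharZero K] (l : ℕ) (π : Equiv.Perm (Fin (l + 1)))
    (f : SimplexRing K l) : integralRing l (pullRingFun π f) = integralRing l f := by
  have key : integralRing l ∘ₗ (pullRingFun (K := K) π).toLinearMap = integralRing l := by
    refine (MvPolynomial.basisMonomials (Fin l) K).ext fun b => ?_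
    have hb : MvPolynomial.basisMonomials (Fin l) K b =
        ∏ i, bary K l i ^ (Fin.cons 0 b : Fin (l + 1) → ℕ) i := by
      rw [MvPolynomial.coe_basisMonomials]
      change MvPolynomial.monomial _ _ = _
      rw [MvPolynomial.monomial_eq, Finsupp.prod_fintype _ _ (by simp), Fin.prod_univ_succ]
      simp
    have hp : ∀ i, pullRingFun π (bary K l i) = bary K l (π.symm i) := fun i => by
      rw [pullRingFun_bary]
      rw [Finset.sum_eq_single_of_mem (π.symm i) (by simp)]
      intro j hj hne
      exact absurd (by rw [← (Finset.mem_filter.mp hj).2]; simp) hne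
    rw [LinearMap.comp_apply, AlgHom.toLinearMap_apply, hb, map_prod]
    simp only [map_pow, hp]
    rw [← Equiv.prod_comp π]
    simp only [Equiv.symm_apply_apply]
    rw [integralRing_prod_bary, integralRing_prod_bary]
    rw [Equiv.prod_comp π fun i => (((Fin.cons 0 b : Fin (l + 1) → ℕ) i).factorial : K),
      Equiv.sum_comp π]
  exact LinearMap.congr_fun key f

/-- The function part of the integral does not see the permutation, and the top exterior power is
multiplied by a determinant. The value of the determinant is never needed, since the formula serves
to transport vanishing integrals. -/
theorem Form.integral_pullFun_perm [CharZero K] (l : ℕ) (π : Equiv.Perm (Fin (l + 1)))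
    (x : Form K l l) :
    Form.integral l (Form.pullFun l π x) =
      LinearMap.det (pullCotangentFun (K := K) π) * Form.integral l x := by
  have hd : detForm l ∘ₗ exteriorPower.map l (pullCotangentFun (K := K) π) =
      LinearMap.det (pullCotangentFun (K := K) π) • detForm l := by
    apply exteriorPower.linearMap_ext
    ext v
    simp only [LinearMap.compAlternatingMap_apply, LinearMap.comp_apply,
      exteriorPower.map_apply_ιMulti, detForm, exteriorPower.alternatingMapLinearEquiv_apply_ιMulti,
      LinearMap.smul_apply, smul_eq_mul]
    exact Module.Basis.det_comp _ _ _
  induction x using TensorProduct.induction_on with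
  | zero => simp
  | add x y hx hy => simp only [map_add, hx, hy, mul_add]
  | tmul f x =>
    have := LinearMap.congr_fun hd x
    simp only [LinearMap.comp_apply, LinearMap.smul_apply, smul_eq_mul] at this
    rw [Form.pullFun_tmul, Form.integral_tmul, Form.integral_tmul, this, integralRing_pullRingFun_perm]
    ring

end Integrals

/-! ### The Stokes formula -/

section Stokes

variable {K : Type u} [Field K]

theorem pullRingFun_succAbove_bary {p : ℕ} (k : Fin (p + 2)) (i : Fin (p + 1)) :
    pullRingFun (k.succAbove) (bary K (p + 1) (k.succAbove i)) = bary K p i := by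
  rw [pullRingFun_bary, Finset.sum_eq_single_of_mem i (by simp)]
  intro j hj hne
  exact absurd (Fin.succAbove_right_injective (Finset.mem_filter.mp hj).2) hne

theorem pullRingFun_succAbove_bary_self {p : ℕ} (k : Fin (p + 2)) :
    pullRingFun (k.succAbove) (bary K (p + 1) k) = 0 := by
  rw [pullRingFun_bary]
  exact Finset.sum_eq_zero fun j hj => absurd (Finset.mem_filter.mp hj).2 (Fin.succAbove_ne k j)

theorem integralRing_pullRingFun_zero [CharZero K] {p : ℕ} (b : Fin (p + 1) → ℕ) :
    integralRing p (pullRingFun (Fin.succAbove 0) (∏ j, MvPolynomial.X j ^ b j : SimplexRing K (p + 1))) =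
      (∏ j, ((b j).factorial : K)) / ((p + ∑ j, b j).factorial : K) := by
  rw [map_prod, ← integralRing_prod_bary]
  congr 1
  refine Finset.prod_congr rfl fun j _ => ?_
  rw [map_pow, ← bary_succ, ← Fin.succAbove_zero, pullRingFun_succAbove_bary]

/-- On this face t_{j+1} is zero, so only monomials not involving it survive. Giving t_0 the
exponent 0 puts the monomial in the symmetric form of Dirichlet's formula. -/
theorem integralRing_pullRingFun_succ [CharZero K] {p : ℕ} (j : Fin (p + 1)) (b : Fin (p + 1) → ℕ) :
    integralRing p (pullRingFun (Fin.succAbove j.succ)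
        (∏ j, MvPolynomial.X j ^ b j : SimplexRing K (p + 1))) =
      if b j = 0 then (∏ j, ((b j).factorial : K)) / ((p + ∑ j, b j).factorial : K) else 0 := by
  set a : Fin (p + 2) → ℕ := Fin.cons 0 b with ha
  have e : (∏ j, MvPolynomial.X j ^ b j : SimplexRing K (p + 1)) = ∏ i, bary K (p + 1) i ^ a i := by
    rw [Fin.prod_univ_succ fun i => bary K (p + 1) i ^ a i]; simp [ha]
  have e1 : ∏ j, ((b j).factorial : K) = ∏ i, ((a i).factorial : K) := by
    rw [Fin.prod_univ_succ fun i => ((a i).factorial : K)]; simp [ha]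
  have e2 : ∑ j, b j = ∑ i, a i := by
    rw [Fin.sum_univ_succ a]; simp [ha]
  have e3 : b j = a j.succ := by simp [ha]
  rw [e, e1, e2, e3, map_prod, Fin.prod_univ_succAbove _ j.succ, Fin.prod_univ_succAbove _ j.succ,
    Fin.sum_univ_succAbove _ j.succ]
  simp only [map_pow, pullRingFun_succAbove_bary_self, pullRingFun_succAbove_bary]
  split_ifs with h
  · rw [h, pow_zero, one_mul, integralRing_prod_bary]; simp
  · rw [zero_pow h, zero_mul, map_zero]

/-- The fundamental theorem of calculus in the direction of t_{j+1}: lines in this direction enter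
the simplex through the face t_{j+1} = 0 and leave it through the face t_0 = 0. -/
theorem integralRing_pderiv [CharZero K] {p : ℕ} (j : Fin (p + 1)) (f : SimplexRing K (p + 1)) :
    integralRing (p + 1) (MvPolynomial.pderiv j f) =
      integralRing p (pullRingFun (Fin.succAbove 0) f) -
        integralRing p (pullRingFun (Fin.succAbove j.succ) f) := by
  have key : integralRing (p + 1) ∘ₗ (MvPolynomial.pderiv j).toLinearMap =
      integralRing p ∘ₗ (pullRingFun (K := K) (Fin.succAbove 0)).toLinearMap -
        integralRing p ∘ₗ (pullRingFun (K := K) (Fin.succAbove j.succ)).toLinearMap := by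
    refine (MvPolynomial.basisMonomials (Fin (p + 1)) K).ext fun b => ?_
    have hb : MvPolynomial.basisMonomials (Fin (p + 1)) K b = ∏ i, MvPolynomial.X i ^ b i := by
      rw [MvPolynomial.coe_basisMonomials]
      change MvPolynomial.monomial _ _ = _
      rw [MvPolynomial.monomial_eq, Finsupp.prod_fintype _ _ (by simp)]
      simp
    have hd : MvPolynomial.pderiv j (∏ i, MvPolynomial.X i ^ b i : SimplexRing K (p + 1)) =
        (b j : K) • ∏ i, MvPolynomial.X i ^ (b - Finsupp.single j 1 : Fin (p + 1) →₀ ℕ) i := by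
      have h1 : ∀ b : Fin (p + 1) →₀ ℕ, (∏ i, MvPolynomial.X i ^ b i : SimplexRing K (p + 1)) =
          MvPolynomial.monomial b 1 := fun b => by
        rw [MvPolynomial.monomial_eq, Finsupp.prod_fintype _ _ (by simp)]
        simp
      rw [h1, h1, MvPolynomial.pderiv_monomial, MvPolynomial.smul_monomial]
      simp
    simp only [LinearMap.comp_apply, LinearMap.sub_apply, AlgHom.toLinearMap_apply]
    change integralRing (p + 1) (MvPolynomial.pderiv j _) = _
    rw [hb, hd, integralRing_pullRingFun_zero, integralRing_pullRingFun_succ, map_smul,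
      integralRing_prod_X]
    -- If t_{j+1} does not occur, the derivative is zero and the two face integrals agree; if it
    -- occurs, the face t_{j+1} = 0 contributes nothing.
    by_cases h : b j = 0
    · simp [h]
    · rw [if_neg h, sub_zero]
      set c : Fin (p + 1) → ℕ := ⇑(b - Finsupp.single j 1 : Fin (p + 1) →₀ ℕ) with hc
      have e : (b : Fin (p + 1) → ℕ) = c + Pi.single j 1 := by
        ext i
        by_cases hi : i = j
        · subst hi; simp [hc]; omega
        · simp [hc, hi]
      have ej : b j = c j + 1 := by rw [e]; simp
      have es : ∑ i, b i = ∑ i, c i + 1 := by rw [e]; simp [Finset.sum_add_distrib]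
      have ep : ∏ i, ((b i).factorial : K) = (c j + 1 : K) * ∏ i, ((c i).factorial : K) := by
        rw [e, prod_factorial_add_single]
      rw [es, ep, ej, show p + 1 + ∑ i, c i = p + (∑ i, c i + 1) by omega, smul_eq_mul]
      push_cast
      ring
  exact LinearMap.congr_fun key f

/-! ### Determinants of the restrictions to the faces -/

theorem extMul_ιMulti {E : Type u} [AddCommGroup E] [Module K E] (p : ℕ) (e : E) (v : Fin p → E) :
    extMul 1 p (p + 1) (by omega) (extOne (K := K) e) (exteriorPower.ιMulti K p v) =
      exteriorPower.ιMulti K (p + 1) (Fin.cons e v : Fin (p + 1) → E) :=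
  Subtype.ext (by
    simp only [coe_extMul, coe_extOne, exteriorPower.ιMulti_apply_coe]
    rw [ExteriorAlgebra.ιMulti_succ_apply]
    simp [Matrix.vecTail, Function.comp_def])

theorem pullCotangentFun_succAbove_succ_apply {p : ℕ} (j : Fin (p + 1)) (v : Cotangent K (p + 1))
    (b : Fin p) : pullCotangentFun (Fin.succAbove j.succ) v b = v (j.succAbove b) := by
  rw [pullCotangentFun, Fintype.linearCombination_apply, Finset.sum_apply,
    Finset.sum_eq_single (j.succAbove b)]
  · have : (Finset.univ.filter fun i : Fin (p + 1) => j.succ.succAbove i = (j.succAbove b).succ) =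
        {b.succ} := by
      ext i
      simp only [Finset.mem_filter, Finset.mem_univ, true_and, Finset.mem_singleton]
      rw [← Fin.succ_succAbove_succ, Fin.succAbove_right_inj]
    rw [this]; simp
  · intro a _ ha
    rw [Pi.smul_apply, Finset.sum_apply, Finset.sum_eq_zero, smul_zero]
    intro i hi
    obtain rfl | ⟨i, rfl⟩ := Fin.eq_zero_or_eq_succ i
    · simp [Fin.succ_ne_zero, eq_comm] at hi
    · have hi := (Finset.mem_filter.mp hi).2
      rw [Fin.succ_succAbove_succ, Fin.succ_inj] at hi
      rw [dbary_succ, Pi.single_apply, if_neg]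
      rintro rfl
      exact ha hi.symm
  · simp

/-- On the face opposite to the vertex 0 the old vertex 1 is the new origin, so dt_1 restricts to
minus the sum of the coordinate differentials of the face. -/
theorem pullCotangentFun_succAbove_zero_apply {p : ℕ} (v : Cotangent K (p + 1))
    (b : Fin p) : pullCotangentFun (Fin.succAbove 0) v b = v b.succ - v 0 := by
  have : ∀ j : Fin (p + 1), (Finset.univ.filter fun i : Fin (p + 1) => Fin.succAbove 0 i = j.succ) = {j} := by
    intro j
    ext i
    simp
  rw [pullCotangentFun, Fintype.linearCombination_apply, Fin.sum_univ_succ]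
  simp only [this, Finset.sum_singleton, dbary_succ]
  simp [dbary, Finset.sum_apply, Pi.single_apply]
  ring

/-- Restriction to this face deletes the j-th coordinate, so this is the Laplace expansion of a
determinant whose first row is the j-th unit vector. -/
theorem detForm_map_succAbove_succ {p : ℕ} (j : Fin (p + 1)) (y : ⋀[K]^p (Cotangent K (p + 1))) :
    detForm p (exteriorPower.map p (pullCotangentFun (Fin.succAbove j.succ)) y) =
      (-1) ^ (j : ℕ) * detForm (p + 1) (extMul 1 p (p + 1) (by omega) (extOne (Pi.single j (1 : K))) y) := by
  have key : detForm p ∘ₗ exteriorPower.map p (pullCotangentFun (K := K) (Fin.succAbove j.succ)) =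
      (-1 : K) ^ (j : ℕ) • (detForm (p + 1) ∘ₗ
        extMul 1 p (p + 1) (by omega) (extOne (Pi.single j (1 : K)))) := by
    apply exteriorPower.linearMap_ext
    ext v
    simp only [LinearMap.compAlternatingMap_apply, LinearMap.comp_apply,
      exteriorPower.map_apply_ιMulti, LinearMap.smul_apply, smul_eq_mul, extMul_ιMulti, detForm_ιMulti]
    rw [Matrix.det_succ_row_zero, Finset.sum_eq_single j]
    · simp only [Matrix.of_apply, Fin.cons_zero, Pi.single_eq_same, mul_one, ← mul_assoc, ← mul_pow]
      simp only [mul_neg, mul_one, neg_neg, one_pow, one_mul]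
      congr 1
      ext a b
      simp [pullCotangentFun_succAbove_succ_apply]
    · intro b _ hb
      simp [hb]
    · simp
  exact LinearMap.congr_fun key y

theorem detForm_map_succAbove_zero {p : ℕ} (y : ⋀[K]^p (Cotangent K (p + 1))) :
    detForm p (exteriorPower.map p (pullCotangentFun (Fin.succAbove 0)) y) =
      ∑ j, detForm (p + 1) (extMul 1 p (p + 1) (by omega) (extOne (Pi.single j (1 : K))) y) := by
  have key : detForm p ∘ₗ exteriorPower.map p (pullCotangentFun (K := K) (Fin.succAbove 0)) =
      detForm (p + 1) ∘ₗ extMul 1 p (p + 1) (by omega) (extOne (∑ j, Pi.single j (1 : K))) := by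
    apply exteriorPower.linearMap_ext
    ext v
    simp only [LinearMap.compAlternatingMap_apply, LinearMap.comp_apply,
      exteriorPower.map_apply_ιMulti, extMul_ιMulti, detForm_ιMulti]
    -- The first row of the original determinant is (1, …, 1). Subtracting the first column from the
    -- others gives `N`, whose first row is (1, 0, …, 0) and whose remaining minor is the
    -- restriction to the face.
    let N : Matrix (Fin (p + 1)) (Fin (p + 1)) K := Matrix.of fun a b =>
      Fin.cases (Pi.single 0 1 : Fin (p + 1) → K) (fun a => Fin.cases (v a 0) fun b => v a b.succ - v a 0) a b
    rw [← Matrix.det_transpose (Matrix.of (Fin.cons (∑ j, Pi.single j (1 : K)) v)),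
      Matrix.det_eq_of_forall_row_eq_smul_add_const (A := (Matrix.of (Fin.cons (∑ j, Pi.single j (1 : K)) v)).transpose)
        (B := N.transpose) (fun i => if i = 0 then 0 else 1) 0 (by simp), Matrix.det_transpose]
    · rw [Matrix.det_succ_row_zero, Finset.sum_eq_single 0]
      · simp only [N, Matrix.of_apply, Fin.cases_zero, Pi.single_eq_same]
        simp only [Fin.val_zero, pow_zero, one_mul]
        congr 1
        ext a b
        exact (pullCotangentFun_succAbove_zero_apply (v a) b).trans (by simp)
      · intro b _ hb
        simp [N, hb]
      · simp
    · intro i j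
      refine Fin.cases ?_ (fun i => ?_) i <;> refine Fin.cases ?_ (fun j => ?_) j <;>
        simp [N, Finset.sum_apply, Pi.single_apply]
  have := LinearMap.congr_fun key y
  simpa only [map_sum, LinearMap.sum_apply, LinearMap.comp_apply] using this

/-- The Stokes formula for the simplex. -/
theorem Form.integral_d [CharZero K] (p : ℕ) (x : Form K (p + 1) p) :
    Form.integral (p + 1) (Form.dS (p + 1) p x) =
      ∑ k : Fin (p + 2), (-1 : K) ^ (k : ℕ) * Form.integral p (Form.pullFun p k.succAbove x) := by
  induction x using TensorProduct.induction_on with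
  | zero => simp
  | add x y hx hy => simp only [map_add, hx, hy, mul_add, Finset.sum_add_distrib]
  | tmul f y =>
    rw [Form.d_tmul, map_sum, Fin.sum_univ_succ fun k : Fin (p + 2) => _]
    -- Every partial derivative contributes two faces. The face opposite to 0 occurs for each j, and
    -- the sum of its determinants is the one of the restriction; the face opposite to j + 1 occurs
    -- once.
    simp only [Form.pullFun_tmul, Form.integral_tmul, integralRing_pderiv, detForm_map_succAbove_zero,
      detForm_map_succAbove_succ]
    simp only [sub_mul, Finset.sum_sub_distrib, Finset.mul_sum]
    rw [sub_eq_add_neg, ← Finset.sum_neg_distrib]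
    congr 1
    · simp
    · refine Finset.sum_congr rfl fun j _ => ?_
      have : (-1 : K) ^ (j : ℕ) * (-1) ^ (j : ℕ) = 1 := by rw [← mul_pow]; simp
      rw [Fin.val_succ, pow_succ]
      linear_combination (integralRing p (pullRingFun (Fin.succAbove j.succ) f) * detForm (p + 1) (extMul 1 p (p + 1) (by omega) (extOne (Pi.single j (1 : K))) y)) * this

/-- A top form is d of its contraction, so Stokes applies. On a face containing the vertex 0 the
contraction commutes with restriction, and a (p+1)-form restricts to zero there; only the face
opposite to 0 remains. -/
theorem Form.integral_coneZero [CharZero K] (p : ℕ) (x : Form K (p + 1) (p + 1)) :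
    Form.integral p (Form.pullFun p (Fin.succAbove 0) (Form.coneZero (p + 1) p x)) =
      Form.integral (p + 1) x := by
  conv_rhs => rw [← Form.d_coneZero (p + 1) p x,
    Form.eq_zero_of_lt (by omega) (Form.dS (p + 1) (p + 1) x), map_zero, add_zero, Form.integral_d,
    Fin.sum_univ_succ]
  rw [Finset.sum_eq_zero]
  · simp
  · intro k _
    rw [Form.pullFun_coneZero p (Fin.succ_succAbove_zero k), Form.eq_zero_of_lt (by omega) (Form.pullFun (p + 1) _ x), map_zero,
      map_zero, mul_zero]

/-- Naturality of the contraction reduces to the standard simplex and its vertex 0. Iterated, this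
identifies vertex values of repeated contractions with integrals over simplices. -/
theorem Form.integral_cone [CharZero K] (l p : ℕ) (α : Fin (p + 2) → Fin (l + 1)) (x : Form K l (p + 1)) :
    Form.integral p (Form.pullFun p (α ∘ Fin.succ) (Form.cone l p (α 0) x)) =
      Form.integral (p + 1) (Form.pullFun (p + 1) α x) := by
  rw [Form.pullFun_comp, Form.pullFun_cone, Form.cone_zero, ← Form.integral_coneZero]
  congr 3

end Stokes

/-! ### The Dupont homotopy -/

section Dupont

variable {K : Type u} [Field K]

/-- The operator `∑_k (-1)^k ∑ dt_{i_1} ∧ ⋯ ∧ dt_{i_k} ∧ h_{i_k} ⋯ h_{i_1}`, where `h_i` is the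
contraction onto the vertex `i`. -/
def Form.resid (l : ℕ) : ∀ p, Form K l p →ₗ[K] Form K l p
  | 0 => LinearMap.id
  | p + 1 => LinearMap.id - ∑ i, Form.wedge l p (dbary K l i) ∘ₗ Form.resid l p ∘ₗ Form.cone l p i

/-- The Dupont homotopy `∑_i t_i R h_i`, where `R` is the operator `Form.resid`. -/
def Form.dupont (l p : ℕ) : Form K l (p + 1) →ₗ[K] Form K l p :=
  ∑ i, Form.fmul l p (bary K l i) ∘ₗ Form.resid l p ∘ₗ Form.cone l p i

/-- The commutator of the exterior derivative and `Form.resid`. -/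
def Form.defect (l p : ℕ) : Form K l p →ₗ[K] Form K l (p + 1) :=
  Form.dS l p ∘ₗ Form.resid l p - Form.resid l (p + 1) ∘ₗ Form.dS l p

theorem Form.resid_succ (l p : ℕ) (x : Form K l (p + 1)) : Form.resid l (p + 1) x =
    x - ∑ i, Form.wedge l p (dbary K l i) (Form.resid l p (Form.cone l p i x)) := by
  simp [Form.resid, LinearMap.sum_apply]

theorem Form.dupont_apply (l p : ℕ) (x : Form K l (p + 1)) : Form.dupont l p x =
    ∑ i, Form.fmul l p (bary K l i) (Form.resid l p (Form.cone l p i x)) := by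
  simp [Form.dupont, LinearMap.sum_apply]

theorem Form.defect_apply (l p : ℕ) (x : Form K l p) : Form.defect l p x =
    Form.dS l p (Form.resid l p x) - Form.resid l (p + 1) (Form.dS l p x) := rfl

theorem Form.sum_wedge_dbary (l p : ℕ) (x : Form K l p) :
    ∑ i, Form.wedge l p (dbary K l i) x = 0 := by
  rw [← LinearMap.sum_apply, ← map_sum, sum_dbary, map_zero, LinearMap.zero_apply]

theorem Form.sum_fmul_bary (l p : ℕ) (x : Form K l p) :
    ∑ i, Form.fmul l p (bary K l i) x = x := by
  rw [← Form.fmul_sum, sum_bary, Form.fmul_one]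

theorem Form.defect_zero [CharZero K] (l : ℕ) (x : Form K l 0) : Form.defect l 0 x =
    -∑ i, Form.eval l i x • Form.wedge l 0 (dbary K l i) (Form.one K l) := by
  rw [Form.defect_apply, Form.resid_succ]
  simp only [Form.resid, LinearMap.id_apply, Form.cone_d, map_sub, map_smul, Finset.sum_sub_distrib]
  rw [Form.sum_wedge_dbary]
  abel

/-- Substitute h_i d = 1 - d h_i in the recursion for `Form.resid`; the contribution of 1 vanishes
because ∑ dt_i = 0. Unfolded down to `Form.defect_zero`, the defect is a combination of constant
forms dt_{i_0} ⋯ dt_{i_p} with vertex values as coefficients. -/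
theorem Form.defect_succ [CharZero K] (l p : ℕ) (x : Form K l (p + 1)) :
    Form.defect l (p + 1) x =
      ∑ i, Form.wedge l (p + 1) (dbary K l i) (Form.defect l p (Form.cone l p i x)) := by
  have h : ∀ i, Form.cone l (p + 1) i (Form.dS l (p + 1) x) = x - Form.dS l p (Form.cone l p i x) :=
    fun i => eq_sub_of_add_eq' (Form.d_cone l p i x)
  rw [Form.defect_apply, Form.resid_succ, Form.resid_succ]
  simp only [h, Form.defect_apply, map_sub, map_sum, Form.d_wedge, Finset.sum_sub_distrib,
    Finset.sum_neg_distrib]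
  rw [Form.sum_wedge_dbary]
  abel

theorem Form.dupont_d_zero [CharZero K] (l : ℕ) (x : Form K l 0) : Form.dupont l 0 (Form.dS l 0 x) =
    x - ∑ i, Form.eval l i x • Form.fmul l 0 (bary K l i) (Form.one K l) := by
  rw [Form.dupont_apply]
  simp only [Form.resid, LinearMap.id_apply, Form.cone_d, map_sub, map_smul, Finset.sum_sub_distrib]
  rw [Form.sum_fmul_bary]

/-- Expanding as in `Form.defect_succ`, with ∑ t_i = 1 in place of ∑ dt_i = 0, leaves R x + ∑ dt_i ∧
R h_i x besides the defect terms, for R = `Form.resid`. The recursion for R is chosen so that this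
equals x. -/
theorem Form.d_dupont [CharZero K] (l p : ℕ) (x : Form K l (p + 1)) :
    Form.dS l p (Form.dupont l p x) + Form.dupont l (p + 1) (Form.dS l (p + 1) x) =
      x + ∑ i, Form.fmul l (p + 1) (bary K l i) (Form.defect l p (Form.cone l p i x)) := by
  have h : ∀ i, Form.cone l (p + 1) i (Form.dS l (p + 1) x) = x - Form.dS l p (Form.cone l p i x) :=
    fun i => eq_sub_of_add_eq' (Form.d_cone l p i x)
  rw [Form.dupont_apply, Form.dupont_apply]
  simp only [h, map_sum, Form.d_fmul_bary, map_sub, Finset.sum_sub_distrib, Finset.sum_add_distrib,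
    Form.defect_apply]
  rw [Form.sum_fmul_bary, Form.resid_succ]
  abel

/-- The pull back of dt_j is the sum of dt_i over the fibre of j, so a sum over the vertices of the
target becomes one over the vertices of the source, grouped by fibres; `Form.pullFun_cone` matches
the terms. -/
theorem Form.pullFun_resid {k l : ℕ} (p : ℕ) (α : Fin (k + 1) → Fin (l + 1)) (x : Form K l p) :
    Form.pullFun p α (Form.resid l p x) = Form.resid k p (Form.pullFun p α x) := by
  induction p with
  | zero => rfl
  | succ p ih =>
    rw [Form.resid_succ, Form.resid_succ, map_sub, map_sum]
    congr 1
    simp only [Form.pullFun_wedge, pullCotangentFun_dbary, ih, map_sum, LinearMap.sum_apply]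
    rw [← Finset.sum_fiberwise (s := Finset.univ) (g := α)]
    refine Finset.sum_congr rfl fun j _ => Finset.sum_congr rfl fun i hi => ?_
    rw [← Form.pullFun_cone, (Finset.mem_filter.mp hi).2]

theorem Form.pullFun_dupont {k l : ℕ} (p : ℕ) (α : Fin (k + 1) → Fin (l + 1)) (x : Form K l (p + 1)) :
    Form.pullFun p α (Form.dupont l p x) = Form.dupont k p (Form.pullFun (p + 1) α x) := by
  rw [Form.dupont_apply, Form.dupont_apply, map_sum]
  simp only [Form.pullFun_fmul, pullRingFun_bary, Form.fmul_sum, Form.pullFun_resid]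
  rw [← Finset.sum_fiberwise (s := Finset.univ) (g := α)]
  refine Finset.sum_congr rfl fun j _ => Finset.sum_congr rfl fun i hi => ?_
  rw [← Form.pullFun_cone, (Finset.mem_filter.mp hi).2]

end Dupont

/-! ### Completed tensor products as functors of the discrete factor -/

section CompletedLift

variable {K : Type u} [Field K]
  {V W U : Type u} [AddCommGroup V] [Module K V] [AddCommGroup W] [Module K W]
  [AddCommGroup U] [Module K U]
  {M : Type v} [AddCommGroup M] [Module K M] {N : Type v'} [AddCommGroup N] [Module K N]
  {D : DirInv.{u, v, w} K M} {E : DirInv.{u, v', w} K N}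

/-- The map `g ⊗ 1` of completed tensor products. -/
abbrev ctLeft (D : DirInv.{u, v, w} K M) (g : V →ₗ[K] W) : CTensor V D →ₗ[K] CTensor W D :=
  ctMap g LinearMap.id (DirInv.Cont.id D)

theorem ctLeft_add (g g' : V →ₗ[K] W) (x : CTensor V D) :
    ctLeft D (g + g') x = ctLeft D g x + ctLeft D g' x := by
  obtain ⟨x, rfl⟩ := DirInv.cls_surjective _ x
  simp only [ctLeft, ctMap, DirInv.complMap_cls]
  rw [← map_add]
  congr 1
  refine Subtype.ext (funext fun n => ?_)
  simp [DirInv.cauchyMap, TensorProduct.map_add_left]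

theorem ctLeft_smul (c : K) (g : V →ₗ[K] W) (x : CTensor V D) :
    ctLeft D (c • g) x = c • ctLeft D g x := by
  obtain ⟨x, rfl⟩ := DirInv.cls_surjective _ x
  simp only [ctLeft, ctMap, DirInv.complMap_cls]
  rw [← map_smul]
  congr 1
  refine Subtype.ext (funext fun n => ?_)
  simp [DirInv.cauchyMap, TensorProduct.map_smul_left]

theorem ctLeft_zero (x : CTensor V D) : ctLeft D (0 : V →ₗ[K] W) x = 0 :=
  ctMap_zero (fun _ => rfl) x

theorem ctLeft_sum {ι : Type*} (s : Finset ι) (g : ι → V →ₗ[K] W) (x : CTensor V D) :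
    ctLeft D (∑ i ∈ s, g i) x = ∑ i ∈ s, ctLeft D (g i) x := by
  classical
  induction s using Finset.induction_on with
  | empty => simpa using ctLeft_zero x
  | insert a s ha ih => rw [Finset.sum_insert ha, Finset.sum_insert ha, ctLeft_add, ih]

theorem ctLeft_id (x : CTensor V D) : ctLeft D LinearMap.id x = x := by
  obtain ⟨x, rfl⟩ := DirInv.cls_surjective _ x
  simp only [ctLeft, ctMap, DirInv.complMap_cls]
  congr 1
  refine Subtype.ext (funext fun n => ?_)
  simp [DirInv.cauchyMap]

theorem ctLeft_comp (g : V →ₗ[K] W) (g' : W →ₗ[K] U) (x : CTensor V D) :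
    ctLeft D (g' ∘ₗ g) x = ctLeft D g' (ctLeft D g x) := by
  have := ctMap_comm (D₁ := D) (D₂ := D) (D₃ := D) (D₄ := D) (g := g) (g' := g') (k := g' ∘ₗ g)
    (k' := LinearMap.id) (f := LinearMap.id) (f' := LinearMap.id) (l := LinearMap.id)
    (l' := LinearMap.id) (hf := DirInv.Cont.id _) (hf' := DirInv.Cont.id _) (hl := DirInv.Cont.id _)
    (hl' := DirInv.Cont.id _) (fun _ => rfl) (fun _ => rfl) x
  rw [ctLeft, ctLeft, this]
  exact (ctLeft_id _).symm

theorem ctContract_ctLeft (g : V →ₗ[K] W) (c : W →ₗ[K] K) (hD : D.IsComplete) (x : CTensor V D) :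
    ctContract c hD (ctLeft D g x) = ctContract (c ∘ₗ g) hD x := by
  obtain ⟨x, rfl⟩ := DirInv.cls_surjective _ x
  simp only [ctContract, LinearMap.comp_apply, ctLeft, ctMap, DirInv.complMap_cls]
  congr 2
  refine Subtype.ext (funext fun n => ?_)
  simp only [DirInv.cauchyMap, LinearMap.coe_mk, AddHom.coe_mk]
  induction (x : ℕ → V ⊗[K] M) n using TensorProduct.induction_on with
  | zero => simp
  | add x y hx hy => simp only [map_add, hx, hy]
  | tmul v m => simp

theorem ctContract_add (c c' : V →ₗ[K] K) (hD : D.IsComplete) (x : CTensor V D) :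
    ctContract (c + c') hD x = ctContract c hD x + ctContract c' hD x := by
  obtain ⟨x, rfl⟩ := DirInv.cls_surjective _ x
  simp only [ctContract, LinearMap.comp_apply, DirInv.complMap_cls]
  rw [← map_add, ← map_add]
  congr 2
  refine Subtype.ext (funext fun n => ?_)
  simp only [DirInv.cauchyMap, LinearMap.coe_mk, AddHom.coe_mk, Submodule.coe_add, Pi.add_apply]
  induction (x : ℕ → V ⊗[K] M) n using TensorProduct.induction_on with
  | zero => simp
  | add x y hx hy => simp only [map_add, hx, hy]; abel
  | tmul v m => simp

theorem ctContract_smul (a : K) (c : V →ₗ[K] K) (hD : D.IsComplete) (x : CTensor V D) :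
    ctContract (a • c) hD x = a • ctContract c hD x := by
  obtain ⟨x, rfl⟩ := DirInv.cls_surjective _ x
  simp only [ctContract, LinearMap.comp_apply, DirInv.complMap_cls]
  rw [← map_smul, ← map_smul]
  congr 2
  refine Subtype.ext (funext fun n => ?_)
  simp only [DirInv.cauchyMap, LinearMap.coe_mk, AddHom.coe_mk, Submodule.coe_smul, Pi.smul_apply]
  induction (x : ℕ → V ⊗[K] M) n using TensorProduct.induction_on with
  | zero => simp
  | add x y hx hy => simp only [map_add, smul_add, hx, hy]
  | tmul v m => simp [smul_smul]

theorem ctContract_zero (hD : D.IsComplete) (x : CTensor V D) :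
    ctContract (0 : V →ₗ[K] K) hD x = 0 := by
  simpa using ctContract_smul (0 : K) (0 : V →ₗ[K] K) hD x

theorem ctContract_sum {ι : Type*} (s : Finset ι) (c : ι → V →ₗ[K] K) (hD : D.IsComplete)
    (x : CTensor V D) : ctContract (∑ i ∈ s, c i) hD x = ∑ i ∈ s, ctContract (c i) hD x := by
  classical
  induction s using Finset.induction_on with
  | empty => simpa using ctContract_zero hD x
  | insert a s ha ih => rw [Finset.sum_insert ha, Finset.sum_insert ha, ctContract_add, ih]

theorem cont_tmul (D : DirInv.{u, v, w} K M) (x : V) :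
    DirInv.Cont D (D.tensor V) (TensorProduct.mk K V M x) :=
  fun j => ⟨j, fun _ hm => tmul_mem_tensorSub x hm, fun i => ⟨i, fun _ hm => tmul_mem_tensorSub x hm⟩⟩

/-- The map `m ↦ x ⊗ m`, from a complete dir-inv module to the completed tensor product. -/
def ctTmul (x : V) (hD : D.IsComplete) : M →ₗ[K] CTensor V D :=
  DirInv.complMap _ (cont_tmul D x) ∘ₗ hD.equiv.toLinearMap

/-- A rank one operator on the discrete factor acts through the contraction with its linear form.
Hence a sum of such operators kills every element whose contractions with these forms vanish. -/
theorem ctTmul_ctContract (c : V →ₗ[K] K) (x : W) (hD : D.IsComplete) (y : CTensor V D) :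
    ctTmul x hD (ctContract c hD y) = ctLeft D (c.smulRight x) y := by
  obtain ⟨y, rfl⟩ := DirInv.cls_surjective _ y
  simp only [ctTmul, ctContract, LinearMap.comp_apply, LinearEquiv.coe_coe,
    LinearEquiv.apply_symm_apply, ctLeft, ctMap, DirInv.complMap_cls]
  congr 1
  refine Subtype.ext (funext fun n => ?_)
  simp only [DirInv.cauchyMap, LinearMap.coe_mk, AddHom.coe_mk]
  induction (y : ℕ → V ⊗[K] M) n using TensorProduct.induction_on with
  | zero => simp
  | add x y hx hy => simp only [map_add, hx, hy]
  | tmul v m => simp [TensorProduct.smul_tmul]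

theorem ctContract_ctTmul (c : V →ₗ[K] K) (x : V) (hD : D.IsComplete) (m : M) :
    ctContract c hD (ctTmul x hD m) = c x • m := by
  simp only [ctTmul, ctContract, LinearMap.comp_apply, LinearEquiv.coe_coe]
  rw [LinearEquiv.symm_apply_eq, map_smul]
  obtain ⟨y, hy⟩ := DirInv.cls_surjective _ (hD.equiv m)
  rw [← hy]
  simp only [DirInv.complMap_cls]
  rw [← map_smul]
  congr 1

theorem ctMap_ctTmul (g : V →ₗ[K] W) (f : M →ₗ[K] N) (hf : DirInv.Cont D E f) (x : V)
    (hD : D.IsComplete) (hE : E.IsComplete) (m : M) :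
    ctMap g f hf (ctTmul x hD m) = ctTmul (g x) hE (f m) := by
  have key : hE.equiv (f m) = DirInv.complMap f hf (hD.equiv m) := rfl
  simp only [ctTmul, LinearMap.comp_apply, LinearEquiv.coe_coe, key]
  obtain ⟨y, hy⟩ := DirInv.cls_surjective _ (hD.equiv m)
  rw [← hy]
  simp only [DirInv.complMap_cls, ctMap]
  congr 1

theorem ctTmul_add (x y : V) (hD : D.IsComplete) (m : M) :
    ctTmul (x + y) hD m = ctTmul x hD m + ctTmul y hD m := by
  simp only [ctTmul, LinearMap.comp_apply, LinearEquiv.coe_coe]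
  obtain ⟨z, hz⟩ := DirInv.cls_surjective _ (hD.equiv m)
  rw [← hz]
  simp only [DirInv.complMap_cls]
  rw [← map_add]
  congr 1
  refine Subtype.ext (funext fun n => ?_)
  simp [DirInv.cauchyMap]

theorem ctTmul_zero (hD : D.IsComplete) (m : M) : ctTmul (0 : V) hD m = 0 := by
  simpa using ctTmul_add (0 : V) 0 hD m

theorem ctTmul_sum {ι : Type*} (s : Finset ι) (x : ι → V) (hD : D.IsComplete) (m : M) :
    ctTmul (∑ i ∈ s, x i) hD m = ∑ i ∈ s, ctTmul (x i) hD m := by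
  classical
  induction s using Finset.induction_on with
  | empty => simpa using ctTmul_zero hD m
  | insert a s ha ih => rw [Finset.sum_insert ha, Finset.sum_insert ha, ctTmul_add, ih]

/-- The defect has finite rank, with coefficients the integrals over the simplices spanned by p + 1
vertices. The induction follows `Form.defect_succ`, down to vertex values, which are integrals over
points. -/
theorem ctLeft_defect_eq_zero [CharZero K] (hD : D.IsComplete) (l p : ℕ) (x : CTensor (Form K l p) D)
    (hx : ∀ α : Fin (p + 1) → Fin (l + 1),
      ctContract (Form.integral p ∘ₗ Form.pullFun p α) hD x = 0) :
    ctLeft D (Form.defect l p) x = 0 := by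
  induction p with
  | zero =>
    have e : Form.defect (K := K) l 0 = (-1 : K) •
        ∑ i, (Form.eval l i).smulRight (Form.wedge l 0 (dbary K l i) (Form.one K l)) := by
      refine LinearMap.ext fun x => ?_
      rw [Form.defect_zero]
      simp [LinearMap.sum_apply]
    rw [e, ctLeft_smul, ctLeft_sum, Finset.sum_eq_zero, smul_zero]
    intro i _
    rw [← ctTmul_ctContract _ _ hD]
    exact (congrArg _ (hx fun _ => i)).trans (map_zero _)
  | succ p ih =>
    have e : Form.defect (K := K) l (p + 1) =
        ∑ i, Form.wedge l (p + 1) (dbary K l i) ∘ₗ Form.defect l p ∘ₗ Form.cone l p i := by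
      refine LinearMap.ext fun x => ?_
      rw [Form.defect_succ]
      simp [LinearMap.sum_apply]
    rw [e, ctLeft_sum, Finset.sum_eq_zero]
    intro i _
    rw [ctLeft_comp, ctLeft_comp, ih, map_zero]
    intro α
    rw [ctContract_ctLeft]
    -- Contracting onto i before integrating over α amounts to integrating over the simplex with i
    -- prepended to the vertices of α.
    have e2 : (Form.integral p ∘ₗ Form.pullFun p α) ∘ₗ Form.cone l p i =
        Form.integral (p + 1) ∘ₗ Form.pullFun (K := K) (p + 1) (Fin.cons i α : Fin (p + 2) → Fin (l + 1)) := by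
      refine LinearMap.ext fun x => ?_
      have := Form.integral_cone l p (Fin.cons i α : Fin (p + 2) → Fin (l + 1)) x
      rw [Fin.cons_zero] at this
      exact this
    rw [e2]
    exact hx _

theorem ctLeft_dupont_d_zero [CharZero K] (hD : D.IsComplete) (l : ℕ) (x : CTensor (Form K l 0) D)
    (hx : ∀ α : Fin (0 + 1) → Fin (l + 1),
      ctContract (Form.integral 0 ∘ₗ Form.pullFun 0 α) hD x = 0) :
    ctLeft D (Form.dupont l 0) (ctLeft D (Form.dS l 0) x) = x := by
  have e : Form.dupont (K := K) l 0 ∘ₗ Form.dS l 0 = LinearMap.id + (-1 : K) •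
      ∑ i, (Form.eval l i).smulRight (Form.fmul l 0 (bary K l i) (Form.one K l)) := by
    refine LinearMap.ext fun x => ?_
    rw [LinearMap.comp_apply, Form.dupont_d_zero]
    simp [LinearMap.sum_apply, sub_eq_add_neg]
  rw [← ctLeft_comp, e, ctLeft_add, ctLeft_smul, ctLeft_sum, Finset.sum_eq_zero, smul_zero, add_zero,
    ctLeft_id]
  intro i _
  rw [← ctTmul_ctContract _ _ hD]
  exact (congrArg _ (hx fun _ => i)).trans (map_zero _)

theorem ctLeft_d_dupont [CharZero K] (hD : D.IsComplete) (l p : ℕ) (x : CTensor (Form K l (p + 1)) D)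
    (hx : ∀ α : Fin (p + 1 + 1) → Fin (l + 1),
      ctContract (Form.integral (p + 1) ∘ₗ Form.pullFun (p + 1) α) hD x = 0) :
    ctLeft D (Form.dS l p) (ctLeft D (Form.dupont l p) x) +
      ctLeft D (Form.dupont l (p + 1)) (ctLeft D (Form.dS l (p + 1)) x) = x := by
  have e : Form.dS (K := K) l p ∘ₗ Form.dupont l p + Form.dupont l (p + 1) ∘ₗ Form.dS l (p + 1) =
      LinearMap.id + ∑ i, Form.fmul l (p + 1) (bary K l i) ∘ₗ Form.defect l p ∘ₗ Form.cone l p i := by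
    refine LinearMap.ext fun x => ?_
    rw [LinearMap.add_apply, LinearMap.comp_apply, LinearMap.comp_apply, Form.d_dupont]
    simp [LinearMap.sum_apply]
  rw [← ctLeft_comp, ← ctLeft_comp, ← ctLeft_add, e, ctLeft_add, ctLeft_sum, Finset.sum_eq_zero,
    add_zero, ctLeft_id]
  intro i _
  rw [ctLeft_comp, ctLeft_comp, ctLeft_defect_eq_zero hD, map_zero]
  intro α
  rw [ctContract_ctLeft]
  have e2 : (Form.integral p ∘ₗ Form.pullFun p α) ∘ₗ Form.cone l p i =
      Form.integral (p + 1) ∘ₗ Form.pullFun (K := K) (p + 1) (Fin.cons i α : Fin (p + 2) → Fin (l + 1)) := by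
    refine LinearMap.ext fun x => ?_
    have := Form.integral_cone l p (Fin.cons i α : Fin (p + 2) → Fin (l + 1)) x
    rw [Fin.cons_zero] at this
    exact this
  rw [e2]
  exact hx _

end CompletedLift

namespace CosimplicialDGAlg

variable {K : Type u} [Field K] (A : CosimplicialDGAlg.{u, v, w} K)

/-! ### The Thom-Sullivan normalization of a complete cosimplicial algebra -/

section Thom

variable {A}

/-- Compatibility of the sequence moves α from the forms to the coefficients. -/
theorem ctContract_pull_thom (hA : ∀ q i, ((A.obj q).D i).IsComplete) {p : ℕ} {i : ℤ} {x : ∀ l, A.FormTensor l p i}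
    (hx : x ∈ A.thomSub p i) {k l : ℕ} (α : Fin (k + 1) →o Fin (l + 1)) (c : Form K k p →ₗ[K] K) :
    ctContract (c ∘ₗ Form.pull p α) (hA l i) (x l) = A.map α i (ctContract c (hA k i) (x k)) := by
  rw [map_ctContract c (hA k i) (hA l i) _ (A.map_cont α i)]
  have := A.mem_thomSub.mp hx k l α
  unfold coeffMap formMap at this
  rw [this, ctContract_ctLeft]

/-- Compatibility is only available for monotone maps. Sorting writes α as a monotone map after a
permutation of the vertices, and the permutation changes the integral by a scalar. So the single
condition ∫ x_p = 0 controls the integrals of all components over all simplices. -/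
theorem ctContract_pullFun_thom [CharZero K] (hA : ∀ q i, ((A.obj q).D i).IsComplete) {p : ℕ} {i : ℤ}
    {x : ∀ l, A.FormTensor l p i} (hx : x ∈ A.thomSub p i)
    (h0 : ctContract (Form.integral p) (hA p i) (x p) = 0) {l : ℕ} (α : Fin (p + 1) → Fin (l + 1)) :
    ctContract (Form.integral p ∘ₗ Form.pullFun p α) (hA l i) (x l) = 0 := by
  let σ : Fin (p + 1) →o Fin (l + 1) := ⟨α ∘ Tuple.sort α, Tuple.monotone_sort α⟩
  have hσ : α = σ ∘ (Tuple.sort α).symm := by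
    ext a
    simp [σ]
  have e : Form.integral p ∘ₗ Form.pullFun (K := K) p α =
      LinearMap.det (pullCotangentFun (K := K) (Tuple.sort α).symm) •
        (Form.integral p ∘ₗ Form.pull p σ) := by
    refine LinearMap.ext fun y => ?_
    conv_lhs => rw [hσ]
    rw [LinearMap.comp_apply, Form.pullFun_comp, Form.integral_pullFun_perm]
    rfl
  rw [e, ctContract_smul, ctContract_pull_thom hA hx, h0, map_zero, smul_zero]

variable (A)

/-- The Dupont homotopy on the Thom-Sullivan normalization. -/
def thomDupont (p : ℕ) (i : ℤ) : A.thomSub (p + 1) i →ₗ[K] A.thomSub p i :=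
  (LinearMap.pi fun l => ctLeft ((A.obj l).D i) (Form.dupont l p) ∘ₗ LinearMap.proj l).restrict
    fun x hx => by
      rw [mem_thomSub] at hx ⊢
      intro k l α
      let δ : CTensor (Form K k (p + 1)) ((A.obj l).D i) →ₗ[K] CTensor (Form K k p) ((A.obj l).D i) :=
        ctMap (Form.dupont k p) LinearMap.id (DirInv.Cont.id _)
      have e1 : A.coeffMap p i α (ctLeft _ (Form.dupont k p) (x k)) = δ (A.coeffMap (p + 1) i α (x k)) :=
        ctMap_comm (by intro _; rfl) (by intro _; rfl) (x k)
      have e2 : A.formMap p i α (ctLeft _ (Form.dupont l p) (x l)) = δ (A.formMap (p + 1) i α (x l)) :=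
        ctMap_comm (Form.pullFun_dupont p α) (by intro _; rfl) (x l)
      simp only [LinearMap.pi_apply, LinearMap.comp_apply, LinearMap.proj_apply]
      rw [e1, e2, hx]

theorem coe_thomDupont (p : ℕ) (i : ℤ) (x : A.thomSub (p + 1) i) (l : ℕ) :
    (A.thomDupont p i x).1 l = ctLeft ((A.obj l).D i) (Form.dupont l p) (x.1 l) := rfl

/-- The exterior derivative of the Thom-Sullivan normalization. -/
def thomDh (p p' : ℕ) (i : ℤ) (h : p + 1 = p') : A.thomSub p i →ₗ[K] A.thomSub p' i :=
  (LinearMap.pi fun l => A.formD l p p' i h ∘ₗ LinearMap.proj l).restrict (A.formD_mem p p' i h)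

/-- The differential of the Thom-Sullivan normalization that comes from the coefficients. -/
def thomDv (p : ℕ) (i i' : ℤ) (h : i + 1 = i') : A.thomSub p i →ₗ[K] A.thomSub p i' :=
  (LinearMap.pi fun l => A.coeffD l p i i' h ∘ₗ LinearMap.proj l).restrict (A.coeffD_mem p i i' h)

/-- The cosimplicial differential of the standard normalization. -/
def normDh (p p' : ℕ) (i : ℤ) (h : p + 1 = p') : A.normSub p i →ₗ[K] A.normSub p' i :=
  (A.delta p p' i h).restrict (A.delta_mem p p' i h)

theorem coe_thomDh (p p' : ℕ) (i : ℤ) (h : p + 1 = p') (x : A.thomSub p i) (l : ℕ) :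
    (A.thomDh p p' i h x).1 l = ctLeft ((A.obj l).D i) (Form.d l p p' h) (x.1 l) := rfl

theorem coe_thomDv (p : ℕ) (i i' : ℤ) (h : i + 1 = i') (x : A.thomSub p i) (l : ℕ) :
    (A.thomDv p i i' h x).1 l = A.coeffD l p i i' h (x.1 l) := rfl

theorem coe_normDh (p p' : ℕ) (i : ℤ) (h : p + 1 = p') (x : A.normSub p i) :
    (A.normDh p p' i h x).1 = A.delta p p' i h x.1 := rfl

variable {A} (hA : ∀ q i, ((A.obj q).D i).IsComplete)

theorem coe_integralBi (p : ℕ) (i : ℤ) (x : A.thomSub p i) :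
    (A.integralBi hA p i x : (A.obj p).X i) = ctContract (Form.integral p) (hA p i) (x.1 p) := rfl

/-- The component that is integrated comes from a (p+1)-form on Δ^p, and there are none. -/
theorem integralBi_thomDupont [CharZero K] (p : ℕ) (i : ℤ) (x : A.thomSub (p + 1) i) :
    A.integralBi hA p i (A.thomDupont p i x) = 0 := by
  refine Subtype.ext ?_
  rw [coe_integralBi, coe_thomDupont, ctContract_ctLeft]
  have : Form.integral p ∘ₗ Form.dupont (K := K) p p = 0 := by
    refine LinearMap.ext fun y => ?_
    rw [Form.eq_zero_of_lt (Nat.lt_succ_self p) y, map_zero, map_zero]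
  rw [this, ctContract_zero]
  rfl

theorem thomDupont_dv [CharZero K] (p : ℕ) (i : ℤ) (x : A.thomSub (p + 1) i) :
    A.thomDv p i (i + 1) rfl (A.thomDupont p i x) =
      A.thomDupont p (i + 1) (A.thomDv (p + 1) i (i + 1) rfl x) :=
  Subtype.ext (funext fun l => ctMap_comm (hf := DirInv.Cont.id _) (hl' := DirInv.Cont.id _)
    (hf' := (A.obj l).d_cont i (i + 1) rfl) (hl := (A.obj l).d_cont i (i + 1) rfl)
    (by intro _; rfl) (by intro _; rfl) (x.1 l))

theorem thomDupont_dh_zero [CharZero K] (i : ℤ) (x : A.thomSub 0 i) (hx : A.integralBi hA 0 i x = 0) :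
    A.thomDupont 0 i (A.thomDh 0 (0 + 1) i rfl x) = x := by
  have h0 : ctContract (Form.integral 0) (hA 0 i) (x.1 0) = 0 := congrArg Subtype.val hx
  refine Subtype.ext (funext fun l => ?_)
  rw [coe_thomDupont, coe_thomDh]
  exact ctLeft_dupont_d_zero (hA l i) l (x.1 l) fun α => ctContract_pullFun_thom hA x.2 h0 α

theorem thomDupont_dh [CharZero K] (p : ℕ) (i : ℤ) (x : A.thomSub (p + 1) i)
    (hx : A.integralBi hA (p + 1) i x = 0) :
    A.thomDh p (p + 1) i rfl (A.thomDupont p i x) +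
      A.thomDupont (p + 1) i (A.thomDh (p + 1) (p + 1 + 1) i rfl x) = x := by
  have h0 : ctContract (Form.integral (p + 1)) (hA (p + 1) i) (x.1 (p + 1)) = 0 :=
    congrArg Subtype.val hx
  refine Subtype.ext (funext fun l => ?_)
  rw [Submodule.coe_add, Pi.add_apply, coe_thomDupont, coe_thomDh, coe_thomDh, coe_thomDupont]
  exact ctLeft_d_dupont (hA l i) l p (x.1 l) fun α => ctContract_pullFun_thom hA x.2 h0 α

theorem coe_integralBi_thomDv [CharZero K] (p : ℕ) (i i' : ℤ) (h : i + 1 = i') (x : A.thomSub p i) :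
    (A.integralBi hA p i' (A.thomDv p i i' h x)).1 =
      (A.obj p).d i i' h (A.integralBi hA p i x).1 := by
  rw [coe_integralBi, coe_integralBi, coe_thomDv]
  exact (map_ctContract (Form.integral p) (hA p i) (hA p i') _ ((A.obj p).d_cont i i' h) (x.1 p)).symm

/-! ### Stokes' formula and the cosimplicial differential -/

theorem coe_coface_eq_succAbove {p : ℕ} (k : Fin (p + 2)) :
    ⇑(coface (p := p) rfl k) = k.succAbove := by
  ext x
  rw [coe_coface]
  simp only [Fin.succAbove, Fin.lt_def, Fin.val_castSucc]
  split_ifs <;> simp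

theorem _root_.ThomSullivan.Form.integral_d_range [CharZero K] (p : ℕ) (x : Form K (p + 1) p) :
    Form.integral (p + 1) (Form.dS (p + 1) p x) =
      ∑ k ∈ Finset.range (p + 2), (-1 : K) ^ k • Form.integral p (Form.pull p (coface rfl k) x) := by
  rw [Form.integral_d, Finset.sum_range fun k => (-1 : K) ^ k • Form.integral p (Form.pull p (coface rfl k) x)]
  refine Finset.sum_congr rfl fun k _ => ?_
  rw [Form.pull_eq_pullFun, coe_coface_eq_succAbove, smul_eq_mul]

theorem integralBi_dh [CharZero K] (p : ℕ) (i : ℤ) (x : A.thomSub p i) :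
    A.integralBi hA (p + 1) i (A.thomDh p (p + 1) i rfl x) =
      A.normDh p (p + 1) i rfl (A.integralBi hA p i x) := by
  refine Subtype.ext ?_
  rw [coe_integralBi, coe_normDh, coe_integralBi, coe_thomDh]
  have e : Form.integral (p + 1) ∘ₗ Form.dS (K := K) (p + 1) p =
      ∑ k ∈ Finset.range (p + 2), (-1 : K) ^ k • (Form.integral p ∘ₗ Form.pull p (coface rfl k)) := by
    refine LinearMap.ext fun y => ?_
    rw [LinearMap.comp_apply, Form.integral_d_range]
    simp [LinearMap.sum_apply]
  rw [ctContract_ctLeft, e, ctContract_sum, delta_apply]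
  refine Finset.sum_congr rfl fun k _ => ?_
  rw [ctContract_smul, ctContract_pull_thom hA x.2]

end Thom

end CosimplicialDGAlg

/-! ### Surjectivity of the integration -/

section Whitney

variable {K : Type u} [Field K]

/-- The product of the differentials `dt_{σ_1}, …, dt_{σ_p}`. -/
def Form.dprod (l : ℕ) : ∀ p, (Fin p → Fin (l + 1)) → Form K l p
  | 0, _ => Form.one K l
  | p + 1, σ => Form.wedge l p (dbary K l (σ 0)) (Form.dprod l p (Fin.tail σ))

/-- The form `t_{σ_0} dt_{σ_1} ⋯ dt_{σ_p}`. -/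
def Form.elem (l p : ℕ) (σ : Fin (p + 1) → Fin (l + 1)) : Form K l p :=
  Form.fmul l p (bary K l (σ 0)) (Form.dprod l p (Fin.tail σ))

theorem sum_fin_cons {p : ℕ} {X V : Type*} [Fintype X] [AddCommMonoid V] (F : (Fin (p + 1) → X) → V) :
    ∑ τ, F τ = ∑ x, ∑ τ : Fin p → X, F (Fin.cons x τ : Fin (p + 1) → X) := by
  rw [← (Fin.consEquiv fun _ : Fin (p + 1) => X).sum_comp, Fintype.sum_prod_type]
  rfl

theorem comp_cons_eq_iff {p : ℕ} {X Y : Type*} (α : X → Y) (x : X) (τ : Fin p → X)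
    (σ : Fin (p + 1) → Y) :
    α ∘ (Fin.cons x τ : Fin (p + 1) → X) = σ ↔ α x = σ 0 ∧ α ∘ τ = Fin.tail σ := by
  constructor
  · rintro rfl
    exact ⟨rfl, rfl⟩
  · rintro ⟨h1, h2⟩
    ext i
    refine Fin.cases h1 (fun i => congrFun h2 i) i

/-- Each dt_{σ_a} pulls back to a sum over a fibre, and expanding the product gives one term for
each lift of σ. -/
theorem Form.pullFun_dprod {k l : ℕ} (p : ℕ) (α : Fin (k + 1) → Fin (l + 1)) (σ : Fin p → Fin (l + 1)) :
    Form.pullFun p α (Form.dprod l p σ) =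
      ∑ τ : Fin p → Fin (k + 1), if α ∘ τ = σ then Form.dprod (K := K) k p τ else 0 := by
  induction p with
  | zero =>
    rw [Fintype.sum_unique, if_pos (Subsingleton.elim _ _)]
    exact Form.pullFun_one α
  | succ p ih =>
    rw [Form.dprod, Form.pullFun_wedge, pullCotangentFun_dbary, ih, sum_fin_cons,
      map_sum (Form.wedge k p), LinearMap.sum_apply, Finset.sum_filter]
    refine Finset.sum_congr rfl fun i _ => ?_
    simp only [comp_cons_eq_iff]
    split_ifs with h
    · rw [map_sum]
      refine Finset.sum_congr rfl fun τ _ => ?_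
      simp only [h, true_and]
      split_ifs
      · rfl
      · exact map_zero _
    · simp [h]

theorem Form.pullFun_elem {k l : ℕ} (p : ℕ) (α : Fin (k + 1) → Fin (l + 1)) (σ : Fin (p + 1) → Fin (l + 1)) :
    Form.pullFun p α (Form.elem l p σ) =
      ∑ τ : Fin (p + 1) → Fin (k + 1), if α ∘ τ = σ then Form.elem (K := K) k p τ else 0 := by
  rw [Form.elem, Form.pullFun_fmul, pullRingFun_bary, Form.pullFun_dprod, sum_fin_cons, Form.fmul_sum,
    Finset.sum_filter]
  refine Finset.sum_congr rfl fun i _ => ?_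
  simp only [comp_cons_eq_iff]
  split_ifs with h
  · rw [map_sum]
    refine Finset.sum_congr rfl fun τ _ => ?_
    simp only [h, true_and]
    split_ifs
    · rfl
    · exact map_zero _
  · simp [h]

theorem Form.dprod_eq (l p : ℕ) (σ : Fin p → Fin (l + 1)) :
    Form.dprod (K := K) l p σ = 1 ⊗ₜ exteriorPower.ιMulti K p fun a => dbary K l (σ a) := by
  induction p with
  | zero =>
    rw [Form.dprod, Form.one]
    congr 1
  | succ p ih =>
    rw [Form.dprod, ih, Form.wedge_tmul, extMul_ιMulti]
    congr 2
    refine funext fun a => ?_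
    exact Fin.cases rfl (fun _ => rfl) a

theorem Form.integral_elem_id [CharZero K] (p : ℕ) :
    Form.integral p (Form.elem (K := K) p p id) = ((p + 1).factorial : K)⁻¹ := by
  have h1 : (Matrix.of fun a : Fin p => dbary K p (Fin.tail id a)) = 1 := by
    ext a b
    simp [Fin.tail, Matrix.one_apply, Pi.single_apply, eq_comm]
  have h2 : bary K p 0 = ∏ i, bary K p i ^ (Pi.single 0 1 : Fin (p + 1) → ℕ) i := by
    rw [Finset.prod_eq_single 0 (fun j _ hj => by simp [hj]) (by simp)]
    simp
  rw [Form.elem, Form.dprod_eq, Form.fmul_tmul, Form.integral_tmul, detForm_ιMulti, h1, Matrix.det_one,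
    mul_one, mul_one, id, h2, integralRing_prod_bary, Finset.sum_pi_single', Finset.prod_eq_one]
  · simp
  · intro i _
    by_cases h : i = 0
    · subst h; simp
    · simp [h]

end Whitney

namespace CosimplicialDGAlg

variable {K : Type u} [Field K] (A : CosimplicialDGAlg.{u, v, w} K)

open Classical in
/-- The map that is induced by a map of vertices if it is monotone, and zero otherwise. -/
def mapOrZero {p l : ℕ} (σ : Fin (p + 1) → Fin (l + 1)) (i : ℤ) : (A.obj p).X i →ₗ[K] (A.obj l).X i :=
  if h : Monotone σ then A.map ⟨σ, h⟩ i else 0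

/-- Such a σ identifies two consecutive vertices, so it factors through a codegeneracy, which kills
normalized elements. -/
theorem map_eq_zero_of_not_strictMono {p l : ℕ} {i : ℤ} (σ : Fin (p + 1) →o Fin (l + 1)) (hσ : ¬StrictMono σ)
    {x : (A.obj p).X i} (hx : x ∈ A.normSub p i) : A.map σ i x = 0 := by
  rw [Fin.strictMono_iff_lt_succ] at hσ
  push Not at hσ
  obtain ⟨k, hk⟩ := hσ
  obtain ⟨p, rfl⟩ : ∃ m, p = m + 1 := ⟨p - 1, by have := k.2; omega⟩
  have hk' : σ k.castSucc = σ k.succ := le_antisymm (σ.monotone (Fin.castSucc_lt_succ).le) hk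
  -- Collapsing k and k + 1 and reinserting past the gap at k moves only k, to k + 1, where σ has
  -- the same value.
  have e : σ = (σ.comp (coface rfl k)).comp (codegen rfl k) := by
    ext a
    simp only [OrderHom.comp_coe, Function.comp_apply]
    by_cases h : a = k.castSucc
    · have : coface rfl (k : ℕ) (codegen rfl k a) = k.succ := by
        ext
        rw [coe_coface, coe_codegen, h]
        simp
      rw [this, h, hk']
    · congr 2
      have h' : (a : ℕ) ≠ k := fun h0 => h (Fin.ext h0)
      ext
      rw [coe_coface, coe_codegen]
      split_ifs <;> omega
  rw [e, A.map_comp, A.mem_normSub.mp hx p rfl k, map_zero]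

/-- The critical case is a τ that is not monotone while α ∘ τ is. Then α ∘ τ cannot be strictly
monotone, as a monotone α cannot undo an inversion of τ; so both sides vanish on the normalization.
-/
theorem map_mapOrZero {p k l : ℕ} {i : ℤ} (α : Fin (k + 1) →o Fin (l + 1)) (τ : Fin (p + 1) → Fin (k + 1))
    {x : (A.obj p).X i} (hx : x ∈ A.normSub p i) :
    A.map α i (A.mapOrZero τ i x) = A.mapOrZero (α ∘ τ) i x := by
  by_cases hτ : Monotone τ
  · rw [mapOrZero, mapOrZero, dif_pos hτ, dif_pos (α.monotone.comp hτ), ← A.map_comp]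
    rfl
  · rw [mapOrZero, dif_neg hτ, LinearMap.zero_apply, map_zero, mapOrZero]
    split_ifs with h
    · rw [map_eq_zero_of_not_strictMono _ _ _ hx]
      intro hs
      refine hτ fun a b hab => ?_
      rcases hab.eq_or_lt with rfl | hab
      · exact le_rfl
      · by_contra hlt
        exact absurd (hs hab) (not_lt.mpr (α.monotone (not_le.mp hlt).le))
    · rfl

theorem mapOrZero_self {p : ℕ} {i : ℤ} (σ : Fin (p + 1) → Fin (p + 1)) {x : (A.obj p).X i}
    (hx : x ∈ A.normSub p i) : A.mapOrZero σ i x = if σ = id then x else 0 := by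
  rw [mapOrZero]
  split_ifs with h h' h'
  · subst h'
    exact A.map_id p i x
  · refine A.map_eq_zero_of_not_strictMono _ (fun hs => h' ?_) hx
    exact hs.range_inj (strictMono_id) |>.mp (by
      rw [Set.range_id, (Finite.injective_iff_surjective.mp hs.injective).range_eq])
  · subst h'
    exact absurd monotone_id h
  · rfl

theorem integralBi_surjective [CharZero K] (hA : ∀ q i, ((A.obj q).D i).IsComplete) (p : ℕ) (i : ℤ) :
    Function.Surjective (A.integralBi hA p i) := by
  intro a
  -- An unnormalized Whitney form with coefficients. Summing over all tuples, with zero for the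
  -- non-monotone ones, lets the pull back formula for `Form.elem` apply as it stands.
  let x : ∀ l, A.FormTensor l p i := fun l =>
    ∑ σ : Fin (p + 1) → Fin (l + 1), ctTmul (Form.elem l p σ) (hA l i) (A.mapOrZero σ i a.1)
  have hx : x ∈ A.thomSub p i := by
    rw [mem_thomSub]
    intro k l α
    simp only [x, map_sum, coeffMap, formMap]
    have e1 : ∀ τ : Fin (p + 1) → Fin (k + 1), ctMap (LinearMap.id : Form K k p →ₗ[K] Form K k p) (A.map α i) (A.map_cont α i)
        (ctTmul (Form.elem (K := K) k p τ) (hA k i) (A.mapOrZero τ i a.1)) =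
        ctTmul (Form.elem (K := K) k p τ) (hA l i) (A.mapOrZero (α ∘ τ) i a.1) := fun τ => by
      rw [ctMap_ctTmul _ _ _ _ _ (hA l i), A.map_mapOrZero α τ a.2]
      rfl
    have e2 : ∀ σ : Fin (p + 1) → Fin (l + 1), ctMap (Form.pull (K := K) p α) LinearMap.id (DirInv.Cont.id _)
        (ctTmul (Form.elem l p σ) (hA l i) (A.mapOrZero σ i a.1)) =
        ∑ τ : Fin (p + 1) → Fin (k + 1), if α ∘ τ = σ then
          ctTmul (Form.elem k p τ) (hA l i) (A.mapOrZero σ i a.1) else 0 := fun σ => by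
      rw [ctMap_ctTmul _ _ _ _ _ (hA l i), Form.pull_eq_pullFun, Form.pullFun_elem, ctTmul_sum]
      refine Finset.sum_congr rfl fun τ _ => ?_
      split_ifs
      · rfl
      · exact ctTmul_zero _ _
    simp only [e1, e2]
    -- Each τ lifts exactly one σ, namely α ∘ τ, so the inner sum collapses.
    rw [Finset.sum_comm]
    refine Finset.sum_congr rfl fun τ _ => ?_
    rw [Finset.sum_ite_eq]
    simp
  -- On Δ^p only σ = id contributes, and t_0 dt_1 ⋯ dt_p has integral 1 / (p + 1)!.
  refine ⟨((p + 1).factorial : K) • ⟨x, hx⟩, Subtype.ext ?_⟩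
  rw [map_smul, Submodule.coe_smul, coe_integralBi]
  simp only [x, map_sum, ctContract_ctTmul, A.mapOrZero_self _ a.2]
  rw [Finset.sum_eq_single id]
  · rw [if_pos rfl, Form.integral_elem_id, smul_smul, mul_inv_cancel₀, one_smul]
    exact Nat.cast_ne_zero.mpr (Nat.factorial_ne_zero _)
  · intro σ _ hσ
    rw [if_neg hσ, smul_zero]
  · simp

end CosimplicialDGAlg

/-! ### Quasi-isomorphisms of total complexes -/

namespace DGAlg

variable {K : Type u} [Field K] {A : DGAlg.{u, v} K} {B : DGAlg.{u, v'} K} {f : ∀ n, A.X n →ₗ[K] B.X n}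

/-- The kernel of a surjective cochain map is contracted by S, hence acyclic; the argument is the
long exact sequence made explicit. Linearity of S plays no role beyond S 0 = 0. -/
theorem mapH_bijective (hf : IsCochainMap A B f) (hs : ∀ n, Function.Surjective (f n))
    (S : ∀ n' n, n' + 1 = n → A.X n → A.X n') (hfS : ∀ n' n h x, f n' (S n' n h x) = 0)
    (hS : ∀ n' n n'' (h : n' + 1 = n) (h' : n + 1 = n'') x, f n x = 0 →
      A.d n' n h (S n' n h x) + S n n'' h' (A.d n n'' h' x) = x)
    (hS0 : ∀ n' n h, S n' n h 0 = 0) (n : ℤ) : Function.Bijective (mapH hf n) := by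
  constructor
  · rw [← LinearMap.ker_eq_bot, LinearMap.ker_eq_bot']
    intro x hx
    obtain ⟨⟨x, hxc⟩, rfl⟩ := Submodule.Quotient.mk_surjective _ x
    obtain ⟨b, hb⟩ := (Submodule.Quotient.mk_eq_zero _).mp hx
    obtain ⟨w, rfl⟩ := hs _ b
    have hb : B.d (n - 1) n (sub_add_cancel n 1) (f (n - 1) w) = f n x := hb
    rw [← hf] at hb
    -- Lifting a primitive of f x changes x by a coboundary into a cocycle of the kernel, where S
    -- provides a primitive.
    have h1 : f n (x - A.d (n - 1) n (sub_add_cancel n 1) w) = 0 := by rw [map_sub, hb, sub_self]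
    have h2 := hS (n - 1) n (n + 1) (sub_add_cancel n 1) rfl _ h1
    rw [map_sub, A.d_d, A.d_eq_zero rfl hxc, sub_zero, hS0, add_zero] at h2
    refine (Submodule.Quotient.mk_eq_zero _).mpr
      ⟨w + S (n - 1) n (sub_add_cancel n 1) (x - A.d (n - 1) n (sub_add_cancel n 1) w), ?_⟩
    rw [map_add, h2]
    exact add_sub_cancel _ _
  · intro y
    obtain ⟨⟨y, hyc⟩, rfl⟩ := Submodule.Quotient.mk_surjective _ y
    obtain ⟨w, hw⟩ := hs _ y
    have h0 : f (n + 1) (A.d n (n + 1) rfl w) = 0 := by rw [hf, hw]; exact hyc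
    have h1 := hS n (n + 1) (n + 1 + 1) rfl rfl _ h0
    rw [A.d_d, hS0, add_zero] at h1
    -- A lift w of a cocycle has its boundary in the kernel. Subtracting S (d w) makes it closed,
    -- and the image is unchanged because f S = 0.
    refine ⟨A.cls n ⟨w - S n (n + 1) rfl (A.d n (n + 1) rfl w), ?_⟩, ?_⟩
    · rw [cocycles, LinearMap.mem_ker, map_sub, h1, sub_self]
    · refine congrArg (B.cls n) (Subtype.ext ?_)
      change f n (w - S n (n + 1) rfl (A.d n (n + 1) rfl w)) = y
      rw [map_sub, hfS, sub_zero, hw]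

theorem mapH_mul (hf : IsCochainMap A B f)
    (h : ∀ m n (x : A.X m) (y : A.X n), x ∈ A.cocycles m → y ∈ A.cocycles n →
      f (m + n) (A.mul m n _ rfl x y) - B.mul m n _ rfl (f m x) (f n y) ∈ B.coboundaries (m + n))
    (m n : ℤ) (x : A.H m) (y : A.H n) :
    mapH hf (m + n) (A.mulH m n (m + n) rfl x y) =
      B.mulH m n (m + n) rfl (mapH hf m x) (mapH hf n y) := by
  obtain ⟨x, rfl⟩ := Submodule.Quotient.mk_surjective _ x
  obtain ⟨y, rfl⟩ := Submodule.Quotient.mk_surjective _ y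
  exact (Submodule.Quotient.eq _).mpr (h m n x y x.2 y.2)

end DGAlg

namespace BiDGAlg

variable {K : Type u} [Field K] (B : BiDGAlg.{u, v} K) (C : BiDGAlg.{u, v'} K)

/-- The map of total modules that is induced by maps of the bigraded components. -/
def totMap (f : ∀ p i, B.X p i →ₗ[K] C.X p i) (n : ℤ) : B.TotX n →ₗ[K] C.TotX n :=
  DirectSum.toModule K (Bideg n) (C.TotX n) fun x => C.inc n x.1.1 x.1.2 x.2 ∘ₗ f x.1.1 x.1.2

variable {B C} {f : ∀ p i, B.X p i →ₗ[K] C.X p i}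

theorem totMap_inc (n : ℤ) (p : ℕ) (i : ℤ) (h : (p : ℤ) + i = n) (x : B.X p i) :
    totMap B C f n (B.inc n p i h x) = C.inc n p i h (f p i x) := by
  simp only [totMap, inc, DirectSum.toModule_lof]
  rfl

theorem totMap_apply (n : ℤ) (x : B.TotX n) (b : Bideg n) :
    totMap B C f n x b = f b.1.1 b.1.2 (x b) := by
  classical
  induction x using B.tot_induction with
  | zero => simp
  | add x y hx hy => rw [map_add, DirectSum.add_apply, DirectSum.add_apply, hx, hy, map_add]
  | inc p i h x =>
    rw [totMap_inc]
    simp only [inc, DirectSum.lof_eq_of]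
    by_cases hb : (⟨(p, i), h⟩ : Bideg n) = b
    · subst hb
      rw [DirectSum.of_eq_same, DirectSum.of_eq_same]
    · rw [DirectSum.of_eq_of_ne _ _ _ (Ne.symm hb), DirectSum.of_eq_of_ne _ _ _ (Ne.symm hb), map_zero]

/-- The kernel of a bigraded map is the sum of the kernels of its components, so homogeneous
elements suffice. -/
theorem eqOn_ker_totMap {V : Type*} [AddCommGroup V] [Module K V] {n : ℤ} (T T' : B.TotX n →ₗ[K] V)
    (h : ∀ (p : ℕ) i (e : (p : ℤ) + i = n) x, f p i x = 0 → T (B.inc n p i e x) = T' (B.inc n p i e x))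
    {x : B.TotX n} (hx : totMap B C f n x = 0) : T x = T' x := by
  classical
  rw [← DirectSum.sum_support_of x, map_sum, map_sum]
  refine Finset.sum_congr rfl fun b _ => ?_
  refine h b.1.1 b.1.2 b.2 (x b) ?_
  rw [← totMap_apply, hx, DirectSum.zero_apply]

theorem isCochainMap_totMap (hh : ∀ p p' i h x, f p' i (B.dh p p' i h x) = C.dh p p' i h (f p i x))
    (hv : ∀ p i i' h x, f p i' (B.dv p i i' h x) = C.dv p i i' h (f p i x)) :
    DGAlg.IsCochainMap B.tot C.tot (totMap B C f) := by
  intro n n' h x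
  change totMap B C f n' (B.totD n n' h x) = C.totD n n' h (totMap B C f n x)
  induction x using B.tot_induction with
  | zero => simp
  | add x y hx hy => simp only [map_add, hx, hy]
  | inc p i e x =>
    rw [totMap_inc, B.totD_inc n n' h p (p + 1) i (i + 1) e rfl rfl, map_add, map_smul, totMap_inc,
      totMap_inc, hh, hv, C.totD_inc n n' h p (p + 1) i (i + 1) e rfl rfl]

theorem totMap_surjective (hs : ∀ p i, Function.Surjective (f p i)) (n : ℤ) :
    Function.Surjective (totMap B C f n) := by
  intro y
  induction y using C.tot_induction with
  | zero => exact ⟨0, map_zero _⟩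
  | add x y hx hy =>
    obtain ⟨x, rfl⟩ := hx
    obtain ⟨y, rfl⟩ := hy
    exact ⟨x + y, map_add _ _ _⟩
  | inc p i e y =>
    obtain ⟨x, rfl⟩ := hs p i y
    exact ⟨B.inc n p i e x, totMap_inc n p i e x⟩

section Homotopy

variable (S : ∀ p i, B.X (p + 1) i →ₗ[K] B.X p i)

/-- A family of maps of bidegree `(-1, 0)`, as a map between total modules. -/
def totS (n' n : ℤ) (h : n' + 1 = n) : B.TotX n →ₗ[K] B.TotX n' :=
  DirectSum.toModule K _ _ fun x => match x with
    | ⟨(0, _), _⟩ => 0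
    | ⟨(p + 1, i), e⟩ => B.inc n' p i (by simp at e; omega) ∘ₗ S p i

theorem totS_inc_zero (n' n : ℤ) (h : n' + 1 = n) (i : ℤ) (e : ((0 : ℕ) : ℤ) + i = n) (x : B.X 0 i) :
    totS S n' n h (B.inc n 0 i e x) = 0 := by
  simp only [totS, inc, DirectSum.toModule_lof]
  rfl

theorem totS_inc_succ (n' n : ℤ) (h : n' + 1 = n) (p : ℕ) (i : ℤ) (e : ((p + 1 : ℕ) : ℤ) + i = n)
    (e' : (p : ℤ) + i = n') (x : B.X (p + 1) i) :
    totS S n' n h (B.inc n (p + 1) i e x) = B.inc n' p i e' (S p i x) := by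
  simp only [totS, inc, DirectSum.toModule_lof]
  rfl

theorem totMap_totS (hfS : ∀ p i x, f p i (S p i x) = 0) (n' n : ℤ) (h : n' + 1 = n) (x : B.TotX n) :
    totMap B C f n' (totS S n' n h x) = 0 := by
  induction x using B.tot_induction with
  | zero => simp
  | add x y hx hy => rw [map_add, map_add, hx, hy, add_zero]
  | inc p i e x =>
    cases p with
    | zero => rw [totS_inc_zero, map_zero]
    | succ p =>
      rw [totS_inc_succ S n' n h p i e (by push_cast at e; omega), totMap_inc, hfS, map_zero]

/-- As S lowers p by one and commutes with dv, the two vertical terms carry opposite signs (-1)^p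
and cancel; the horizontal terms are the given homotopy. -/
theorem totD_totS (hSv : ∀ p i i' h x, S p i' (B.dv (p + 1) i i' h x) = B.dv p i i' h (S p i x))
    (hS0 : ∀ i x, f 0 i x = 0 → S 0 i (B.dh 0 1 i rfl x) = x)
    (hS : ∀ p i x, f (p + 1) i x = 0 →
      B.dh p (p + 1) i rfl (S p i x) + S (p + 1) i (B.dh (p + 1) (p + 1 + 1) i rfl x) = x)
    (n' n n'' : ℤ) (h : n' + 1 = n) (h' : n + 1 = n'') {x : B.TotX n} (hx : totMap B C f n x = 0) :
    B.totD n' n h (totS S n' n h x) + totS S n n'' h' (B.totD n n'' h' x) = x := by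
  refine eqOn_ker_totMap (B.totD n' n h ∘ₗ totS S n' n h + totS S n n'' h' ∘ₗ B.totD n n'' h')
    LinearMap.id ?_ hx
  intro p i e x hx
  simp only [LinearMap.add_apply, LinearMap.comp_apply, LinearMap.id_apply]
  rw [B.totD_inc n n'' h' p (p + 1) i (i + 1) e rfl rfl, map_add, map_smul,
    totS_inc_succ S n n'' h' p i _ e]
  cases p with
  | zero => rw [totS_inc_zero, totS_inc_zero, map_zero, hS0 i x hx, smul_zero, add_zero, zero_add]
  | succ p =>
    have e1 : (p : ℤ) + i = n' := by push_cast at e; omega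
    rw [totS_inc_succ S n' n h p i e e1, totS_inc_succ S n n'' h' p (i + 1) _ (by omega), hSv,
      B.totD_inc n' n h p (p + 1) i (i + 1) e1 rfl rfl, pow_succ, mul_neg, mul_one, neg_smul]
    rw [add_add_add_comm, add_neg_cancel, add_zero, ← map_add, hS p i x hx]

end Homotopy

section Multiplicativity

variable (H : ∀ p q r i j k, p + q = r + 1 → i + j = k → (B.X p i →ₗ[K] B.X q j →ₗ[K] C.X r k))

/-- A family of bilinear maps of bidegree `(-1, 0)`, as a bilinear map between total modules; the
sign is the one of the total product. -/
def totH (m n k : ℤ) (h : m + n = k + 1) : B.TotX m →ₗ[K] B.TotX n →ₗ[K] C.TotX k :=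
  DirectSum.toModule K _ _ fun x => LinearMap.flip <| DirectSum.toModule K _ _ fun y =>
    -- For p = q = 0 the target would have horizontal degree -1, so the map is zero there; the
    -- condition also makes the truncated subtraction p + q - 1 exact.
    LinearMap.flip <| if hxy : 0 < x.1.1 + y.1.1 then (-1 : K) ^ (x.1.2 * (y.1.1 : ℤ)) •
      (H x.1.1 y.1.1 (x.1.1 + y.1.1 - 1) x.1.2 y.1.2 _ (Nat.sub_add_cancel hxy).symm rfl).compr₂
        (C.inc k (x.1.1 + y.1.1 - 1) (x.1.2 + y.1.2)
          (by have := x.2; have := y.2; omega)) else 0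

theorem totH_inc (m n k : ℤ) (h : m + n = k + 1) (p q r : ℕ) (i j l : ℤ) (e : (p : ℤ) + i = m)
    (e' : (q : ℤ) + j = n) (hr : p + q = r + 1) (hl : i + j = l) (x : B.X p i) (y : B.X q j) :
    totH H m n k h (B.inc m p i e x) (B.inc n q j e' y) =
      (-1 : K) ^ (i * (q : ℤ)) • C.inc k r l (by omega) (H p q r i j l hr hl x y) := by
  obtain rfl : r = p + q - 1 := by omega
  subst hl
  simp only [totH, inc, DirectSum.toModule_lof, LinearMap.flip_apply]
  rw [dif_pos (by omega)]
  rfl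

theorem totH_inc_zero (m n k : ℤ) (h : m + n = k + 1) (i j : ℤ) (e : ((0 : ℕ) : ℤ) + i = m)
    (e' : ((0 : ℕ) : ℤ) + j = n) (x : B.X 0 i) (y : B.X 0 j) :
    totH H m n k h (B.inc m 0 i e x) (B.inc n 0 j e' y) = 0 := by
  simp only [totH, inc, DirectSum.toModule_lof, LinearMap.flip_apply]
  rfl

/-- The horizontal hypotheses say that H is a homotopy for dh; they are split because no term dh H
exists for p = q = 0. By `hHv` the vertical differential acts on H by the Leibniz rule, so the
vertical terms drop out of the total formula. -/
theorem totMap_totMul_sub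
    (hH0 : ∀ i j k (e : i + j = k) (x : B.X 0 i) (y : B.X 0 j),
      f 0 k (B.mul 0 0 0 i j k rfl e x y) - C.mul 0 0 0 i j k rfl e (f 0 i x) (f 0 j y) =
        H 1 0 0 i j k rfl e (B.dh 0 1 i rfl x) y + H 0 1 0 i j k rfl e x (B.dh 0 1 j rfl y))
    (hH : ∀ p q r i j k (h : p + q = r + 1) (h1 : p + 1 + q = r + 1 + 1) (h2 : p + (q + 1) = r + 1 + 1)
      (e : i + j = k) (x : B.X p i) (y : B.X q j),
      f (r + 1) k (B.mul p q (r + 1) i j k h e x y) -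
        C.mul p q (r + 1) i j k h e (f p i x) (f q j y) =
        C.dh r (r + 1) k rfl (H p q r i j k h e x y) +
          H (p + 1) q (r + 1) i j k h1 e (B.dh p (p + 1) i rfl x) y +
          (-1 : K) ^ p • H p (q + 1) (r + 1) i j k h2 e x (B.dh q (q + 1) j rfl y))
    (hHv : ∀ p q r i j k i' j' k' (h : p + q = r + 1) (e : i + j = k) (ei : i + 1 = i')
      (ej : j + 1 = j') (ek : k + 1 = k') (e1 : i' + j = k') (e2 : i + j' = k')
      (x : B.X p i) (y : B.X q j),
      C.dv r k k' ek (H p q r i j k h e x y) = H p q r i' j k' h e1 (B.dv p i i' ei x) y +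
        (-1 : K) ^ i • H p q r i j' k' h e2 x (B.dv q j j' ej y))
    (m n l : ℤ) (h : m + n = l + 1) (h' : m + 1 + n = l + 1 + 1) (h'' : m + (n + 1) = l + 1 + 1)
    (x : B.TotX m) (y : B.TotX n) :
    totMap B C f (l + 1) (B.totMul m n (l + 1) h x y) -
        C.totMul m n (l + 1) h (totMap B C f m x) (totMap B C f n y) =
      C.totD l (l + 1) rfl (totH H m n l h x y) +
        totH H (m + 1) n (l + 1) h' (B.totD m (m + 1) rfl x) y +
        (-1 : K) ^ m • totH H m (n + 1) (l + 1) h'' x (B.totD n (n + 1) rfl y) := by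
  induction x using B.tot_induction with
  | zero => simp
  | add x x' hx hx' =>
    simp only [map_add, LinearMap.add_apply, smul_add]
    rw [add_sub_add_comm, hx, hx']
    abel
  | inc p i e x =>
  induction y using B.tot_induction with
  | zero => simp
  | add y y' hy hy' =>
    simp only [map_add, smul_add]
    rw [add_sub_add_comm, hy, hy']
    abel
  | inc q j e' y =>
    have n1 : (-1 : K) ≠ 0 := neg_ne_zero.mpr one_ne_zero
    have s1 : (-1 : K) ^ m = (-1) ^ p * (-1 : K) ^ i := by
      rw [← e, zpow_add₀ n1, zpow_natCast]
    have s2 : (-1 : K) ^ ((i + 1) * (q : ℤ)) = (-1 : K) ^ (i * (q : ℤ)) * (-1) ^ q := by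
      rw [add_mul, one_mul, zpow_add₀ n1, zpow_natCast]
    have s3 : (-1 : K) ^ (i * ((q + 1 : ℕ) : ℤ)) = (-1 : K) ^ (i * (q : ℤ)) * (-1 : K) ^ i := by
      rw [Nat.cast_add, mul_add, Nat.cast_one, mul_one, zpow_add₀ n1]
    have s4 : (-1 : K) ^ i * (-1 : K) ^ i = 1 := by rw [← mul_zpow]; simp
    rw [B.totD_inc m (m + 1) rfl p (p + 1) i (i + 1) e rfl rfl,
      B.totD_inc n (n + 1) rfl q (q + 1) j (j + 1) e' rfl rfl, totMap_inc, totMap_inc]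
    simp only [map_add, map_smul, LinearMap.add_apply, LinearMap.smul_apply]
    rcases Nat.eq_zero_or_pos (p + q) with h0 | h0
    · obtain ⟨rfl, rfl⟩ : p = 0 ∧ q = 0 := by omega
      rw [B.totMul_inc m n (l + 1) h 0 0 0 i j (i + j) e e' rfl rfl,
        C.totMul_inc m n (l + 1) h 0 0 0 i j (i + j) e e' rfl rfl, map_smul, totMap_inc,
        totH_inc_zero, totH_inc_zero, totH_inc_zero,
        totH_inc H (m + 1) n (l + 1) h' 1 0 0 i j (i + j) _ e' rfl rfl,
        totH_inc H m (n + 1) (l + 1) h'' 0 1 0 i j (i + j) e _ rfl rfl, ← smul_sub, ← map_sub, hH0, s1]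
      have s5 : (-1 : K) ^ 0 * (-1 : K) ^ i * (-1 : K) ^ (i * ((1 : ℕ) : ℤ)) = 1 := by simp [s4]
      simp only [smul_add, smul_smul, s5, map_add]
      simp
    · obtain ⟨r, hr⟩ : ∃ r, p + q = r + 1 := ⟨p + q - 1, by omega⟩
      rw [B.totMul_inc m n (l + 1) h p q (r + 1) i j (i + j) e e' hr rfl,
        C.totMul_inc m n (l + 1) h p q (r + 1) i j (i + j) e e' hr rfl, map_smul, totMap_inc,
        totH_inc H m n l h p q r i j (i + j) e e' hr rfl, map_smul,
        C.totD_inc l (l + 1) rfl r (r + 1) (i + j) (i + j + 1) _ rfl rfl,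
        totH_inc H (m + 1) n (l + 1) h' (p + 1) q (r + 1) i j (i + j) _ e' (by omega) rfl,
        totH_inc H (m + 1) n (l + 1) h' p q r (i + 1) j (i + j + 1) _ e' hr (by omega),
        totH_inc H m (n + 1) (l + 1) h'' p (q + 1) (r + 1) i j (i + j) e _ (by omega) rfl,
        totH_inc H m (n + 1) (l + 1) h'' p q r i (j + 1) (i + j + 1) e _ hr (by omega),
        ← smul_sub, ← map_sub, hH p q r i j (i + j) hr (by omega) (by omega) rfl,
        hHv p q r i j (i + j) (i + 1) (j + 1) (i + j + 1) hr rfl rfl rfl rfl (by omega) (by omega)]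
      simp only [map_add, map_smul, smul_add, smul_smul]
      -- Since r is one less than p + q, the vertical part of the differential of H has the sign
      -- opposite to that of the vertical terms in its arguments, which is what cancels them.
      have t0 : (-1 : K) ^ p * (-1) ^ q = - (-1 : K) ^ r := by rw [← pow_add, hr, pow_succ, mul_neg_one]
      rw [s1, s2, s3]
      have t1 : (-1 : K) ^ p * ((-1 : K) ^ (i * (q : ℤ)) * (-1) ^ q) =
          -((-1 : K) ^ (i * (q : ℤ)) * (-1) ^ r) := by
        linear_combination (-1 : K) ^ (i * (q : ℤ)) * t0
      have t2 : (-1 : K) ^ p * (-1 : K) ^ i * ((-1 : K) ^ (i * (q : ℤ)) * (-1 : K) ^ i) =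
          (-1 : K) ^ (i * (q : ℤ)) * (-1) ^ p := by
        linear_combination ((-1 : K) ^ p * (-1 : K) ^ (i * (q : ℤ))) * s4
      have t3 : (-1 : K) ^ p * (-1 : K) ^ i * ((-1 : K) ^ q * (-1 : K) ^ (i * (q : ℤ))) =
          -((-1 : K) ^ (i * (q : ℤ)) * ((-1) ^ r * (-1 : K) ^ i)) := by
        linear_combination ((-1 : K) ^ (i * (q : ℤ)) * (-1 : K) ^ i) * t0
      simp only [mul_assoc] at t1 t2 t3 ⊢
      rw [t1, t2, t3, neg_smul, neg_smul]
      abel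

theorem mapH_totMap_mul (hf : DGAlg.IsCochainMap B.tot C.tot (totMap B C f))
    (hH0 : ∀ i j k (e : i + j = k) (x : B.X 0 i) (y : B.X 0 j),
      f 0 k (B.mul 0 0 0 i j k rfl e x y) - C.mul 0 0 0 i j k rfl e (f 0 i x) (f 0 j y) =
        H 1 0 0 i j k rfl e (B.dh 0 1 i rfl x) y + H 0 1 0 i j k rfl e x (B.dh 0 1 j rfl y))
    (hH : ∀ p q r i j k (h : p + q = r + 1) (h1 : p + 1 + q = r + 1 + 1) (h2 : p + (q + 1) = r + 1 + 1)
      (e : i + j = k) (x : B.X p i) (y : B.X q j),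
      f (r + 1) k (B.mul p q (r + 1) i j k h e x y) -
        C.mul p q (r + 1) i j k h e (f p i x) (f q j y) =
        C.dh r (r + 1) k rfl (H p q r i j k h e x y) +
          H (p + 1) q (r + 1) i j k h1 e (B.dh p (p + 1) i rfl x) y +
          (-1 : K) ^ p • H p (q + 1) (r + 1) i j k h2 e x (B.dh q (q + 1) j rfl y))
    (hHv : ∀ p q r i j k i' j' k' (h : p + q = r + 1) (e : i + j = k) (ei : i + 1 = i')
      (ej : j + 1 = j') (ek : k + 1 = k') (e1 : i' + j = k') (e2 : i + j' = k')
      (x : B.X p i) (y : B.X q j),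
      C.dv r k k' ek (H p q r i j k h e x y) = H p q r i' j k' h e1 (B.dv p i i' ei x) y +
        (-1 : K) ^ i • H p q r i j' k' h e2 x (B.dv q j j' ej y))
    (m n : ℤ) (x : B.tot.H m) (y : B.tot.H n) :
    DGAlg.mapH hf (m + n) (B.tot.mulH m n (m + n) rfl x y) =
      C.tot.mulH m n (m + n) rfl (DGAlg.mapH hf m x) (DGAlg.mapH hf n y) := by
  refine DGAlg.mapH_mul hf (fun m n x y hx hy => ?_) m n x y
  have key : ∀ k l (h : m + n = k) (hl : l + 1 = k) (x : B.TotX m) (y : B.TotX n)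
      (_ : B.totD m (m + 1) rfl x = 0) (_ : B.totD n (n + 1) rfl y = 0),
      totMap B C f k (B.totMul m n k h x y) - C.totMul m n k h (totMap B C f m x) (totMap B C f n y) =
        C.totD l k hl (totH H m n l (by omega) x y) := by
    rintro k l h rfl x y h2 h3
    rw [totMap_totMul_sub H hH0 hH hHv m n l h (by omega) (by omega) x y, h2, h3, map_zero, map_zero,
      LinearMap.zero_apply, smul_zero, add_zero, add_zero]
  have h1 := key (m + n) (m + n - 1) rfl (sub_add_cancel _ _) x y hx hy
  exact ⟨_, h1.symm⟩

end Multiplicativity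

end BiDGAlg

/-! ### Bilinear forms on differential forms -/

section Bilinear

variable (K : Type u) [Field K]

/-- The families of bilinear forms on `Ω^p(Δ^r) × Ω^q(Δ^r)`. -/
abbrev Bil (r : ℕ) : Type u := ∀ p q, Form K r p →ₗ[K] Form K r q →ₗ[K] K

variable {K}

/-- The push forward of bilinear forms. -/
def Bil.push {r s : ℕ} (α : Fin (r + 1) →o Fin (s + 1)) : Bil K r →ₗ[K] Bil K s where
  toFun θ p q := (θ p q).compl₁₂ (Form.pull p α) (Form.pull q α)
  map_add' _ _ := rfl
  map_smul' _ _ := rfl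

theorem Bil.ext {r : ℕ} {θ θ' : Bil K r} (h : ∀ p q ω η, θ p q ω η = θ' p q ω η) : θ = θ' :=
  funext fun p => funext fun q => LinearMap.ext fun ω => LinearMap.ext fun η => h p q ω η

theorem Bil.push_apply {r s : ℕ} (α : Fin (r + 1) →o Fin (s + 1)) (θ : Bil K r) (p q : ℕ)
    (ω : Form K s p) (η : Form K s q) :
    Bil.push α θ p q ω η = θ p q (Form.pullFun p α ω) (Form.pullFun q α η) := rfl

/-- A module with the discrete topology. -/
def DirInv.discrete (M : Type u) [AddCommGroup M] [Module K M] : DirInv.{u, u, 0} K M where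
  J := Unit
  F _ := ⊤
  fil _ _ := ⊥
  fil_le _ _ := bot_le
  fil_anti _ _ _ _ := le_rfl
  F_mono _ _ _ := le_rfl
  incl_cont _ _ _ _ := ⟨0, le_rfl⟩

theorem DirInv.cont_discrete {M N : Type u} [AddCommGroup M] [Module K M] [AddCommGroup N] [Module K N]
    (f : M →ₗ[K] N) : DirInv.Cont (DirInv.discrete M) (DirInv.discrete N) f :=
  fun _ => ⟨(), fun _ _ => trivial, fun _ => ⟨0, fun x hx => by
    rw [(Submodule.mem_bot K).mp hx, map_zero]; exact Submodule.zero_mem _⟩⟩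

theorem Bil.push_id {r : ℕ} (θ : Bil K r) : Bil.push OrderHom.id θ = θ := Bil.ext fun p q ω η => by
  have h : ∀ (p : ℕ) (x : Form K r p), Form.pullFun p (OrderHom.id : Fin (r + 1) →o Fin (r + 1)) x = x :=
    Form.pullFun_id
  rw [Bil.push_apply, h, h]

theorem Bil.push_comp {r s t : ℕ} (β : Fin (s + 1) →o Fin (t + 1)) (α : Fin (r + 1) →o Fin (s + 1))
    (θ : Bil K r) : Bil.push (β.comp α) θ = Bil.push β (Bil.push α θ) := Bil.ext fun p q ω η => by
  rw [Bil.push_apply, Bil.push_apply, Bil.push_apply, OrderHom.comp_coe, Form.pullFun_comp,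
    Form.pullFun_comp]

/-- A module as a DG algebra in each degree, with the differential and the product zero. -/
def trivialAlg (M : Type u) [AddCommGroup M] [Module K M] : DirInvDGAlg.{u, u, 0} K where
  X _ := M
  d _ _ _ := 0
  mul _ _ _ _ := 0
  d_d _ _ _ _ _ _ := rfl
  leibniz _ _ _ _ _ _ _ _ _ _ _ _ _ _ := by
    simp only [LinearMap.zero_apply, smul_zero, add_zero]
  D _ := DirInv.discrete M
  d_cont _ _ _ := DirInv.cont_discrete _
  mul_cont _ _ _ _ _ _ := ⟨(), fun _ _ _ _ => trivial,
    fun _ => ⟨0, fun _ _ _ _ => Submodule.zero_mem _⟩,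
    fun _ _ _ => ⟨0, fun _ _ => Submodule.zero_mem _⟩,
    fun _ _ _ => ⟨0, fun _ _ => Submodule.zero_mem _⟩⟩

/-- The cosimplicial module of the bilinear forms on differential forms, with the product zero. -/
def bilCosimplicial : CosimplicialDGAlg.{u, u, 0} K where
  obj r := trivialAlg (Bil K r)
  map α _ := Bil.push α
  map_cont _ _ := DirInv.cont_discrete _
  map_id _ _ := Bil.push_id
  map_comp β α _ := Bil.push_comp β α
  map_d α _ _ _ _ := map_zero (Bil.push α)
  map_mul α _ _ _ _ _ _ := map_zero (Bil.push α)

/-- The alternating sum of the push forwards along the co-face maps. -/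
def Bil.faceSum {r : ℕ} (θ : Bil K r) : Bil K (r + 1) :=
  ∑ k ∈ Finset.range (r + 2), (-1 : K) ^ k • Bil.push (coface rfl k) θ

/-- Viewing bilinear forms as a cosimplicial module makes the simplicial identities `delta_delta`
and `delta_mem` available for `Bil.faceSum`. The degree 0 is an arbitrary choice, as all degrees
carry the same module. -/
theorem Bil.faceSum_eq_delta {r : ℕ} (θ : Bil K r) :
    Bil.faceSum θ = bilCosimplicial.delta r (r + 1) 0 rfl θ :=
  (bilCosimplicial.delta_apply r (r + 1) 0 rfl θ).symm

theorem Bil.faceSum_apply {r : ℕ} (θ : Bil K r) (p q : ℕ) (ω : Form K (r + 1) p) (η : Form K (r + 1) q) :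
    Bil.faceSum θ p q ω η = ∑ k ∈ Finset.range (r + 2), (-1 : K) ^ k •
      θ p q (Form.pull p (coface rfl k) ω) (Form.pull q (coface rfl k) η) := by
  rw [Bil.faceSum]
  simp only [Finset.sum_apply, LinearMap.sum_apply]
  rfl

theorem Bil.sub_apply {r : ℕ} (θ θ' : Bil K r) (p q : ℕ) (ω : Form K r p) (η : Form K r q) :
    (θ - θ') p q ω η = θ p q ω η - θ' p q ω η := rfl

theorem Bil.faceSum_sub {r : ℕ} (θ θ' : Bil K r) :
    Bil.faceSum (θ - θ') = Bil.faceSum θ - Bil.faceSum θ' := Bil.ext fun p q ω η => by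
  simp only [Bil.sub_apply, Bil.faceSum_apply, smul_sub, Finset.sum_sub_distrib]

theorem Bil.faceSum_faceSum {r : ℕ} (θ : Bil K r) : Bil.faceSum (Bil.faceSum θ) = 0 := by
  rw [Bil.faceSum_eq_delta, Bil.faceSum_eq_delta]
  exact bilCosimplicial.delta_delta r (r + 1) (r + 1 + 1) 0 rfl rfl θ

/-- The differential of bilinear forms that is dual to the exterior derivative. -/
def Bil.dB {r : ℕ} (θ : Bil K r) : Bil K r := fun p q =>
  (θ (p + 1) q) ∘ₗ Form.dS r p + (-1 : K) ^ p • (θ p (q + 1)).compl₂ (Form.dS r q)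

theorem Bil.dB_apply {r : ℕ} (θ : Bil K r) (p q : ℕ) (ω : Form K r p) (η : Form K r q) :
    Bil.dB θ p q ω η = θ (p + 1) q (Form.dS r p ω) η + (-1 : K) ^ p • θ p (q + 1) ω (Form.dS r q η) := rfl

theorem Bil.dB_sub {r : ℕ} (θ θ' : Bil K r) : Bil.dB (θ - θ') = Bil.dB θ - Bil.dB θ' :=
  Bil.ext fun p q ω η => by
    simp only [Bil.dB_apply, Pi.sub_apply, LinearMap.sub_apply, smul_sub]
    abel

theorem Bil.dB_faceSum {r : ℕ} (θ : Bil K r) : Bil.dB (Bil.faceSum θ) = Bil.faceSum (Bil.dB θ) :=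
  Bil.ext fun p q ω η => by
    simp only [Bil.dB_apply, Bil.faceSum_apply, Form.pull_d, Finset.smul_sum, smul_add,
      Finset.sum_add_distrib]
    congr 1
    exact Finset.sum_congr rfl fun _ _ => smul_comm _ _ _

/-- The contraction of bilinear forms that is dual to the contraction of the simplex to the first
vertex. -/
def Bil.cyl {r : ℕ} (G : Bil K r) : Bil K r
  | p + 1, q => G p q ∘ₗ Form.coneZero r p
  | 0, q + 1 => (Form.eval r 0).smulRight (G 0 q (Form.one K r) ∘ₗ Form.coneZero r q)
  | 0, 0 => 0

theorem Bil.cyl_succ {r : ℕ} (G : Bil K r) (p q : ℕ) (ω : Form K r (p + 1)) (η : Form K r q) :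
    Bil.cyl G (p + 1) q ω η = G p q (Form.coneZero r p ω) η := by
  rw [Bil.cyl]; rfl

theorem Bil.cyl_zero_succ {r : ℕ} (G : Bil K r) (q : ℕ) (ω : Form K r 0) (η : Form K r (q + 1)) :
    Bil.cyl G 0 (q + 1) ω η =
      Form.eval r 0 ω * G 0 q (Form.one K r) (Form.coneZero r q η) := by
  rw [Bil.cyl]; rfl

theorem Bil.cyl_zero_zero {r : ℕ} (G : Bil K r) : Bil.cyl G 0 0 = 0 := by
  rw [Bil.cyl]

theorem Form.d_one (r : ℕ) : Form.dS r 0 (Form.one K r) = 0 := by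
  rw [Form.one, Form.dS, Form.d_tmul]
  simp

/-- `Bil.cyl` is composition with the contraction h ⊗ 1 + ε ⊗ h of Ω ⊗ Ω onto the constants, for ε
the evaluation at the vertex 0. A closed form is thus exact up to its value on 1 ⊗ 1, which is
assumed to vanish. -/
theorem Bil.dB_cyl [CharZero K] {r : ℕ} (G : Bil K r) (hG : Bil.dB G = 0)
    (h1 : G 0 0 (Form.one K r) (Form.one K r) = 0) : Bil.dB (Bil.cyl G) = G := by
  have hG' : ∀ p q (ω : Form K r p) (η : Form K r q),
      G (p + 1) q (Form.dS r p ω) η + (-1 : K) ^ p • G p (q + 1) ω (Form.dS r q η) = 0 :=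
    fun p q ω η => by rw [← Bil.dB_apply, hG]; rfl
  refine Bil.ext fun p q ω η => ?_
  rw [Bil.dB_apply, Bil.cyl_succ]
  cases p with
  | zero =>
    rw [Form.coneZero_d, Bil.cyl_zero_succ, map_sub, map_smul, LinearMap.sub_apply,
      LinearMap.smul_apply, pow_zero, one_smul, smul_eq_mul]
    -- With first argument 1, closedness of G reduces to G(1, dη) = 0, because d 1 = 0.
    have key : G 0 q (Form.one K r) (Form.coneZero r q (Form.dS r q η)) = G 0 q (Form.one K r) η := by
      cases q with
      | zero => rw [Form.coneZero_d, map_sub, map_smul, h1, smul_zero, sub_zero]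
      | succ q =>
        have h2 := hG' 0 q (Form.one K r) (Form.coneZero r q η)
        rw [Form.d_one, map_zero, LinearMap.zero_apply, zero_add, pow_zero, one_smul] at h2
        conv_rhs => rw [← Form.d_coneZero r q η, map_add, h2, zero_add]
    rw [key, sub_add_cancel]
  | succ p =>
    have h2 := hG' p q (Form.coneZero r p ω) η
    have h3 := Form.d_coneZero r p ω
    have h4 := congrArg (fun z => G (p + 1) q z η) h3
    simp only [map_add, LinearMap.add_apply] at h4
    rw [Bil.cyl_succ, pow_succ, smul_eq_mul]
    rw [smul_eq_mul] at h2
    linear_combination h4 - h2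

/-- The contraction is onto the vertex 0, so it is natural exactly for the maps at hand that fix
this vertex. -/
theorem Bil.push_cyl {r s : ℕ} (α : Fin (r + 1) →o Fin (s + 1)) (hα : α 0 = 0) (G : Bil K r) :
    Bil.push α (Bil.cyl G) = Bil.cyl (Bil.push α G) := by
  refine Bil.ext fun p q ω η => ?_
  rw [Bil.push_apply]
  cases p with
  | succ p => rw [Bil.cyl_succ, Bil.cyl_succ, Bil.push_apply, Form.pullFun_coneZero p hα]
  | zero =>
    cases q with
    | zero => rw [Bil.cyl_zero_zero, Bil.cyl_zero_zero]; rfl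
    | succ q =>
      rw [Bil.cyl_zero_succ, Bil.cyl_zero_succ, Bil.push_apply, Form.pullFun_coneZero q hα,
        Form.pullFun_one, Form.eval_pullFun, hα]

theorem Bil.cyl_zero {r : ℕ} : Bil.cyl (0 : Bil K r) = 0 := by
  refine Bil.ext fun p q ω η => ?_
  cases p with
  | succ p => rw [Bil.cyl_succ]; rfl
  | zero =>
    cases q with
    | zero => rw [Bil.cyl_zero_zero]; rfl
    | succ q => rw [Bil.cyl_zero_succ]; exact mul_zero _

variable (K) in
/-- The integral of the product of two forms. -/
def Bil.wedge (r : ℕ) : Bil K r := fun p q =>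
  if h : p + q = r then (Form.mul r p q r h).compr₂ (Form.integral r) else 0

variable (K) in
/-- The product of the integrals of two forms over the front face and the back face. -/
def Bil.cup (r : ℕ) : Bil K r := fun p q =>
  if h : p + q = r then (LinearMap.mul K K).compl₁₂ (Form.integral p ∘ₗ Form.pull p (front h))
    (Form.integral q ∘ₗ Form.pull q (back h)) else 0

theorem Bil.wedge_apply {r p q : ℕ} (h : p + q = r) (ω : Form K r p) (η : Form K r q) :
    Bil.wedge K r p q ω η = Form.integral r (Form.mul r p q r h ω η) := by
  rw [Bil.wedge, dif_pos h]; rfl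

theorem Bil.wedge_of_ne {r p q : ℕ} (h : p + q ≠ r) : Bil.wedge K r p q = 0 := dif_neg h

theorem Bil.cup_apply {r p q : ℕ} (h : p + q = r) (ω : Form K r p) (η : Form K r q) :
    Bil.cup K r p q ω η = Form.integral p (Form.pull p (front h) ω) *
      Form.integral q (Form.pull q (back h) η) := by
  rw [Bil.cup, dif_pos h]; rfl

theorem Bil.cup_of_ne {r p q : ℕ} (h : p + q ≠ r) : Bil.cup K r p q = 0 := dif_neg h

/-- By the Leibniz rule the left hand side integrates d(ω ∧ η), and Stokes turns this into a sum
over faces. -/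
theorem Bil.dB_wedge [CharZero K] (r : ℕ) :
    Bil.dB (Bil.wedge K (r + 1)) = Bil.faceSum (Bil.wedge K r) := by
  refine Bil.ext fun p q ω η => ?_
  rw [Bil.dB_apply, Bil.faceSum_apply]
  by_cases h : p + q = r
  · rw [Bil.wedge_apply (by omega : p + 1 + q = r + 1), Bil.wedge_apply (by omega : p + (q + 1) = r + 1),
      ← map_smul, ← map_add, ← Form.leibniz (r + 1) p q r (p + 1) (q + 1) (r + 1) h rfl rfl rfl,
      Form.integral_d_range]
    simp only [Bil.wedge_apply h, Form.pull_mul]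
  · rw [Bil.wedge_of_ne (by omega), Bil.wedge_of_ne (by omega), Bil.wedge_of_ne h]
    simp

theorem Form.pull_pull_eq {k l n : ℕ} (a : ℕ) (α : Fin (k + 1) →o Fin (l + 1))
    (β : Fin (l + 1) →o Fin (n + 1)) (γ : Fin (k + 1) →o Fin (n + 1)) (h : ∀ y, (β (α y) : ℕ) = γ y)
    (x : Form K n a) : Form.pull a α (Form.pull a β x) = Form.pull a γ x := by
  have e : β.comp α = γ := OrderHom.ext _ _ (funext fun y => Fin.ext (h y))
  subst e
  exact (Form.pullFun_comp a α β x).symm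

theorem Bil.cup_coface_lt {p q r s : ℕ} (h : p + q = r) (h1 : p + 1 + q = r + 1) (hs : s < p + 1)
    (ω : Form K (r + 1) p) (η : Form K (r + 1) q) :
    Bil.cup K r p q (Form.pull p (coface rfl s) ω) (Form.pull q (coface rfl s) η) =
      Form.integral p (Form.pull p (coface rfl s) (Form.pull p (front h1) ω)) *
        Form.integral q (Form.pull q (back h1) η) := by
  rw [Bil.cup_apply h, Form.pull_pull_eq q (back h) (coface rfl s) (back h1) (fun y => by
      rw [coe_coface, coe_back, coe_back, if_neg (by omega)]; omega),
    Form.pull_pull_eq p (front h) (coface rfl s) ((front h1).comp (coface rfl s)) (fun y => rfl),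
    Form.pull_pull_eq p (coface rfl s) (front h1) ((front h1).comp (coface rfl s)) (fun y => rfl)]

theorem Bil.cup_coface_add {p q r : ℕ} (h : p + q = r) (h2 : p + (q + 1) = r + 1) (s : ℕ)
    (ω : Form K (r + 1) p) (η : Form K (r + 1) q) :
    Bil.cup K r p q (Form.pull p (coface rfl (p + 1 + s)) ω) (Form.pull q (coface rfl (p + 1 + s)) η) =
      Form.integral p (Form.pull p (front h2) ω) *
        Form.integral q (Form.pull q (coface rfl (s + 1)) (Form.pull q (back h2) η)) := by
  rw [Bil.cup_apply h, Form.pull_pull_eq p (front h) (coface rfl (p + 1 + s)) (front h2) (fun y => by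
      have := y.2
      rw [coe_coface, coe_front, coe_front, if_pos (by omega)]),
    Form.pull_pull_eq q (back h) (coface rfl (p + 1 + s)) ((back h2).comp (coface rfl (s + 1)))
      (fun y => by
        rw [OrderHom.comp_coe, Function.comp_apply, coe_coface, coe_back, coe_back, coe_coface]
        split_ifs <;> omega),
    Form.pull_pull_eq q (coface rfl (s + 1)) (back h2) ((back h2).comp (coface rfl (s + 1)))
      (fun y => rfl)]

theorem Bil.dB_cup [CharZero K] (r : ℕ) :
    Bil.dB (Bil.cup K (r + 1)) = Bil.faceSum (Bil.cup K r) := by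
  refine Bil.ext fun p q ω η => ?_
  rw [Bil.dB_apply, Bil.faceSum_apply]
  by_cases h : p + q = r
  · have h1 : p + 1 + q = r + 1 := by omega
    have h2 : p + (q + 1) = r + 1 := by omega
    -- The last face of the front simplex and the zeroth face of the back simplex are the two inner
    -- faces. In the two Stokes formulas they produce the same product of integrals with opposite
    -- signs; all other faces match those of Δ^{r+1}.
    have C1 : Form.pull p (coface rfl (p + 1)) (Form.pull p (front h1) ω) = Form.pull p (front h2) ω :=
      Form.pull_pull_eq _ _ _ _ (fun y => by
        have := y.2
        rw [coe_front, coe_front, coe_coface, if_pos (by omega)]) _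
    have C2 : Form.pull q (coface rfl 0) (Form.pull q (back h2) η) = Form.pull q (back h1) η :=
      Form.pull_pull_eq _ _ _ _ (fun y => by
        rw [coe_back, coe_back, coe_coface, if_neg (by omega)]; omega) _
    have hr : r + 2 = (p + 1) + (q + 1) := by omega
    rw [hr, Finset.sum_range_add, Finset.sum_congr rfl fun s hs => congrArg ((-1 : K) ^ s • ·)
      (Bil.cup_coface_lt h h1 (Finset.mem_range.mp hs) ω η),
      Finset.sum_congr rfl fun s _ => congrArg ((-1 : K) ^ (p + 1 + s) • ·)
      (Bil.cup_coface_add h h2 s ω η)]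
    rw [Bil.cup_apply h1, Bil.cup_apply h2, Form.pull_d, Form.pull_d, Form.integral_d_range,
      Form.integral_d_range, Finset.sum_range_succ _ (p + 1), Finset.sum_range_succ' _ (q + 1), C1, C2]
    generalize Form.integral q (Form.pull q (back h1) η) = b1
    generalize Form.integral p (Form.pull p (front h2) ω) = a2
    simp only [smul_eq_mul, add_mul, mul_add, Finset.sum_mul, Finset.mul_sum]
    have e3 : ∀ s (z : K), (-1 : K) ^ (p + 1 + s) * (a2 * z) = (-1) ^ p * (a2 * ((-1) ^ (s + 1) * z)) :=
      fun s z => by ring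
    simp only [e3, mul_assoc]
    ring
  · rw [Bil.cup_of_ne (by omega), Bil.cup_of_ne (by omega), Bil.cup_of_ne h]
    simp

/-- The difference of the two products of integrals. -/
def Bil.psi (r : ℕ) : Bil K r := Bil.wedge K r - Bil.cup K r

theorem Bil.dB_psi [CharZero K] (r : ℕ) :
    Bil.dB (Bil.psi (K := K) (r + 1)) = Bil.faceSum (Bil.psi r) := by
  rw [Bil.psi, Bil.psi, Bil.dB_sub, Bil.dB_wedge, Bil.dB_cup, Bil.faceSum_sub]

/-- On a point the two products live in form degrees 0 and 0, whereas the dual differential only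
involves a positive total degree. -/
theorem Bil.dB_psi_zero : Bil.dB (Bil.psi (K := K) 0) = 0 := by
  refine Bil.ext fun p q ω η => ?_
  rw [Bil.dB_apply, Bil.psi, Bil.sub_apply, Bil.sub_apply, Bil.wedge_of_ne (by omega),
    Bil.wedge_of_ne (by omega), Bil.cup_of_ne (by omega), Bil.cup_of_ne (by omega)]
  simp

/-- The wedge product is an r-form pulled back along a map to a simplex of dimension r - 1. In the
product of integrals the codegeneracy collapses either the front face (s < p) or the back face (s ≥
p), and that integral vanishes. -/
theorem Bil.push_codegen_psi {r r' : ℕ} (h : r' + 1 = r) (s : Fin (r' + 1)) :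
    Bil.push (codegen h s) (Bil.psi (K := K) r) = 0 := by
  refine Bil.ext fun p q ω η => ?_
  rw [Bil.push_apply, Bil.psi, Bil.sub_apply]
  change _ = (0 : K)
  have hs := s.2
  by_cases hpq : p + q = r
  · have e1 : Bil.cup K r p q (Form.pullFun p (codegen h s) ω) (Form.pullFun q (codegen h s) η) = 0 := by
      rw [Bil.cup_apply hpq]
      simp only [Form.pull_eq_pullFun, ← Form.pullFun_comp]
      by_cases hsp : (s : ℕ) < p
      · obtain ⟨p', rfl⟩ : ∃ m, p = m + 1 := ⟨p - 1, by omega⟩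
        have : ⇑(codegen h s) ∘ ⇑(front hpq) =
            (front (q := q) (by omega)) ∘ (codegen rfl (⟨s, hsp⟩ : Fin (p' + 1))) := by
          ext y
          simp only [Function.comp_apply]
          grind [coe_codegen, coe_front, coe_back]
        rw [this, Form.pullFun_eq_zero_of_factor _ _ (Nat.lt_succ_self p'), map_zero, zero_mul]
      · obtain ⟨q', rfl⟩ : ∃ m, q = m + 1 := ⟨q - 1, by omega⟩
        have : ⇑(codegen h s) ∘ ⇑(back hpq) =
            (back (p := p) (by omega)) ∘ (codegen rfl (⟨s - p, by omega⟩ : Fin (q' + 1))) := by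
          ext y
          simp only [Function.comp_apply]
          grind [coe_codegen, coe_front, coe_back]
        rw [this, Form.pullFun_eq_zero_of_factor _ _ (Nat.lt_succ_self q'), map_zero, mul_zero]
    rw [e1, Bil.wedge_apply hpq]
    have e2 := Form.pull_mul p q r hpq (codegen h s) ω η
    rw [Form.pull_eq_zero _ (by omega)] at e2
    rw [← Form.pull_eq_pullFun, ← Form.pull_eq_pullFun, ← e2, map_zero, sub_zero]
  · rw [Bil.wedge_of_ne hpq, Bil.cup_of_ne hpq]
    simp

/-- The obstructions to the multiplicativity of integration. -/
def Bil.obstruction : ∀ r, Bil K r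
  | 0 => Bil.psi 0
  | r + 1 => Bil.psi (r + 1) - Bil.faceSum (Bil.cyl (Bil.obstruction r))

/-- The homotopy for the multiplicativity of integration. -/
def Bil.theta (r : ℕ) : Bil K r := Bil.cyl (Bil.obstruction r)

/-- These are the two conditions under which `Bil.dB_cyl` solves for the next θ. If the obstruction
on Δ^r is d^* θ_r = ψ_r - δ θ_{r-1}, then applying d^* to ψ_{r+1} - δ θ_r gives δ ψ_r - δ (ψ_r - δ
θ_{r-1}) = 0, because δ δ = 0. -/
theorem Bil.obstruction_spec [CharZero K] (r : ℕ) : Bil.dB (Bil.obstruction (K := K) r) = 0 ∧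
    Bil.obstruction (K := K) r 0 0 (Form.one K r) (Form.one K r) = 0 := by
  induction r with
  | zero =>
    refine ⟨Bil.dB_psi_zero, ?_⟩
    rw [Bil.obstruction, Bil.psi, Bil.sub_apply, Bil.wedge_apply (p := 0) (q := 0) (r := 0) rfl,
      Bil.cup_apply (p := 0) (q := 0) (r := 0) rfl, Form.pull_eq_pullFun, Form.pull_eq_pullFun,
      Form.pullFun_one, Form.pullFun_one, Form.integral_one, Form.one, Form.mul_tmul]
    have : extMul (K := K) 0 0 0 rfl (extUnit (Cotangent K 0)) (extUnit (Cotangent K 0)) = extUnit (Cotangent K 0) :=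
      Subtype.ext (mul_one _)
    rw [this, mul_one, ← Form.one, Form.integral_one, mul_one, sub_self]
  | succ r ih =>
    have h1 := Bil.dB_cyl _ ih.1 ih.2
    constructor
    · rw [Bil.obstruction, Bil.dB_sub, Bil.dB_psi, Bil.dB_faceSum, h1, ← Bil.faceSum_sub]
      cases r with
      | zero => 
        rw [Bil.obstruction]
        refine Bil.ext fun p q ω η => ?_
        rw [Bil.faceSum_apply]
        simp only [Bil.sub_apply, sub_self, smul_zero, Finset.sum_const_zero]
        rfl
      | succ r => 
        rw [Bil.obstruction, ← Bil.faceSum_faceSum (Bil.cyl (Bil.obstruction r))]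
        exact congrArg Bil.faceSum (Bil.ext fun p q ω η => sub_sub_cancel _ _)
    -- In bidegree (0, 0) both products vanish on a simplex of positive dimension, and `Bil.cyl` is
    -- zero there by definition.
    · rw [Bil.obstruction, Bil.psi, Bil.sub_apply, Bil.sub_apply, Bil.wedge_of_ne (by omega), Bil.cup_of_ne (by omega), Bil.faceSum_apply]
      simp [Bil.cyl_zero_zero]

theorem Bil.dB_theta [CharZero K] (r : ℕ) : Bil.dB (Bil.theta (K := K) r) = Bil.obstruction r :=
  Bil.dB_cyl _ (Bil.obstruction_spec r).1 (Bil.obstruction_spec r).2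

theorem Bil.psi_zero [CharZero K] : Bil.psi (K := K) 0 = Bil.dB (Bil.theta 0) := by
  rw [Bil.dB_theta, Bil.obstruction]

theorem Bil.psi_succ [CharZero K] (r : ℕ) :
    Bil.psi (K := K) (r + 1) = Bil.faceSum (Bil.theta r) + Bil.dB (Bil.theta (r + 1)) := by
  rw [Bil.dB_theta, Bil.obstruction, Bil.theta]
  exact Bil.ext fun p q ω η => (add_sub_cancel _ _).symm

/-! ### Compatibility of the homotopy with the codegeneracies -/

theorem codegen_zero {p p' : ℕ} (h : p' + 1 = p) (k : Fin (p' + 1)) : codegen h k 0 = 0 := by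
  ext
  rw [coe_codegen]
  simp

theorem Bil.push_codegen_faceSum {r : ℕ} (θ : Bil K r)
    (hθ : ∀ (r' : ℕ) (h : r' + 1 = r) (s : Fin (r' + 1)), Bil.push (codegen h s) θ = 0)
    (r' : ℕ) (h : r' + 1 = r + 1) (s : Fin (r' + 1)) : Bil.push (codegen h s) (Bil.faceSum θ) = 0 := by
  rw [Bil.faceSum_eq_delta]
  exact (CosimplicialDGAlg.mem_normSub (p := r + 1) (i := 0) _).mp
    (bilCosimplicial.delta_mem r (r + 1) 0 rfl θ
      ((CosimplicialDGAlg.mem_normSub (p := r) (i := 0) _).mpr hθ)) r' h s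

/-- Codegeneracies fix the vertex 0, so they commute with `Bil.cyl`. They kill ψ, and by induction
and the simplicial identities also the face sum of the previous θ. -/
theorem Bil.push_codegen_theta (r r' : ℕ) (h : r' + 1 = r) (s : Fin (r' + 1)) :
    Bil.push (codegen h s) (Bil.theta (K := K) r) = 0 := by
  induction r generalizing r' with
  | zero => omega
  | succ r ih =>
    rw [Bil.theta, Bil.push_cyl _ (codegen_zero h s), Bil.obstruction]
    have e : Bil.push (codegen h s) (Bil.psi (K := K) (r + 1) - Bil.faceSum (Bil.cyl (Bil.obstruction r))) =
        Bil.push (codegen h s) (Bil.psi (r + 1)) -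
          Bil.push (codegen h s) (Bil.faceSum (Bil.cyl (Bil.obstruction r))) := rfl
    rw [e, Bil.push_codegen_psi, ← Bil.theta, Bil.push_codegen_faceSum _ ih]
    exact (congrArg Bil.cyl (Bil.ext fun p q ω η => sub_zero _)).trans Bil.cyl_zero

end Bilinear

/-! ### Pairings of completed tensor products -/

section Pairing

variable {K : Type u} [Field K]
  {V V' W W' : Type u} [AddCommGroup V] [Module K V] [AddCommGroup V'] [Module K V']
  [AddCommGroup W] [Module K W] [AddCommGroup W'] [Module K W']
  {M N P M' N' P' : Type v} [AddCommGroup M] [Module K M] [AddCommGroup N] [Module K N]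
  [AddCommGroup P] [Module K P] [AddCommGroup M'] [Module K M'] [AddCommGroup N'] [Module K N']
  [AddCommGroup P'] [Module K P']
  {D : DirInv.{u, v, w} K M} {E : DirInv.{u, v, w} K N} {G : DirInv.{u, v, w} K P}
  {D' : DirInv.{u, v, w} K M'} {E' : DirInv.{u, v, w} K N'} {G' : DirInv.{u, v, w} K P'}

/-- The pairing of completed tensor products with values in a complete module that is induced by a
bilinear form and a continuous bilinear map. -/
def ctPair (θ : V →ₗ[K] V' →ₗ[K] K) (φ : M →ₗ[K] N →ₗ[K] P) (hφ : DirInv.Cont₂ D E G φ)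
    (hG : G.IsComplete) : CTensor V D →ₗ[K] CTensor V' E →ₗ[K] P :=
  (ctMap₂ θ φ hφ).compr₂ (ctContract LinearMap.id hG)

variable {φ : M →ₗ[K] N →ₗ[K] P} {hφ : DirInv.Cont₂ D E G φ} {hG : G.IsComplete}

theorem ctPair_apply (θ : V →ₗ[K] V' →ₗ[K] K) (x : CTensor V D) (y : CTensor V' E) :
    ctPair θ φ hφ hG x y = ctContract LinearMap.id hG (ctMap₂ θ φ hφ x y) := rfl

theorem ctPair_add (θ θ' : V →ₗ[K] V' →ₗ[K] K) (x : CTensor V D) (y : CTensor V' E) :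
    ctPair (θ + θ') φ hφ hG x y = ctPair θ φ hφ hG x y + ctPair θ' φ hφ hG x y := by
  simp only [ctPair_apply]
  rw [← map_add]
  congr 1
  obtain ⟨x, rfl⟩ := DirInv.cls_surjective _ x
  obtain ⟨y, rfl⟩ := DirInv.cls_surjective _ y
  simp only [ctMap₂, DirInv.complMap₂_cls]
  rw [← map_add]
  congr 1
  refine Subtype.ext (funext fun n => ?_)
  simp only [DirInv.cauchyMap₂, LinearMap.mk₂_apply, Submodule.coe_add, Pi.add_apply]
  induction (x : ℕ → V ⊗[K] M) n using TensorProduct.induction_on with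
  | zero => simp
  | add x y hx hy => simp only [map_add, LinearMap.add_apply, hx, hy]; abel
  | tmul v m =>
  induction (y : ℕ → V' ⊗[K] N) n using TensorProduct.induction_on with
  | zero => simp
  | add x y hx hy => simp only [map_add, hx, hy]; abel
  | tmul v' m' => simp [TensorProduct.add_tmul]

theorem ctPair_smul (a : K) (θ : V →ₗ[K] V' →ₗ[K] K) (x : CTensor V D) (y : CTensor V' E) :
    ctPair (a • θ) φ hφ hG x y = a • ctPair θ φ hφ hG x y := by
  simp only [ctPair_apply]
  rw [← map_smul]
  congr 1
  obtain ⟨x, rfl⟩ := DirInv.cls_surjective _ x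
  obtain ⟨y, rfl⟩ := DirInv.cls_surjective _ y
  simp only [ctMap₂, DirInv.complMap₂_cls]
  rw [← map_smul]
  congr 1
  refine Subtype.ext (funext fun n => ?_)
  simp only [DirInv.cauchyMap₂, LinearMap.mk₂_apply, Submodule.coe_smul, Pi.smul_apply]
  induction (x : ℕ → V ⊗[K] M) n using TensorProduct.induction_on with
  | zero => simp
  | add x y hx hy => simp only [map_add, LinearMap.add_apply, hx, hy, smul_add]
  | tmul v m =>
  induction (y : ℕ → V' ⊗[K] N) n using TensorProduct.induction_on with
  | zero => simp
  | add x y hx hy => simp only [map_add, hx, hy, smul_add]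
  | tmul v' m' => simp [TensorProduct.smul_tmul']

theorem ctPair_zero (x : CTensor V D) (y : CTensor V' E) :
    ctPair (0 : V →ₗ[K] V' →ₗ[K] K) φ hφ hG x y = 0 := by
  simpa using ctPair_smul (φ := φ) (hφ := hφ) (hG := hG) (0 : K) (0 : V →ₗ[K] V' →ₗ[K] K) x y

theorem ctPair_sum {ι : Type*} (s : Finset ι) (θ : ι → V →ₗ[K] V' →ₗ[K] K) (x : CTensor V D)
    (y : CTensor V' E) :
    ctPair (∑ i ∈ s, θ i) φ hφ hG x y = ∑ i ∈ s, ctPair (θ i) φ hφ hG x y := by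
  classical
  induction s using Finset.induction_on with
  | empty => simpa using ctPair_zero x y
  | insert a s ha ih => rw [Finset.sum_insert ha, Finset.sum_insert ha, ctPair_add, ih]

theorem ctPair_compl₁₂ (θ : W →ₗ[K] W' →ₗ[K] K) (g : V →ₗ[K] W) (g' : V' →ₗ[K] W') (x : CTensor V D)
    (y : CTensor V' E) :
    ctPair (θ.compl₁₂ g g') φ hφ hG x y = ctPair θ φ hφ hG (ctLeft D g x) (ctLeft E g' y) := by
  rw [ctPair_apply, ctPair_apply]
  have := ctMap_ctMap₂ (γ := θ.compl₁₂ g g') (γ' := θ) (g₁ := g) (g₂ := g') (g₃ := LinearMap.id)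
    (fun _ _ => rfl) (φ := φ) (φ' := φ) (hφ := hφ) (hφ' := hφ) (f₁ := LinearMap.id)
    (hf₁ := DirInv.Cont.id D) (f₂ := LinearMap.id) (hf₂ := DirInv.Cont.id E) (f₃ := LinearMap.id)
    (hf₃ := DirInv.Cont.id G) (fun _ _ => rfl) x y
  rw [← this]
  exact congrArg _ (ctLeft_id _).symm

theorem ctPair_compr₂ (γ : V →ₗ[K] V' →ₗ[K] W) (c : W →ₗ[K] K) (x : CTensor V D) (y : CTensor V' E) :
    ctPair (γ.compr₂ c) φ hφ hG x y = ctContract c hG (ctMap₂ γ φ hφ x y) := by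
  rw [ctPair_apply]
  have := ctMap_ctMap₂ (γ := γ) (γ' := γ.compr₂ c) (g₁ := LinearMap.id) (g₂ := LinearMap.id) (g₃ := c)
    (fun _ _ => rfl) (φ := φ) (φ' := φ) (hφ := hφ) (hφ' := hφ) (f₁ := LinearMap.id)
    (hf₁ := DirInv.Cont.id D) (f₂ := LinearMap.id) (hf₂ := DirInv.Cont.id E) (f₃ := LinearMap.id)
    (hf₃ := DirInv.Cont.id G) (fun _ _ => rfl) x y
  have h2 := congrArg (ctContract LinearMap.id hG) this
  refine Eq.trans ?_ (h2.symm.trans (ctContract_ctLeft c LinearMap.id hG _))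
  exact congrArg₂ (fun a b => ctContract LinearMap.id hG (ctMap₂ (γ.compr₂ c) φ hφ a b))
    (ctLeft_id x).symm (ctLeft_id y).symm

theorem ctMap₂_ctTmul (γ : V →ₗ[K] V' →ₗ[K] W) (hD : D.IsComplete) (hE : E.IsComplete) (a : V) (b : V')
    (m : M) (n : N) :
    ctMap₂ γ φ hφ (ctTmul a hD m) (ctTmul b hE n) = ctTmul (γ a b) hG (φ m n) := by
  have key : hG.equiv (φ m n) = DirInv.complMap₂ φ hφ (hD.equiv m) (hE.equiv n) := rfl
  simp only [ctTmul, LinearMap.comp_apply, LinearEquiv.coe_coe, key]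
  obtain ⟨y, hy⟩ := DirInv.cls_surjective _ (hD.equiv m)
  obtain ⟨z, hz⟩ := DirInv.cls_surjective _ (hE.equiv n)
  rw [← hy, ← hz]
  simp only [DirInv.complMap_cls, DirInv.complMap₂_cls, ctMap₂]
  congr 1

/-- A decomposable bilinear form factors through K × K, where both arguments become elements 1 ⊗ m
and the pairing is φ itself. -/
theorem ctPair_mul (hD : D.IsComplete) (hE : E.IsComplete) (c : V →ₗ[K] K) (c' : V' →ₗ[K] K)
    (x : CTensor V D) (y : CTensor V' E) :
    ctPair ((LinearMap.mul K K).compl₁₂ c c') φ hφ hG x y =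
      φ (ctContract c hD x) (ctContract c' hE y) := by
  have h1 : ∀ c : V →ₗ[K] K, ctLeft D c x = ctTmul (1 : K) hD (ctContract c hD x) := fun c => by
    rw [ctTmul_ctContract]
    exact congrArg (fun g => ctLeft D g x) (LinearMap.ext fun z => (mul_one (c z)).symm)
  have h2 : ∀ c : V' →ₗ[K] K, ctLeft E c y = ctTmul (1 : K) hE (ctContract c hE y) := fun c => by
    rw [ctTmul_ctContract]
    exact congrArg (fun g => ctLeft E g y) (LinearMap.ext fun z => (mul_one (c z)).symm)
  rw [ctPair_compl₁₂, h1, h2, ctPair_apply, ctMap₂_ctTmul (hG := hG), ctContract_ctTmul]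
  simp

theorem ctPair_sum_smul_compl₁₂ {ι : Type*} (s : Finset ι) (a : ι → K) (θ : W →ₗ[K] W' →ₗ[K] K)
    (g : ι → V →ₗ[K] W) (g' : ι → V' →ₗ[K] W') (x : CTensor V D) (y : CTensor V' E) :
    ctPair (∑ i ∈ s, a i • θ.compl₁₂ (g i) (g' i)) φ hφ hG x y =
      ∑ i ∈ s, a i • ctPair (θ.compl₁₂ (g i) (g' i)) φ hφ hG x y := by
  simp only [ctPair_sum, ctPair_smul]

theorem ctPair_comp_add_compl₂ (θ : W →ₗ[K] V' →ₗ[K] K) (θ' : V →ₗ[K] W' →ₗ[K] K) (g : V →ₗ[K] W)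
    (g' : V' →ₗ[K] W') (a : K) (x : CTensor V D) (y : CTensor V' E) :
    ctPair (θ ∘ₗ g + a • θ'.compl₂ g') φ hφ hG x y =
      ctPair θ φ hφ hG (ctLeft D g x) y + a • ctPair θ' φ hφ hG x (ctLeft E g' y) := by
  rw [ctPair_add, ctPair_smul]
  have h1 := ctPair_compl₁₂ (φ := φ) (hφ := hφ) (hG := hG) θ g LinearMap.id x y
  have h2 := ctPair_compl₁₂ (φ := φ) (hφ := hφ) (hG := hG) θ' LinearMap.id g' x y
  rw [ctLeft_id] at h1 h2
  exact congrArg₂ (fun b c => b + a • c) h1 h2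

theorem map_ctPair (θ : V →ₗ[K] V' →ₗ[K] K) {φ' : M' →ₗ[K] N' →ₗ[K] P'}
    {hφ' : DirInv.Cont₂ D' E' G' φ'} {hG' : G'.IsComplete}
    {f₁ : M →ₗ[K] M'} {hf₁ : DirInv.Cont D D' f₁} {f₂ : N →ₗ[K] N'} {hf₂ : DirInv.Cont E E' f₂}
    {f₃ : P →ₗ[K] P'} {hf₃ : DirInv.Cont G G' f₃} (hf : ∀ x y, f₃ (φ x y) = φ' (f₁ x) (f₂ y))
    (x : CTensor V D) (y : CTensor V' E) :
    f₃ (ctPair θ φ hφ hG x y) =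
      ctPair θ φ' hφ' hG' (ctMap LinearMap.id f₁ hf₁ x) (ctMap LinearMap.id f₂ hf₂ y) := by
  rw [ctPair_apply, ctPair_apply, map_ctContract LinearMap.id hG hG' f₃ hf₃,
    ctMap_ctMap₂ (γ' := θ) (g₁ := LinearMap.id) (g₂ := LinearMap.id) (fun _ _ => rfl) hf]

theorem leibniz_ctPair (θ : V →ₗ[K] V' →ₗ[K] K)
    {φ₁ : M' →ₗ[K] N →ₗ[K] P'} {hφ₁ : DirInv.Cont₂ D' E G' φ₁}
    {φ₂ : M →ₗ[K] N' →ₗ[K] P'} {hφ₂ : DirInv.Cont₂ D E' G' φ₂} {hG' : G'.IsComplete}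
    {f₁ : M →ₗ[K] M'} {hf₁ : DirInv.Cont D D' f₁} {f₂ : N →ₗ[K] N'} {hf₂ : DirInv.Cont E E' f₂}
    {f₃ : P →ₗ[K] P'} {hf₃ : DirInv.Cont G G' f₃} {c : K}
    (hf : ∀ x y, f₃ (φ x y) = φ₁ (f₁ x) y + c • φ₂ x (f₂ y)) (x : CTensor V D) (y : CTensor V' E) :
    f₃ (ctPair θ φ hφ hG x y) =
      ctPair θ φ₁ hφ₁ hG' (ctMap LinearMap.id f₁ hf₁ x) y +
        c • ctPair θ φ₂ hφ₂ hG' x (ctMap LinearMap.id f₂ hf₂ y) := by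
  rw [ctPair_apply, ctPair_apply, ctPair_apply, map_ctContract LinearMap.id hG hG' f₃ hf₃,
    ct_leibniz (γ₁ := θ) (γ₂ := θ) (g₁ := LinearMap.id) (g₂ := LinearMap.id) (φ₁ := φ₁) (hφ₁ := hφ₁)
      (φ₂ := φ₂) (hφ₂ := hφ₂) (f₁ := f₁) (hf₁ := hf₁) (f₂ := f₂) (hf₂ := hf₂) (c := c)
      (fun v m v' m' => by
        rw [hf, TensorProduct.tmul_add, TensorProduct.tmul_smul]
        rfl), map_add, map_smul]

end Pairing

namespace CosimplicialDGAlg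

/-! ### Multiplicativity of the integration -/

variable {K : Type u} [Field K] {A : CosimplicialDGAlg.{u, v, w} K}
  (hA : ∀ q i, ((A.obj q).D i).IsComplete)

/-- The pairing on the Thom-Sullivan normalization that is induced by a bilinear form on the
differential forms on one simplex. -/
def thomPair {r p q : ℕ} (θ : Form K r p →ₗ[K] Form K r q →ₗ[K] K) (i j k : ℤ) (e : i + j = k) :
    A.thomSub p i →ₗ[K] A.thomSub q j →ₗ[K] (A.obj r).X k :=
  (ctPair θ ((A.obj r).mul i j k e) ((A.obj r).mul_cont i j k e) (hA r k)).compl₁₂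
    (LinearMap.proj r ∘ₗ (A.thomSub p i).subtype) (LinearMap.proj r ∘ₗ (A.thomSub q j).subtype)

theorem thomPair_apply {r p q : ℕ} (θ : Form K r p →ₗ[K] Form K r q →ₗ[K] K) (i j k : ℤ) (e : i + j = k)
    (x : A.thomSub p i) (y : A.thomSub q j) : thomPair hA θ i j k e x y =
      ctPair θ ((A.obj r).mul i j k e) ((A.obj r).mul_cont i j k e) (hA r k) (x.1 r) (y.1 r) := rfl

theorem thomPair_add {r p q : ℕ} (θ θ' : Form K r p →ₗ[K] Form K r q →ₗ[K] K) (i j k : ℤ) (e : i + j = k)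
    (x : A.thomSub p i) (y : A.thomSub q j) : thomPair hA (θ + θ') i j k e x y =
      thomPair hA θ i j k e x y + thomPair hA θ' i j k e x y :=
  ctPair_add (hG := hA r k) θ θ' (x.1 r) (y.1 r)

theorem thomPair_zero {r p q : ℕ} (i j k : ℤ) (e : i + j = k) (x : A.thomSub p i) (y : A.thomSub q j) :
    thomPair hA (0 : Form K r p →ₗ[K] Form K r q →ₗ[K] K) i j k e x y = 0 :=
  ctPair_zero (hG := hA r k) (x.1 r) (y.1 r)

/-- Compatibility of both sequences moves α from the coefficients to the forms. Thus θ ↦ pairing is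
a map of cosimplicial modules, and identities between bilinear forms become identities in A. -/
theorem map_thomPair {r s p q : ℕ} (α : Fin (r + 1) →o Fin (s + 1))
    (θ : Form K r p →ₗ[K] Form K r q →ₗ[K] K) (i j k : ℤ) (e : i + j = k)
    (x : A.thomSub p i) (y : A.thomSub q j) :
    A.map α k (thomPair hA θ i j k e x y) =
      thomPair hA (θ.compl₁₂ (Form.pull p α) (Form.pull q α)) i j k e x y := by
  rw [thomPair_apply, thomPair_apply, ctPair_compl₁₂,
    map_ctPair θ (hG' := hA s k) (hf₁ := A.map_cont α i) (hf₂ := A.map_cont α j) (hf₃ := A.map_cont α k)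
      (A.map_mul α i j k e)]
  have h1 := A.mem_thomSub.mp x.2 r s α
  have h2 := A.mem_thomSub.mp y.2 r s α
  exact congrArg₂ (fun a b => ctPair θ ((A.obj s).mul i j k e) ((A.obj s).mul_cont i j k e) (hA s k) a b) h1 h2

theorem thomPair_faceSum {r p q : ℕ} (θ : Bil K r) (i j k : ℤ) (e : i + j = k)
    (x : A.thomSub p i) (y : A.thomSub q j) :
    thomPair hA (Bil.faceSum θ p q) i j k e x y =
      A.delta r (r + 1) k rfl (thomPair hA (θ p q) i j k e x y) := by
  have h : Bil.faceSum θ p q = ∑ s ∈ Finset.range (r + 2), (-1 : K) ^ s •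
      (θ p q).compl₁₂ (Form.pull p (coface rfl s)) (Form.pull q (coface rfl s)) := by
    refine LinearMap.ext fun ω => LinearMap.ext fun η => ?_
    rw [Bil.faceSum_apply]
    simp only [LinearMap.sum_apply, LinearMap.smul_apply, LinearMap.compl₁₂_apply]
  rw [h, delta_apply]
  refine (ctPair_sum_smul_compl₁₂ (hG := hA (r + 1) k) _ _ _ _ _ _ _).trans ?_
  exact Finset.sum_congr rfl fun s _ => congrArg ((-1 : K) ^ s • ·)
    (map_thomPair hA (coface rfl s) (θ p q) i j k e x y).symm

theorem thomPair_dB [CharZero K] {r p q : ℕ} (θ : Bil K r) (i j k : ℤ) (e : i + j = k)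
    (x : A.thomSub p i) (y : A.thomSub q j) :
    thomPair hA (Bil.dB θ p q) i j k e x y =
      thomPair hA (θ (p + 1) q) i j k e (A.thomDh p (p + 1) i rfl x) y +
        (-1 : K) ^ p • thomPair hA (θ p (q + 1)) i j k e x (A.thomDh q (q + 1) j rfl y) :=
  ctPair_comp_add_compl₂ (hG := hA r k) (θ (p + 1) q) (θ p (q + 1)) (Form.dS r p) (Form.dS r q)
    ((-1 : K) ^ p) (x.1 r) (y.1 r)

theorem thomPair_wedge {p q r : ℕ} (h : p + q = r) (i j k : ℤ) (e : i + j = k)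
    (x : A.thomSub p i) (y : A.thomSub q j) :
    thomPair hA (Bil.wedge K r p q) i j k e x y =
      ctContract (Form.integral r) (hA r k) (A.formTensorMul r p q r i j k h e (x.1 r) (y.1 r)) := by
  have h1 : Bil.wedge K r p q = (Form.mul r p q r h).compr₂ (Form.integral r) := dif_pos h
  rw [h1]
  exact ctPair_compr₂ (hG := hA r k) (Form.mul r p q r h) (Form.integral r) (x.1 r) (y.1 r)

theorem thomPair_cup {p q r : ℕ} (h : p + q = r) (i j k : ℤ) (e : i + j = k)
    (x : A.thomSub p i) (y : A.thomSub q j) :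
    thomPair hA (Bil.cup K r p q) i j k e x y =
      A.awMul p q r i j k h e (A.integralBi hA p i x).1 (A.integralBi hA q j y).1 := by
  have h1 : Bil.cup K r p q = (LinearMap.mul K K).compl₁₂ (Form.integral p ∘ₗ Form.pull p (front h))
    (Form.integral q ∘ₗ Form.pull q (back h)) := dif_pos h
  rw [h1]
  refine (ctPair_mul (hG := hA r k) (hA r i) (hA r j) (Form.integral p ∘ₗ Form.pull p (front h))
    (Form.integral q ∘ₗ Form.pull q (back h)) (x.1 r) (y.1 r)).trans ?_
  exact congrArg₂ (fun a b => (A.obj r).mul i j k e a b)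
    (ctContract_pull_thom hA x.2 (front h) (Form.integral p))
    (ctContract_pull_thom hA y.2 (back h) (Form.integral q))

/-- The homotopy for the multiplicativity of the integration. -/
def thomHomotopy (p q r : ℕ) (i j k : ℤ) (e : i + j = k) :
    A.thomSub p i →ₗ[K] A.thomSub q j →ₗ[K] A.normSub r k :=
  LinearMap.mk₂ K
    (fun x y => ⟨thomPair hA (Bil.theta r p q) i j k e x y, by
      rw [mem_normSub]
      intro r' h s
      rw [map_thomPair]
      have h0 : (Bil.theta (K := K) r p q).compl₁₂ (Form.pull p (codegen h s))
          (Form.pull q (codegen h s)) = 0 :=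
        congrFun (congrFun (Bil.push_codegen_theta (K := K) r r' h s) p) q
      rw [h0, thomPair_zero]⟩)
    (fun _ _ _ => Subtype.ext (LinearMap.map_add₂ _ _ _ _))
    (fun _ _ _ => Subtype.ext (LinearMap.map_smul₂ _ _ _ _))
    (fun _ _ _ => Subtype.ext (map_add _ _ _))
    (fun _ _ _ => Subtype.ext (map_smul _ _ _))

variable (A) in
/-- The product of the Thom-Sullivan normalization, without sign. -/
def thomMul [CharZero K] (p q r : ℕ) (i j k : ℤ) (h : p + q = r) (e : i + j = k) :
    A.thomSub p i →ₗ[K] A.thomSub q j →ₗ[K] A.thomSub r k := A.thomBi.mul p q r i j k h e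

variable (A) in
/-- The product of the standard normalization, without sign. -/
def normMul (p q r : ℕ) (i j k : ℤ) (h : p + q = r) (e : i + j = k) :
    A.normSub p i →ₗ[K] A.normSub q j →ₗ[K] A.normSub r k := A.normBi.mul p q r i j k h e

theorem integralBi_mul_sub [CharZero K] (p q r : ℕ) (i j k : ℤ) (h : p + q = r) (e : i + j = k)
    (x : A.thomSub p i) (y : A.thomSub q j) :
    (A.integralBi hA r k (A.thomMul p q r i j k h e x y) -
      A.normMul p q r i j k h e (A.integralBi hA p i x) (A.integralBi hA q j y)).1 =
        thomPair hA (Bil.psi r p q) i j k e x y := by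
  have h1 : Bil.wedge K r p q = Bil.psi r p q + Bil.cup K r p q :=
    LinearMap.ext fun _ => LinearMap.ext fun _ => (sub_add_cancel _ _).symm
  have h2 := thomPair_wedge hA h i j k e x y
  rw [h1, thomPair_add, thomPair_cup hA h] at h2
  rw [Submodule.coe_sub]
  exact sub_eq_of_eq_add h2.symm

theorem integralBi_mul_sub_zero [CharZero K] (i j k : ℤ) (e : i + j = k)
    (x : A.thomSub 0 i) (y : A.thomSub 0 j) :
    A.integralBi hA 0 k (A.thomMul 0 0 0 i j k rfl e x y) -
      A.normMul 0 0 0 i j k rfl e (A.integralBi hA 0 i x) (A.integralBi hA 0 j y) =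
        thomHomotopy hA 1 0 0 i j k e (A.thomDh 0 1 i rfl x) y +
          thomHomotopy hA 0 1 0 i j k e x (A.thomDh 0 1 j rfl y) := by
  refine Subtype.ext ?_
  have h1 : Bil.psi (K := K) 0 0 0 = Bil.dB (Bil.theta 0) 0 0 :=
    congrFun (congrFun (Bil.psi_zero (K := K)) 0) 0
  have h2 : ∀ z : (A.obj 0).X k, (-1 : K) ^ 0 • z = z := fun z => by rw [pow_zero, one_smul]
  refine (integralBi_mul_sub hA 0 0 0 i j k rfl e x y).trans ?_
  refine (congrArg (fun θ => thomPair hA θ i j k e x y) h1).trans ?_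
  exact (thomPair_dB hA (Bil.theta 0) i j k e x y).trans (congrArg (_ + ·) (h2 _))

/-- The image of `Bil.psi_succ` under the pairing: the face sum becomes the cosimplicial
differential, the dual differential becomes the exterior derivatives of the arguments. -/
theorem integralBi_mul_sub_succ [CharZero K] (p q r : ℕ) (i j k : ℤ) (h : p + q = r + 1) (e : i + j = k)
    (x : A.thomSub p i) (y : A.thomSub q j) :
    A.integralBi hA (r + 1) k (A.thomMul p q (r + 1) i j k h e x y) -
      A.normMul p q (r + 1) i j k h e (A.integralBi hA p i x) (A.integralBi hA q j y) =
        A.normDh r (r + 1) k rfl (thomHomotopy hA p q r i j k e x y) +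
          thomHomotopy hA (p + 1) q (r + 1) i j k e (A.thomDh p (p + 1) i rfl x) y +
          (-1 : K) ^ p • thomHomotopy hA p (q + 1) (r + 1) i j k e x (A.thomDh q (q + 1) j rfl y) := by
  have h1 : Bil.psi (K := K) (r + 1) p q = Bil.faceSum (Bil.theta r) p q + Bil.dB (Bil.theta (r + 1)) p q :=
    congrFun (congrFun (Bil.psi_succ (K := K) r) p) q
  refine Subtype.ext ?_
  refine (integralBi_mul_sub hA p q (r + 1) i j k h e x y).trans ?_
  refine (congrArg (fun θ => thomPair hA θ i j k e x y) h1).trans ?_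
  refine (thomPair_add hA (Bil.faceSum (Bil.theta r) p q) (Bil.dB (Bil.theta (r + 1)) p q) i j k e x
    y).trans ?_
  refine (congrArg₂ (· + ·) (thomPair_faceSum hA (Bil.theta r) i j k e x y)
    (thomPair_dB hA (Bil.theta (r + 1)) i j k e x y)).trans ?_
  exact (add_assoc _ _ _).symm

/-- The bilinear form only sees the form factor, so this is the Leibniz rule of the coefficients
A^r. -/
theorem thomHomotopy_dv [CharZero K] (p q r : ℕ) (i j k i' j' k' : ℤ) (e : i + j = k) (ei : i + 1 = i')
    (ej : j + 1 = j') (ek : k + 1 = k') (e1 : i' + j = k') (e2 : i + j' = k') (x : A.thomSub p i)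
    (y : A.thomSub q j) :
    (A.obj r).d k k' ek (thomHomotopy hA p q r i j k e x y).1 =
      (thomHomotopy hA p q r i' j k' e1 (A.thomDv p i i' ei x) y +
        (-1 : K) ^ i • thomHomotopy hA p q r i j' k' e2 x (A.thomDv q j j' ej y)).1 :=
  leibniz_ctPair (Bil.theta r p q) (hG := hA r k) (hG' := hA r k') (hf₁ := (A.obj r).d_cont i i' ei)
    (hf₂ := (A.obj r).d_cont j j' ej) (hf₃ := (A.obj r).d_cont k k' ek)
    ((A.obj r).leibniz i j k i' j' k' e ei ej ek e1 e2) (x.1 r) (y.1 r)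

/-! ### Integration on the total complexes and in cohomology -/

theorem isCochainMap_integral [CharZero K] : DGAlg.IsCochainMap A.TS A.N (A.integral hA) :=
  BiDGAlg.isCochainMap_totMap (B := A.thomBi) (C := A.normBi) (f := A.integralBi hA)
    (by rintro p _ i rfl x; exact integralBi_dh hA p i x)
    (fun p i i' h x => Subtype.ext (coe_integralBi_thomDv hA p i i' h x))

theorem mapH_integral_bijective [CharZero K] (n : ℤ) :
    Function.Bijective (DGAlg.mapH (isCochainMap_integral hA) n) :=
  DGAlg.mapH_bijective (isCochainMap_integral hA)
    (BiDGAlg.totMap_surjective (B := A.thomBi) (C := A.normBi) (f := A.integralBi hA)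
      (A.integralBi_surjective hA))
    (fun n' n h => BiDGAlg.totS (B := A.thomBi) A.thomDupont n' n h)
    (BiDGAlg.totMap_totS (B := A.thomBi) (C := A.normBi) (f := A.integralBi hA) A.thomDupont
      (integralBi_thomDupont hA))
    (fun n' n n'' h h' _ hx => BiDGAlg.totD_totS (B := A.thomBi) (C := A.normBi) (f := A.integralBi hA)
      A.thomDupont (by rintro p i _ rfl x; exact (A.thomDupont_dv p i x).symm)
      (thomDupont_dh_zero hA) (thomDupont_dh hA) n' n n'' h h' hx)
    (fun _ _ _ => map_zero _) n

theorem mapH_integral_mul [CharZero K] (m n : ℤ) (x : A.TS.H m) (y : A.TS.H n) :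
    DGAlg.mapH (isCochainMap_integral hA) (m + n) (A.TS.mulH m n (m + n) rfl x y) =
      A.N.mulH m n (m + n) rfl (DGAlg.mapH (isCochainMap_integral hA) m x)
        (DGAlg.mapH (isCochainMap_integral hA) n y) :=
  BiDGAlg.mapH_totMap_mul (B := A.thomBi) (C := A.normBi) (f := A.integralBi hA)
    (fun p q r i j k _ e => thomHomotopy hA p q r i j k e) (isCochainMap_integral hA)
    (integralBi_mul_sub_zero hA)
    (fun p q r i j k h _ _ e x y => integralBi_mul_sub_succ hA p q r i j k h e x y)
    (fun p q r i j k i' j' k' _ e ei ej ek e1 e2 x y => Subtype.ext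
      (thomHomotopy_dv hA p q r i j k i' j' k' e ei ej ek e1 e2 x y)) m n x y

end CosimplicialDGAlg

end ThomSullivan

end

/-- For a cosimplicial DG algebra `A` in dir-inv modules over a field of characteristic zero, all of
whose components are complete, integration is a homomorphism of DG modules from the complete
Thom-Sullivan normalization to the standard normalization, and it induces an isomorphism of graded
algebras in cohomology. -/
theorem mainTheorem9 {K : Type*} [Field K] [CharZero K]
    (A : ThomSullivan.CosimplicialDGAlg K) (hA : ∀ q i, ((A.obj q).D i).IsComplete) :
    ∃ h : ThomSullivan.DGAlg.IsCochainMap A.TS A.N (A.integral hA),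
      (∀ n, Function.Bijective (ThomSullivan.DGAlg.mapH h n)) ∧
      ∀ (m n : ℤ) (x : A.TS.H m) (y : A.TS.H n),
        ThomSullivan.DGAlg.mapH h (m + n) (A.TS.mulH m n (m + n) rfl x y) =
          A.N.mulH m n (m + n) rfl (ThomSullivan.DGAlg.mapH h m x)
            (ThomSullivan.DGAlg.mapH h n y) :=
  ⟨ThomSullivan.CosimplicialDGAlg.isCochainMap_integral hA,
    ThomSullivan.CosimplicialDGAlg.mapH_integral_bijective hA,
    ThomSullivan.CosimplicialDGAlg.mapH_integral_mul hA⟩
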